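/- Let $E_8\subset\mathbb Z^8$ be the root system consisting of the 112 vectors with two coordinates equal to $\pm2$ and the other six equal to $0$, together with the 128 vectors with all coordinates $\pm1$ and an even number of coordinates $-1$ (all of norm $2\sqrt2$). Let $E_7$ be the set of the 126 vectors of $E_8$ that are orthogonal to the all-ones vector (up to symmetry, any vector of $E_8$ may be used instead). A graph $G$ is *$E_7$-representable* if there is an injective map $f:V(G)\to E_7$ such that $\langle f(u),f(v)\rangle=4$ for adjacent vertices $u,v$ and $\langle f(u),f(v)\rangle=0$ for distinct non-adjacent vertices $u,v$. An $E_7$-representable graph is *maximal* if every $E_7$-representable graph that contains it as an induced subgraph is isomorphic to it. The *cone* over a graph is obtained by adding a new vertex adjacent to all its vertices, and a *cone graph* is a graph isomorphic to a cone over some graph. *Seidel switching* $G$ with respect to $X\subseteq V(G)$ complements the adjacencies between $X$ and $V(G)\setminus X$ and keeps all others. Let $\mathcal S_8$ be the class of graphs $G$ for which some Seidel switching of $G$ is isomorphic to the line graph of a graph on eight vertices. The *Schläfli graph* is the 27-vertex graph obtained from the line graph $L(K_8)$ by switching with respect to the set of neighbours of one vertex and deleting that (then isolated) vertex. Up to isomorphism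 there are exactly 39 maximal $E_7$-representable graphs. One of them is the Schläfli graph (which is not a cone graph), exactly 27 of them are cone graphs, and none of the remaining 11 graphs is a cone graph or an element of $\mathcal S_8$. -/

import Mathlib

open SimpleGraph
open scoped Matrix

universe u v

namespace MaximalE7

/-- The 240 vectors of the `E₈` root system, scaled so that they lie in `ℤ⁸` and have squared
length `8`: the 112 vectors with two coordinates `±2` and all others `0`, and the 128 vectors
with all coordinates `±1` and an even number of coordinates `-1` (hence also of `+1`). -/
def rootsE8 : Set (Fin 8 → ℤ) :=
  {x | (∃ i j, i ≠ j ∧ (x i = 2 ∨ x i = -2) ∧ (x j = 2 ∨ x j = -2) ∧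
          ∀ k, k ≠ i → k ≠ j → x k = 0) ∨
       ((∀ i, x i = 1 ∨ x i = -1) ∧ Even (Finset.univ.filter fun i => x i = -1).card)}

/-- The `E₇` root system, realised as the 126 vectors of `E₈` that are orthogonal to the
all-ones vector (which belongs to `E₈`). -/
def rootsE7 : Set (Fin 8 → ℤ) :=
  {x | x ∈ rootsE8 ∧ x ⬝ᵥ (1 : Fin 8 → ℤ) = 0}

/-- An `E₇`-representation: an injective map from the vertices to `E₇` sending distinct adjacent
vertices to vectors at angle 60° (inner product `4`) and distinct non-adjacent vertices to
orthogonal vectors. -/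
structure IsE7Representation {V : Type u} (G : SimpleGraph V) (f : V → Fin 8 → ℤ) : Prop where
  mem : ∀ a, f a ∈ rootsE7
  injective : Function.Injective f
  adj : ∀ a b, G.Adj a b → f a ⬝ᵥ f b = 4
  not_adj : ∀ a b, a ≠ b → ¬ G.Adj a b → f a ⬝ᵥ f b = 0

/-- A graph is `E₇`-representable if it has an `E₇`-representation. (Such a graph is finite.) -/
def E7Representable {V : Type u} (G : SimpleGraph V) : Prop :=
  ∃ f : V → Fin 8 → ℤ, IsE7Representation G f

/-- A graph is a maximal `E₇`-representable graph if it is `E₇`-representable and every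
`E₇`-representable graph containing it as an induced subgraph is isomorphic to it. -/
def IsMaximalE7Representable {V : Type u} (G : SimpleGraph V) : Prop :=
  E7Representable G ∧
    ∀ (W : Type u) (H : SimpleGraph W), E7Representable H → G ⊴ H → Nonempty (G ≃g H)

/-- The cone over `G`: a new vertex `none`, adjacent to all vertices of `G`, is added. -/
def cone {V : Type u} (G : SimpleGraph V) : SimpleGraph (Option V) :=
  SimpleGraph.fromRel fun x y => x = none ∨ ∃ a b, x = some a ∧ y = some b ∧ G.Adj a b

/-- A graph is a cone graph if it is isomorphic to the cone over some graph. -/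
def IsConeGraph {V : Type u} (G : SimpleGraph V) : Prop :=
  ∃ (W : Type u) (H : SimpleGraph W), Nonempty (G ≃g cone H)

/-- Seidel switching with respect to `X`: adjacency is kept between vertices on the same side
of `X` and complemented between vertices on different sides. -/
def seidelSwitch {V : Type u} (G : SimpleGraph V) (X : Set V) : SimpleGraph V :=
  SimpleGraph.fromRel fun a b => G.Adj a b ↔ (a ∈ X ↔ b ∈ X)

/-- `G` and `H` are switching-equivalent if some Seidel switching of `G` is isomorphic to `H`. -/
def SwitchingEquivalent {V : Type u} {W : Type v} (G : SimpleGraph V) (H : SimpleGraph W) : Prop :=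
  ∃ X : Set V, Nonempty (seidelSwitch G X ≃g H)

/-- The class `𝒮₈` of graphs that are switching-equivalent to the line graph of a graph on eight
vertices. -/
def InS8 {V : Type u} (G : SimpleGraph V) : Prop :=
  ∃ H : SimpleGraph (Fin 8), SwitchingEquivalent G H.lineGraph

/-- The edge `{0, 1}` of `K₈`, a vertex of `L(K₈)`. -/
def baseEdge : (⊤ : SimpleGraph (Fin 8)).edgeSet :=
  ⟨s(0, 1), by simp⟩

/-- The Schläfli graph: switch `L(K₈)` with respect to the neighbours of one vertex and delete
that vertex, which has become isolated. -/
def schlaefliGraph : SimpleGraph {x : (⊤ : SimpleGraph (Fin 8)).edgeSet // x ≠ baseEdge} :=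
  (seidelSwitch (⊤ : SimpleGraph (Fin 8)).lineGraph
    ((⊤ : SimpleGraph (Fin 8)).lineGraph.neighborSet baseEdge)).comap Subtype.val

theorem cone_adj_none {V : Type u} (G : SimpleGraph V) (a : V) :
    (cone G).Adj none (some a) := by
  simp [cone]

theorem cone_adj_some {V : Type u} (G : SimpleGraph V) (a b : V) :
    (cone G).Adj (some a) (some b) ↔ G.Adj a b := by
  simp only [cone, SimpleGraph.fromRel_adj]
  constructor
  · rintro ⟨-, h⟩
    simpa [G.adj_comm] using h
  · intro h
    exact ⟨by simpa using h.ne, by simp [h]⟩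

theorem seidelSwitch_adj {V : Type u} (G : SimpleGraph V) (X : Set V) (a b : V) :
    (seidelSwitch G X).Adj a b ↔ a ≠ b ∧ (G.Adj a b ↔ (a ∈ X ↔ b ∈ X)) := by
  simp only [seidelSwitch, SimpleGraph.fromRel_adj, G.adj_comm b a]
  tauto

end MaximalE7

namespace MaximalE7

/-! ### The 126 roots of `E₇` and their inner products -/

/-- Coordinates of the roots of `E₇`, increased by `2`, three bits each. The first two roots form
an edge; the next 75 are the further roots that have a non-negative inner product with both. -/
def rootTable : ℕ :=
  0x4924846496cb64b2cb6592cb6c92cb64b64b65964b6c964b65b24b6cb24b6d924b8124928824928904928920928924124925024928824944824a24825124828924826496d964b2d96592d96c92d964b6596596596c965965b2596cb2596d925964b6c96596c96c96c965b2c96cb2c96d92c965b6496cb6496d96496db2494924a04925104928904944904a24905124908924905024925104925120925124126c925b4224924a04924a20924a241265925b41449248449249409249441264b25b41289248289249089249281264965b4125124825124905124921126492db25b6c92cb6c92d96c92db2c92db64924b6cb2596cb2c96cb25b2cb2cb2cb2d92cb25b64b2cb64b2d964b2db24b41249448249449049449209449241424b6d92596d92c96d925b2d92cb2d92d92d925b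6592cb6592d96592db2594124a24824a24904a24920a24924222d925b2cb25b25b25b2c965b25965b24b65b2c92db2592db24b2db2496db1124920a24920944920928920925120924a2092494

/-- A coordinate of a root, increased by `2`. -/
def coord (n k : ℕ) : ℕ :=
  Nat.land (Nat.shiftRight rootTable (Nat.add (Nat.mul 24 n) (Nat.mul 3 k))) 7

/-- The root with a given index. -/
def rt (n : ℕ) : Fin 8 → ℤ := fun k => Int.subNatNat (coord n k) 2

/-- The inner product of two indexed roots. -/
def ip (i j : ℕ) : ℤ := rt i ⬝ᵥ rt j

theorem ip_comm (i j : ℕ) : ip i j = ip j i := dotProduct_comm _ _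

theorem rt_mem_rootsE7 : ∀ n : Fin 126, rt n ∈ rootsE7 := by
  have h : ∀ n : Fin 126,
      ((∃ i j, i ≠ j ∧ (rt n i = 2 ∨ rt n i = -2) ∧ (rt n j = 2 ∨ rt n j = -2) ∧
          ∀ k, k ≠ i → k ≠ j → rt n k = 0) ∨
       ((∀ i, rt n i = 1 ∨ rt n i = -1) ∧
          Even (Finset.univ.filter fun i => rt n i = -1).card)) ∧
      rt n ⬝ᵥ (1 : Fin 8 → ℤ) = 0 := by
    decide +kernel
  exact h

theorem exists_rt_eq_of_two :
    ∀ i j : Fin 8, i ≠ j → ∃ n : Fin 126, ∀ k, rt n k = if k = i then 2 else if k = j then -2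
      else 0 := by
  decide +kernel

theorem exists_rt_eq_of_sign :
    ∀ a b c d e f g h : Bool,
      ([a, b, c, d, e, f, g, h].countP id = 4) → ∃ n : Fin 126, ∀ k : Fin 8,
        rt n k = if [a, b, c, d, e, f, g, h].getD k false then -1 else 1 := by
  decide +kernel

theorem exists_rt_eq {x : Fin 8 → ℤ} (hx : x ∈ rootsE7) : ∃ n < 126, rt n = x := by
  obtain ⟨h | h, h0⟩ := hx
  · obtain ⟨i, j, hij, hi, hj, hk⟩ := h
    have hs : x i + x j = 0 := by
      rw [← h0, dotProduct_one, ← Finset.sum_pair hij]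
      refine Finset.sum_subset (Finset.subset_univ _) fun k _ hk' => ?_
      simp only [Finset.mem_insert, Finset.mem_singleton, not_or] at hk'
      exact hk k hk'.1 hk'.2
    rcases hi with hi | hi
    · obtain ⟨n, hn⟩ := exists_rt_eq_of_two i j hij
      refine ⟨n, n.2, funext fun k => ?_⟩
      rw [hn]
      split_ifs with h1 h2
      · rw [h1, hi]
      · rw [h2]; omega
      · rw [hk k h1 h2]
    · obtain ⟨n, hn⟩ := exists_rt_eq_of_two j i hij.symm
      refine ⟨n, n.2, funext fun k => ?_⟩
      rw [hn]
      split_ifs with h1 h2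
      · rw [h1]; omega
      · rw [h2, hi]
      · rw [hk k h2 h1]
  · have h1 := h.1
    have hb : ∀ k, x k = if decide (x k = -1) then -1 else 1 := by
      intro k
      rcases h1 k with h | h <;> simp [h]
    have hc : ∀ k, x k = 1 - 2 * (if decide (x k = -1) then 1 else 0) := by
      intro k
      rcases h1 k with h | h <;> simp [h]
    obtain ⟨n, hn⟩ := exists_rt_eq_of_sign (decide (x 0 = -1)) (decide (x 1 = -1))
      (decide (x 2 = -1)) (decide (x 3 = -1)) (decide (x 4 = -1)) (decide (x 5 = -1))
      (decide (x 6 = -1)) (decide (x 7 = -1)) (by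
        rw [dotProduct_one, Fin.sum_univ_eight, hc 0, hc 1, hc 2, hc 3, hc 4, hc 5, hc 6, hc 7]
          at h0
        simp only [List.countP_cons, List.countP_nil, id]
        split_ifs at h0 ⊢ <;> omega)
    refine ⟨n, n.2, funext fun k => ?_⟩
    rw [hn k, hb k]
    fin_cases k <;> rfl

/-- The inner product of two roots, increased by `32`. -/
def ipN (i j : ℕ) : ℕ :=
  Nat.add (Nat.mul (coord i 0) (coord j 0)) (Nat.add (Nat.mul (coord i 1) (coord j 1))
    (Nat.add (Nat.mul (coord i 2) (coord j 2)) (Nat.add (Nat.mul (coord i 3) (coord j 3))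
      (Nat.add (Nat.mul (coord i 4) (coord j 4)) (Nat.add (Nat.mul (coord i 5) (coord j 5))
        (Nat.add (Nat.mul (coord i 6) (coord j 6)) (Nat.mul (coord i 7) (coord j 7))))))))

theorem rt_sum {i : ℕ} (hi : i < 126) : rt i ⬝ᵥ (1 : Fin 8 → ℤ) = 0 :=
  (rt_mem_rootsE7 ⟨i, hi⟩).2

theorem ip_eq_ipN {i j : ℕ} (hi : i < 126) (hj : j < 126) : ip i j = (ipN i j : ℤ) - 32 := by
  have h1 := rt_sum hi
  have h2 := rt_sum hj
  rw [dotProduct_one, Fin.sum_univ_eight] at h1 h2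
  simp only [rt, Int.subNatNat_eq_coe] at h1 h2
  simp only [ip, rt, dotProduct, Fin.sum_univ_eight, ipN, Nat.add_eq, Nat.mul_eq, Nat.cast_add,
    Nat.cast_mul, Int.subNatNat_eq_coe]
  simp only [show ((1 : Fin 8) : ℕ) = 1 from rfl, show ((2 : Fin 8) : ℕ) = 2 from rfl,
    show ((3 : Fin 8) : ℕ) = 3 from rfl, show ((4 : Fin 8) : ℕ) = 4 from rfl,
    show ((5 : Fin 8) : ℕ) = 5 from rfl, show ((6 : Fin 8) : ℕ) = 6 from rfl,
    show ((7 : Fin 8) : ℕ) = 7 from rfl, show ((0 : Fin 8) : ℕ) = 0 from rfl] at h1 h2 ⊢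
  push_cast at h1 h2 ⊢
  linear_combination (-2) * h1 - 2 * h2

/-- Adjacency masks (inner product `4`) of the first 77 roots, 77 bits each. -/
def adjTable : ℕ :=
  0xf02108414882910a440ba004210922124492206c840084188831161103a21080101c203874081e084210000f001fa40003e108414882910291022e021088911122448809b200421444288a84402e88400816102c350200f82108000b8017a900020f842124424881244200ba108891112211220426c0210c221844c11010ba20040d081a16408043e0840006c00db24001083e10c221844031110022e845088a11028884201b211822304418440842e80207040e08e020210f820003a0074710008420f86810d020038480108ba2a04540802c2210026c8c81190201a1084203a21c0438080e0810843e0001e003c07800421083f4806900001e4008422f5202a4000171080109b6480c90000d8421002e8e201c400074108420780f001e0003c0018c630f662000026741805294b6a88000255b80018c666cc200024cd0528094b3990800219ad00c02956aa8200215558c000c678cc08020cca094a408e8f1020058399014a026ab48080542ca940300ace940204c1a4c6300031f86008380e208c6310690f00205b8188129482a4b800856c0a5202940c96c0024da04a5280601c7a000b8e02318c60001fe0003f80100318c620003d9804cf0300a5288002daa04abb000318c20019b30499c0a501290800ce644336a01805282005aaa42ab3180018c0801e334199812948110201a3c4b07520294048080aad2a85a5280601402033a5983518c6000600807e1f01c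8118c6200021a43cb70510252900008a92ead824a405280002325b9b4114a500c0000871ef1c086318c00000207fbf004f780000026704cef663b81e000025584abb6a982f7000024cc499e6ccf6003c00219a433739960d82e00215542ab6aab0037b0020ccc19978cdf40003c05838b0768f1c1d002e0542ca85aab4e00741b04c1a9834ce970001de8380e701c1f87f800001e5b80b70690fc1e0001756c0ad82a4be007800dcda09b40c96f0001e0778e071c01c7b800007bdf803f0001fec00000000001fffffffa00000007fff0001fffe

/-- Incompatibility masks (negative inner product) of the first 77 roots, 77 bits each. -/
def negTable : ℕ :=
  0xfc2108291052205220043f0842488491024880210fc2184430880622010843f0d021a0400708084210fe900d200003cf8108420a4414885220401f42111222244224420047d08a1114220511100211f45408a81005848010847ea405480002e7d0021084910922491011f010844488891224408403e4230446088308842004f91902320403422100213ec901920001b3e4200420c44188b08804f900210a2214454220213e01086110c226088108407c4380870101c10842005f1c40388000e9f10840080e101c3a04017c420040b08161a810085f100206840d0b20404217c01038207047010210840f81e003c00078f8421080007800fd20007e10840005c00bd480021f84200036006d92001087e10001d003a388008421f8000f001e03c03de000000000133c0002e078000000012ad00000bdc000000012664000d800f00000010cd10000360b80000010aa8400000dec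00000106641001d0000f000002c1c040007400b800002a160100001d06c0000260d0040000077a00001c0700101e00000780002dc000400780005c0002b600010001e003600026d000040000781d0001c700001000001ef0000fc0000047bc00000133800080005c0f000012ac0002000017b8000126600008001b001e0010cd0000200006c170010aa80000800001bd801066400002003a0001e02c1c000008000e801702a1600000200003a0d8260d000000800000ef41c07000000203c00000f2dc0000000800f0000bab6000000020003c006e6d0000000080000f03bc7000000002000003defc0000000008006318c40008000000006014a51000200000006000631840008000000014a025210002000000140300a50400080000006300031810002000000025290220400080000024052809010002000000a500c02804000800000318c000c0100020000002318c40004000800002204a5200010002000009480a50000400080000294a0180001000200000c63180000040008000000000000000000000000000000000000000000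

/-- The mask with the lowest 77 bits set. -/
def fullMask : ℕ := 0x1fffffffffffffffffff

/-- The roots among the first 77 that have inner product `4` with root `i`. -/
def adM (i : ℕ) : ℕ := Nat.land (Nat.shiftRight adjTable (Nat.mul 77 i)) fullMask

/-- The roots among the first 77 that have a negative inner product with root `i`. -/
def ncM (i : ℕ) : ℕ := Nat.land (Nat.shiftRight negTable (Nat.mul 77 i)) fullMask

/-- A cheap bit test. -/
def tb (m x : ℕ) : Bool := Nat.beq (Nat.mod (Nat.shiftRight m x) 2) 1

theorem tb_eq (m x : ℕ) : tb m x = m.testBit x := by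
  unfold tb
  rw [Nat.testBit_eq_decide_div_mod_eq, ← Nat.shiftRight_eq_div_pow, Bool.eq_iff_iff,
    Nat.beq_eq, decide_eq_true_iff]
  rfl

theorem fullMask_testBit (x : ℕ) : fullMask.testBit x = decide (x < 77) := by
  have : fullMask = 2 ^ 77 - 1 := by decide +kernel
  rw [this, Nat.testBit_two_pow_sub_one]

theorem ipN_tables : ∀ i < 77, ∀ j < 77,
    (Nat.beq (ipN i j) 36 == tb adjTable (Nat.add (Nat.mul 77 i) j)) = true ∧
      (Nat.ble (ipN i j) 31 == tb negTable (Nat.add (Nat.mul 77 i) j)) = true := by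
  decide +kernel

theorem adM_testBit {i j : ℕ} (hi : i < 77) : (adM i).testBit j ↔ j < 77 ∧ ip i j = 4 := by
  unfold adM
  change (adjTable >>> (77 * i) &&& fullMask).testBit j = true ↔ _
  rw [Nat.testBit_land, fullMask_testBit, Nat.testBit_shiftRight, ← tb_eq]
  by_cases hj : j < 77
  · have h := (ipN_tables i hi j hj).1
    rw [ip_eq_ipN (by omega) (by omega)]
    simp only [Nat.add_eq, Nat.mul_eq, beq_iff_eq] at h
    rw [← h]
    simp [hj]
    omega
  · simp [hj]

theorem ncM_testBit {i j : ℕ} (hi : i < 77) : (ncM i).testBit j ↔ j < 77 ∧ ip i j < 0 := by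
  unfold ncM
  change (negTable >>> (77 * i) &&& fullMask).testBit j = true ↔ _
  rw [Nat.testBit_land, fullMask_testBit, Nat.testBit_shiftRight, ← tb_eq]
  by_cases hj : j < 77
  · have h := (ipN_tables i hi j hj).2
    rw [ip_eq_ipN (by omega) (by omega)]
    simp only [Nat.add_eq, Nat.mul_eq, beq_iff_eq] at h
    rw [← h]
    simp [hj]
    omega
  · simp [hj]

theorem ip_self {i : ℕ} (hi : i < 126) : ip i i = 8 := by
  have h : ∀ i < 126, ipN i i = 40 := by decide +kernel
  rw [ip_eq_ipN hi hi, h i hi]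
  norm_num

theorem lt_of_compatible : ∀ i < 126, 0 ≤ ip i 0 → 0 ≤ ip i 1 → i < 77 := by
  have h : ∀ i < 126, Nat.ble 32 (ipN i 0) = true → Nat.ble 32 (ipN i 1) = true → i < 77 := by
    decide +kernel
  intro i hi h0 h1
  rw [ip_eq_ipN hi (by omega)] at h0 h1
  exact h i hi (by rw [Nat.ble_eq]; omega) (by rw [Nat.ble_eq]; omega)

/-! ### Symmetries of the root system -/

/-- Seven simple roots, seven bits each. -/
def simpleTable : ℕ := 0x1f48c782edaaf

/-- The reflections in the simple roots, as permutations of the 126 indices, seven bits each. -/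
def reflTable : ℕ :=
  0x29e7cd97263c58705fbdcb8f0dfba951a13e74df9efd79f1dfb75e9ceedcb76acd8af5aad4fbb766bd5a744c972a4c88f1a2c4870a0c07ef9ebc76e9cb86ed9ab466c98b05e7cf1d386cd19305cb15284c9115cb562b54a54274c9522344850101e3868c16284880e18284060800140e5f4391e3bf6ebd39f2e3c37e822e9fc493bb3e6cb92edcb76acd8c78b0e0bf7abd6ab52953a3427ce9b325cad3e63c68babd4283035fb7af1decf854a1324d0c982e5978b183470f20a13a64a911a243f4f9e3a70d9a66c98b070ddb35daa552b58b570a12203860a101810403efcf7e7d78eddfa75e7c7970dfbb6ecd7a7568cf9b265c78715fc17aedbb966d58ad5ead4a74a8d09d3e6c78d16243992e54991061407ef9e3d76e9cb770d9ab464cd8b05eb962d54ad4a750992a348890a03e74f1b3868c192e58a1526488901c3c60d16245080e143040608080fbf3d7bf3dfc76ebcfa72e1c77eedbb356bd3a33e5cd93163c382f5fb976ddab166bd5ad529d2a33e84e9b2e64a932214180fdf478d162437aede3a72e1b376ad19b164c17ad5cb15a954a13274a911234280f1f3a70d1b325cc162a4ca12223c80e1a2c60a102438608141820203efbf9ebc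f8ebd3bf6e7cb8efe1bb6ebd9ab4e8cd9f2e4c782fe2c37aedab372dd8af5aa55a74a8519f3a6cc952e4c88f1634486f5e3b74e614180fdf386ed5b3466c98315eb95aa5ab14a84e9532446851203e70d9e3a68c982c5ca94244c8901a3078e162848710182830808080fbf3c77edefd79ebd39f2e3c376fd9b75ead3a33e3c587365c982fdebb72dd7ad56d59b1529d1a5427ce9b325c995223c689161c282fe03e70ddb3568f5e3b74e59b262bd82e5ab14274cad5294a911a24084f9e3a64c17386cd162a50991244078e142440d182c3860a101030203eecd7ab4f8efdbaf4e75eb55a9bb6fcf7ebce8a3427cec78b0e0bf7aedcb76acd8e5c786fa74b3e6cb926cc972a4498f1a2c3890a0c07cfdebc76e5d3364c582f70ddb3568b96ac56a94a446890a84e992a03e78e9c3668a942648c982e588901e3868c161828406284880e08080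

/-- The image of root `x` under the reflection in the simple root `g`. -/
def refl (g x : ℕ) : ℕ :=
  Nat.land (Nat.shiftRight reflTable (Nat.add (Nat.mul 882 g) (Nat.mul 7 x))) 127

/-- The permutation `σ` of the indices `< 126`, with inverse `τ`, preserves inner products. -/
structure IsSym (σ τ : ℕ → ℕ) : Prop where
  maps : ∀ x < 126, σ x < 126
  maps_inv : ∀ x < 126, τ x < 126
  left_inv : ∀ x < 126, τ (σ x) = x
  right_inv : ∀ x < 126, σ (τ x) = x
  ip : ∀ x < 126, ∀ y < 126, ip (σ x) (σ y) = ip x y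

theorem IsSym.id : IsSym id id :=
  ⟨fun _ h => h, fun _ h => h, fun _ _ => rfl, fun _ _ => rfl, fun _ _ _ _ => rfl⟩

theorem IsSym.symm {σ τ : ℕ → ℕ} (h : IsSym σ τ) : IsSym τ σ where
  maps := h.maps_inv
  maps_inv := h.maps
  left_inv := h.right_inv
  right_inv := h.left_inv
  ip x hx y hy := by
    rw [← h.ip _ (h.maps_inv x hx) _ (h.maps_inv y hy), h.right_inv x hx, h.right_inv y hy]

theorem IsSym.comp {σ τ σ' τ' : ℕ → ℕ} (h : IsSym σ τ) (h' : IsSym σ' τ') :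
    IsSym (σ ∘ σ') (τ' ∘ τ) where
  maps x hx := h.maps _ (h'.maps x hx)
  maps_inv x hx := h'.maps_inv _ (h.maps_inv x hx)
  left_inv x hx := by simp [h.left_inv _ (h'.maps x hx), h'.left_inv x hx]
  right_inv x hx := by simp [h'.right_inv _ (h.maps_inv x hx), h.right_inv x hx]
  ip x hx y hy := by
    simp only [Function.comp]
    rw [h.ip _ (h'.maps x hx) _ (h'.maps y hy), h'.ip x hx y hy]

theorem refl_table : ∀ g < 7, ∀ x < 126,
    (Nat.blt (refl g x) 126 && Nat.beq (refl g (refl g x)) x) = true := by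
  decide +kernel

/-- The index of a simple root. -/
def simpleRoot (g : ℕ) : ℕ := Nat.land (Nat.shiftRight simpleTable (Nat.mul 7 g)) 127

theorem simpleRoot_lt : ∀ g < 7, simpleRoot g < 126 := by decide +kernel

theorem refl_formula : ∀ g < 7, ∀ x < 126, ∀ k : Fin 8,
    Nat.beq (Nat.add (Nat.mul 4 (coord (refl g x) k))
      (Nat.add (Nat.mul (ipN x (simpleRoot g)) (coord (simpleRoot g) k)) 64))
    (Nat.add (Nat.mul 4 (coord x k))
      (Nat.add (Nat.mul 2 (ipN x (simpleRoot g))) (Nat.mul 32 (coord (simpleRoot g) k)))) = true := by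
  decide +kernel

theorem four_smul_rt_refl {g x : ℕ} (hg : g < 7) (hx : x < 126) :
    (4 : ℤ) • rt (refl g x) = (4 : ℤ) • rt x - ip x (simpleRoot g) • rt (simpleRoot g) := by
  funext k
  have h := refl_formula g hg x hx k
  rw [Nat.beq_eq] at h
  simp only [Nat.add_eq, Nat.mul_eq] at h
  rw [ip_eq_ipN hx (simpleRoot_lt g hg)]
  simp only [Pi.smul_apply, Pi.sub_apply, smul_eq_mul, rt, Int.subNatNat_eq_coe]
  have h' : (4 : ℤ) * coord (refl g x) k + (ipN x (simpleRoot g) * coord (simpleRoot g) k + 64) =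
      4 * coord x k + (2 * ipN x (simpleRoot g) + 32 * coord (simpleRoot g) k) := by
    exact_mod_cast h
  push_cast
  linear_combination h'

theorem isSym_refl {g : ℕ} (hg : g < 7) : IsSym (refl g) (refl g) := by
  have ht : ∀ x < 126, refl g x < 126 ∧ refl g (refl g x) = x := by
    intro x hx
    have h := refl_table g hg x hx
    rw [Bool.and_eq_true, Nat.beq_eq] at h
    exact ⟨by simpa [Nat.blt] using h.1, h.2⟩
  refine ⟨fun x hx => (ht x hx).1, fun x hx => (ht x hx).1, fun x hx => (ht x hx).2,
    fun x hx => (ht x hx).2, fun x hx y hy => ?_⟩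
  have h1 := four_smul_rt_refl hg hx
  have h2 := four_smul_rt_refl hg hy
  have h3 : ((4 : ℤ) • rt (refl g x)) ⬝ᵥ ((4 : ℤ) • rt (refl g y)) = 16 * ip x y := by
    rw [h1, h2]
    have hs := ip_self (simpleRoot_lt g hg)
    simp only [sub_dotProduct, dotProduct_sub, smul_dotProduct, dotProduct_smul, smul_eq_mul]
    change 4 * (4 * ip x y - ip x (simpleRoot g) * ip (simpleRoot g) y) - ip y (simpleRoot g) *
      (4 * ip x (simpleRoot g) - ip x (simpleRoot g) * ip (simpleRoot g) (simpleRoot g)) = _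
    rw [hs, ip_comm (simpleRoot g) y]
    ring
  simp only [smul_dotProduct, dotProduct_smul, smul_eq_mul] at h3
  change 4 * (4 * ip _ _) = _ at h3
  linarith

/-- The simple reflections to be applied on the way from a root to root `0`, three bits each. -/
def toZeroTable : ℕ := 0x284e17146004694e509c2e28edb6d24ad4a7349246db692489245b68b6d36db69250011db6db6db6db38a331a11a370

/-- The simple reflections fixing root `0` to be applied on the way from a neighbour of root `0`
to root `1`, three bits each. -/
def toOneTable : ℕ := 0x2800000000000000000000000000000000000000000000000000000000016db692500110000000000038a331a11a340

/-- The reflection listed for `x` in a table. -/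
def choice (t x : ℕ) : ℕ := Nat.land (Nat.shiftRight t (Nat.mul 3 x)) 7

/-- Applies the listed reflections repeatedly. -/
def walk (t : ℕ) : ℕ → ℕ → ℕ
  | 0, x => x
  | n + 1, x => walk t n (refl (choice t x) x)

theorem choice_lt : ∀ x < 126, choice toZeroTable x < 7 ∧ choice toOneTable x < 6 := by
  decide +kernel

theorem walk_zero : ∀ x < 126, Nat.beq (walk toZeroTable 33 x) 0 = true := by decide +kernel

theorem walk_one : ∀ x < 126, Nat.beq (ipN 0 x) 36 = true →
    Nat.beq (walk toOneTable 15 x) 1 = true := by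
  decide +kernel

theorem refl_zero : ∀ g < 6, refl g 0 = 0 := by decide +kernel

theorem refl_one : ∀ g < 5, refl g 1 = 1 := by decide +kernel

theorem exists_isSym_walk_zero (n : ℕ) : ∀ x < 126, ∃ σ τ, IsSym σ τ ∧
    σ x = walk toZeroTable n x := by
  induction n with
  | zero => exact fun x _ => ⟨id, id, IsSym.id, rfl⟩
  | succ n ih =>
    intro x hx
    have hs := isSym_refl (choice_lt x hx).1
    obtain ⟨σ, τ, h, h'⟩ := ih _ (hs.maps x hx)
    exact ⟨_, _, h.comp hs, h'⟩

theorem exists_isSym_walk_one (n : ℕ) : ∀ x < 126, ∃ σ τ, IsSym σ τ ∧ σ 0 = 0 ∧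
    σ x = walk toOneTable n x := by
  induction n with
  | zero => exact fun x _ => ⟨id, id, IsSym.id, rfl, rfl⟩
  | succ n ih =>
    intro x hx
    have hg := (choice_lt x hx).2
    have hs := isSym_refl (show choice toOneTable x < 7 by omega)
    obtain ⟨σ, τ, h, h0, h'⟩ := ih _ (hs.maps x hx)
    exact ⟨_, _, h.comp hs, by simp [refl_zero _ hg, h0], h'⟩

/-- The symmetries act transitively on the ordered edges. -/
theorem exists_isSym_edge {x y : ℕ} (hx : x < 126) (hy : y < 126) (h : ip x y = 4) :
    ∃ σ τ, IsSym σ τ ∧ σ x = 0 ∧ σ y = 1 := by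
  obtain ⟨σ, τ, hσ, hx0⟩ := exists_isSym_walk_zero 33 x hx
  rw [Nat.beq_eq.mp (walk_zero x hx)] at hx0
  have hy' := hσ.maps y hy
  have h4 : ip 0 (σ y) = 4 := by rw [← hx0, hσ.ip x hx y hy, h]
  rw [ip_eq_ipN (by norm_num) hy'] at h4
  obtain ⟨σ', τ', hσ', h0, h1⟩ := exists_isSym_walk_one 15 _ hy'
  rw [Nat.beq_eq.mp (walk_one _ hy' (by rw [Nat.beq_eq]; omega))] at h1
  exact ⟨_, _, hσ'.comp hσ, by simp [hx0, h0], h1⟩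

/-! ### Maximal compatible sets and the search -/

/-- The common neighbours of two roots in a set of roots. -/
def common (T : Finset ℕ) (u v : ℕ) : Finset ℕ := T.filter fun w => ip u w = 4 ∧ ip v w = 4

/-- An inclusion-maximal set of roots with pairwise non-negative inner products, with an edge `p q`
that has as many common neighbours as possible. -/
structure IsPointed (T : Finset ℕ) (p q : ℕ) : Prop where
  lt : ∀ x ∈ T, x < 126
  left_mem : p ∈ T
  right_mem : q ∈ T
  compat : ∀ x ∈ T, ∀ y ∈ T, 0 ≤ ip x y
  maximal : ∀ x < 126, x ∉ T → ∃ y ∈ T, ip x y < 0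
  common_le : ∀ x ∈ T, ∀ y ∈ T, ip x y = 4 → (common T x y).card ≤ (common T p q).card

/-- The graph on the positions of a list of roots in which distinct positions are adjacent if the
roots have inner product `4`. -/
def rootGraph (L : List ℕ) : SimpleGraph (Fin L.length) where
  Adj a b := a ≠ b ∧ ip (L.get a) (L.get b) = 4
  symm := ⟨fun a b h => ⟨h.1.symm, by rw [ip_comm]; exact h.2⟩⟩
  loopless := ⟨fun _ h => h.1 rfl⟩

/-- The set of roots `T`, seen as a graph, embeds into the graph of a list in `Ls`. -/
def Embeds (Ls : List (List ℕ)) (T : Finset ℕ) : Prop :=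
  ∃ L ∈ Ls, ∃ h : ℕ → Fin L.length, Set.InjOn h T ∧
    ∀ x ∈ T, ∀ y ∈ T, x ≠ y → (ip x y = 4 ↔ ip (L.get (h x)) (L.get (h y)) = 4)

theorem Embeds.of_map {Ls : List (List ℕ)} {T T' : Finset ℕ} (f : ℕ → ℕ)
    (hf : ∀ x ∈ T, f x ∈ T') (hinj : Set.InjOn f T)
    (hip : ∀ x ∈ T, ∀ y ∈ T, ip (f x) (f y) = ip x y) (h : Embeds Ls T') : Embeds Ls T := by
  obtain ⟨L, hL, h, hi, ha⟩ := h
  refine ⟨L, hL, h ∘ f, hi.comp hinj hf, fun x hx y hy hxy => ?_⟩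
  rw [← hip x hx y hy]
  exact ha _ (hf x hx) _ (hf y hy) fun e => hxy (hinj hx hy e)

/-- The preimage of a set of roots. -/
def preim (σ : ℕ → ℕ) (T : Finset ℕ) : Finset ℕ := (Finset.range 126).filter fun x => σ x ∈ T

theorem mem_preim {σ : ℕ → ℕ} {T : Finset ℕ} {x : ℕ} : x ∈ preim σ T ↔ x < 126 ∧ σ x ∈ T := by
  simp [preim]

theorem Embeds.of_preim {Ls : List (List ℕ)} {σ τ : ℕ → ℕ} (h : IsSym σ τ) {T : Finset ℕ}
    (hT : ∀ x ∈ T, x < 126) (hE : Embeds Ls (preim σ T)) : Embeds Ls T := by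
  refine hE.of_map τ (fun x hx => mem_preim.mpr ⟨h.maps_inv x (hT x hx), ?_⟩) ?_ ?_
  · rwa [h.right_inv x (hT x hx)]
  · intro x hx y hy e
    rw [← h.right_inv x (hT x hx), ← h.right_inv y (hT y hy), e]
  · intro x hx y hy
    exact h.symm.ip x (hT x hx) y (hT y hy)

theorem card_common_preim {σ τ : ℕ → ℕ} (h : IsSym σ τ) {T : Finset ℕ} (hT : ∀ x ∈ T, x < 126)
    {u v : ℕ} (hu : u < 126) (hv : v < 126) :
    (common (preim σ T) u v).card = (common T (σ u) (σ v)).card := by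
  refine Finset.card_bij' (fun x _ => σ x) (fun x _ => τ x) ?_ ?_ ?_ ?_
  · intro x hx
    obtain ⟨hx, h1, h2⟩ := Finset.mem_filter.mp hx
    obtain ⟨hx, hxT⟩ := mem_preim.mp hx
    exact Finset.mem_filter.mpr ⟨hxT, by rwa [h.ip u hu x hx], by rwa [h.ip v hv x hx]⟩
  · intro x hx
    obtain ⟨hxT, h1, h2⟩ := Finset.mem_filter.mp hx
    have hx := hT x hxT
    have e := h.right_inv x hx
    refine Finset.mem_filter.mpr ⟨mem_preim.mpr ⟨h.maps_inv x hx, by rwa [e]⟩, ?_, ?_⟩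
    · rwa [← h.ip u hu _ (h.maps_inv x hx), e]
    · rwa [← h.ip v hv _ (h.maps_inv x hx), e]
  · intro x hx
    exact h.left_inv x (mem_preim.mp (Finset.mem_filter.mp hx).1).1
  · intro x hx
    exact h.right_inv x (hT x (Finset.mem_filter.mp hx).1)

theorem IsPointed.preim {σ τ : ℕ → ℕ} (h : IsSym σ τ) {T : Finset ℕ} {p q : ℕ} (hp : p < 126)
    (hq : q < 126) (hT : IsPointed T (σ p) (σ q)) : IsPointed (preim σ T) p q where
  lt x hx := (mem_preim.mp hx).1
  left_mem := mem_preim.mpr ⟨hp, hT.left_mem⟩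
  right_mem := mem_preim.mpr ⟨hq, hT.right_mem⟩
  compat x hx y hy := by
    rw [mem_preim] at hx hy
    rw [← h.ip x hx.1 y hy.1]
    exact hT.compat _ hx.2 _ hy.2
  maximal x hx hxT := by
    obtain ⟨y, hy, hxy⟩ := hT.maximal (σ x) (h.maps x hx) fun h' => hxT (mem_preim.mpr ⟨hx, h'⟩)
    have hy' := hT.lt y hy
    have e := h.right_inv y hy'
    refine ⟨τ y, mem_preim.mpr ⟨h.maps_inv y hy', by rwa [e]⟩, ?_⟩
    rwa [← h.ip x hx _ (h.maps_inv y hy'), e]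
  common_le x hx y hy hxy := by
    rw [mem_preim] at hx hy
    rw [card_common_preim h hT.lt hx.1 hy.1, card_common_preim h hT.lt hp hq]
    exact hT.common_le _ hx.2 _ hy.2 (by rwa [h.ip x hx.1 y hy.1])

/-- A node of the search: the masks of roots that are required and excluded. -/
abbrev Node := ℕ × ℕ

/-- Every pointed set that contains the required and avoids the excluded roots embeds. -/
def Settled (Ls : List (List ℕ)) (s : Node) : Prop :=
  ∀ T : Finset ℕ, IsPointed T 0 1 → (∀ x, s.1.testBit x → x ∈ T) → (∀ x, s.2.testBit x → x ∉ T) →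
    Embeds Ls T

theorem beq_zero_false {m : ℕ} (hm : m ≠ 0) : Nat.beq m 0 = false := by
  rw [Bool.eq_false_iff, Ne, Nat.beq_eq]
  exact hm

/-- Checks a property for all elements of a mask, with a bound on their number. -/
def allBits (p : ℕ → Bool) : ℕ → ℕ → ℕ → Bool
  | 0, m, _ => Nat.beq m 0
  | n + 1, m, x => cond (Nat.beq m 0) true
      (cond (Nat.beq (Nat.land m 1) 1) (p x && allBits p n (Nat.shiftRight m 1) (Nat.succ x))
        (allBits p n (Nat.shiftRight m 1) (Nat.succ x)))

theorem of_allBits {p : ℕ → Bool} {n : ℕ} : ∀ {m x : ℕ}, allBits p n m x = true →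
    ∀ y, m.testBit y → p (x + y) = true := by
  induction n with
  | zero =>
    intro m x h y hy
    rw [allBits, Nat.beq_eq] at h
    simp [h] at hy
  | succ n ih =>
    intro m x h y hy
    rw [allBits] at h
    by_cases hm : m = 0
    · simp [hm] at hy
    rw [beq_zero_false hm, cond_false] at h
    have hrec : allBits p n (Nat.shiftRight m 1) (Nat.succ x) = true ∧
        (m.testBit 0 → p x = true) := by
      have e : Nat.beq (Nat.land m 1) 1 = m.testBit 0 := by
        rw [Bool.eq_iff_iff, Nat.beq_eq, Nat.testBit_zero, decide_eq_true_iff]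
        change m &&& 1 = 1 ↔ _
        rw [Nat.and_one_is_mod]
      rw [e] at h
      cases hb : m.testBit 0
      · rw [hb, cond_false] at h
        exact ⟨h, by simp⟩
      · rw [hb, cond_true, Bool.and_eq_true] at h
        exact ⟨h.2, fun _ => h.1⟩
    cases y with
    | zero => exact hrec.2 hy
    | succ y =>
      have := ih hrec.1 y (by
        change (m >>> 1).testBit y = true
        rwa [Nat.testBit_shiftRight, Nat.add_comm])
      rwa [Nat.succ_add, ← Nat.add_succ] at this

/-- Number of elements of a mask, with a bound on the positions. -/
def popN : ℕ → ℕ → ℕ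
  | 0, _ => 0
  | n + 1, m => cond (Nat.beq m 0) 0
      (Nat.add (Nat.land m 1) (popN n (Nat.shiftRight m 1)))

theorem popN_eq (n : ℕ) : ∀ m, popN n m = ((Finset.range n).filter fun x => m.testBit x).card := by
  induction n with
  | zero => simp [popN]
  | succ n ih =>
    intro m
    rw [popN]
    by_cases hm : m = 0
    · simp [hm]
    rw [beq_zero_false hm, cond_false, ih]
    rw [Finset.range_add_one', Finset.filter_insert, Finset.filter_map, Nat.add_eq]
    have e : Nat.land m 1 = if m.testBit 0 = true then 1 else 0 := by
      change m &&& 1 = _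
      rw [Nat.and_one_is_mod, Nat.testBit_zero]
      rcases Nat.mod_two_eq_zero_or_one m with h | h <;> simp [h]
    rw [e]
    change _ + (Finset.filter (fun x => (m >>> 1).testBit x = true) (Finset.range n)).card = _
    split_ifs with h
    · rw [Finset.card_insert_of_notMem (by simp), Finset.card_map, Nat.add_comm]
      congr 2
      exact Finset.filter_congr fun x _ => by rw [Nat.testBit_shiftRight, Nat.add_comm]; rfl
    · rw [Finset.card_map, Nat.zero_add]
      congr 1
      exact Finset.filter_congr fun x _ => by rw [Nat.testBit_shiftRight, Nat.add_comm]; rfl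

/-- Applies the simple reflections given by the digits (`1` to `5`) of a word in base `8`. -/
def word : ℕ → ℕ → ℕ → ℕ
  | 0, _, x => x
  | n + 1, w, x => cond (Nat.beq w 0) x
      (word n (Nat.shiftRight w 3) (refl (Nat.mod (Nat.land w 7) 5) x))

theorem exists_isSym_word (n : ℕ) : ∀ w, ∃ τ, IsSym (word n w) τ ∧ word n w 0 = 0 ∧
    word n w 1 = 1 := by
  induction n with
  | zero => exact fun w => ⟨id, IsSym.id, rfl, rfl⟩
  | succ n ih =>
    intro w
    by_cases hw : w = 0
    · refine ⟨id, ?_, ?_, ?_⟩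
      · convert IsSym.id using 1
        funext x
        simp [word, hw]
      · simp [word, hw]
      · simp [word, hw]
    · obtain ⟨τ, h, h0, h1⟩ := ih (Nat.shiftRight w 3)
      have hg : Nat.mod (Nat.land w 7) 5 < 5 := Nat.mod_lt _ (by norm_num)
      have hb := beq_zero_false hw
      have e : word (n + 1) w = word n (Nat.shiftRight w 3) ∘ refl (Nat.mod (Nat.land w 7) 5) := by
        funext x
        rw [word, hb, cond_false, Function.comp]
      refine ⟨_, e ▸ h.comp (isSym_refl (show Nat.mod (Nat.land w 7) 5 < 7 by omega)), ?_, ?_⟩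
      · rw [word, hb, cond_false, refl_zero _ (by omega), h0]
      · rw [word, hb, cond_false, refl_one _ (by omega), h1]

/-- One node of the search is an instance of another, up to a symmetry. -/
def isInstance (w : ℕ) (s g : Node) : Bool :=
  allBits (fun x => Nat.blt x 77 && tb s.1 (word 16 w x)) 77 g.1 0 &&
    allBits (fun x => tb s.2 (word 16 w x)) 77 g.2 0

theorem blt_eq {m n : ℕ} : Nat.blt m n = true ↔ m < n := by
  rw [Nat.blt, Nat.ble_eq]
  exact Iff.rfl

/-- The search. Tokens below `128` split a node according to whether a root belongs to the set;
tokens below `256` close a node since the set is not maximal; tokens below `2 ^ 15` close it since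
an edge has too many common neighbours; the other tokens refer to a node in a list. -/
def search (goals : List Node) : List ℕ → List Node → Bool
  | _, [] => true
  | [], _ :: _ => false
  | t :: ts, s :: st =>
    cond (Nat.blt t 128)
      (Nat.blt t 77 && search goals ts ((s.1, Nat.lor s.2 (Nat.shiftLeft 1 t)) ::
        (Nat.lor s.1 (Nat.shiftLeft 1 t), Nat.lor s.2 (ncM t)) :: st))
    (cond (Nat.blt t 256)
      (Nat.blt (Nat.sub t 128) 77 && (tb s.2 (Nat.sub t 128) &&
        (Nat.beq (Nat.land (ncM (Nat.sub t 128)) s.2) (ncM (Nat.sub t 128)) &&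
          search goals ts st)))
    (cond (Nat.blt t 32768)
      (tb s.1 (Nat.land t 127) && (tb s.1 (Nat.shiftRight t 8) &&
        (tb (adM (Nat.land t 127)) (Nat.shiftRight t 8) &&
          (Nat.blt (popN 77 (Nat.land (adM 0) (Nat.land (adM 1) (Nat.xor s.2 fullMask))))
            (popN 77 (Nat.land s.1 (Nat.land (adM (Nat.land t 127))
              (adM (Nat.shiftRight t 8))))) && search goals ts st))))
      (isInstance (Nat.shiftRight t 23) s
          (goals.getD (Nat.pred (Nat.land (Nat.shiftRight t 15) 255)) (Nat.shiftLeft 1 127, 0)) &&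
        search goals ts st)))

theorem IsPointed.lt_77 {T : Finset ℕ} (hT : IsPointed T 0 1) {x : ℕ} (hx : x ∈ T) : x < 77 :=
  lt_of_compatible x (hT.lt x hx) (hT.compat x hx 0 hT.left_mem) (hT.compat x hx 1 hT.right_mem)

theorem settled_split {Ls : List (List ℕ)} {s : Node} {x : ℕ} (hx : x < 77)
    (h0 : Settled Ls (s.1, s.2 ||| 1 <<< x)) (h1 : Settled Ls (s.1 ||| 1 <<< x, s.2 ||| ncM x)) :
    Settled Ls s := by
  intro T hT hI hO
  by_cases hxT : x ∈ T
  · refine h1 T hT (fun y hy => ?_) (fun y hy => ?_)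
    · rw [Nat.testBit_lor, Bool.or_eq_true, Nat.one_shiftLeft, Nat.testBit_two_pow] at hy
      rcases hy with hy | hy
      · exact hI y hy
      · rwa [← of_decide_eq_true hy]
    · rw [Nat.testBit_lor, Bool.or_eq_true] at hy
      rcases hy with hy | hy
      · exact hO y hy
      · intro hyT
        have := hT.compat x hxT y hyT
        have := ((ncM_testBit hx).mp hy).2
        omega
  · refine h0 T hT hI (fun y hy => ?_)
    rw [Nat.testBit_lor, Bool.or_eq_true, Nat.one_shiftLeft, Nat.testBit_two_pow] at hy
    rcases hy with hy | hy
    · exact hO y hy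
    · rwa [← of_decide_eq_true hy]

theorem settled_full {Ls : List (List ℕ)} {s : Node} {x : ℕ} (hx : x < 77) (hs : s.2.testBit x)
    (hn : ncM x &&& s.2 = ncM x) : Settled Ls s := by
  intro T hT hI hO
  obtain ⟨y, hy, hxy⟩ := hT.maximal x (by omega) (hO x hs)
  have h : (ncM x).testBit y := (ncM_testBit hx).mpr ⟨hT.lt_77 hy, hxy⟩
  rw [← hn, Nat.testBit_land, Bool.and_eq_true] at h
  exact absurd hy (hO y h.2)

theorem settled_edge {Ls : List (List ℕ)} {s : Node} {x y : ℕ} (hx : s.1.testBit x)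
    (hy : s.1.testBit y) (hxy : (adM x).testBit y)
    (h : popN 77 (adM 0 &&& (adM 1 &&& (s.2 ^^^ fullMask))) <
      popN 77 (s.1 &&& (adM x &&& adM y))) : Settled Ls s := by
  intro T hT hI hO
  exfalso
  have hx7 := hT.lt_77 (hI x hx)
  have hy7 := hT.lt_77 (hI y hy)
  have h1 := hT.common_le x (hI x hx) y (hI y hy) ((adM_testBit hx7).mp hxy).2
  rw [popN_eq, popN_eq] at h
  have h2 : (common T 0 1).card ≤ ((Finset.range 77).filter fun w =>
      (adM 0 &&& (adM 1 &&& (s.2 ^^^ fullMask))).testBit w).card := by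
    refine Finset.card_le_card fun w hw => ?_
    obtain ⟨hw, h0, h1⟩ := Finset.mem_filter.mp hw
    have hw7 := hT.lt_77 hw
    have hws : s.2.testBit w = false := by
      by_contra hc
      exact hO w (by simpa using hc) hw
    have e0 := (adM_testBit (i := 0) (by norm_num)).mpr ⟨hw7, h0⟩
    have e1 := (adM_testBit (i := 1) (by norm_num)).mpr ⟨hw7, h1⟩
    rw [Finset.mem_filter, Nat.testBit_land, Nat.testBit_land, Nat.testBit_xor,
      fullMask_testBit, e0, e1, hws]
    simp [hw7]
  have h3 : ((Finset.range 77).filter fun w =>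
      (s.1 &&& (adM x &&& adM y)).testBit w).card ≤ (common T x y).card := by
    refine Finset.card_le_card fun w hw => ?_
    rw [Finset.mem_filter, Nat.testBit_land, Nat.testBit_land, Bool.and_eq_true,
      Bool.and_eq_true] at hw
    exact Finset.mem_filter.mpr ⟨hI w hw.2.1, ((adM_testBit hx7).mp hw.2.2.1).2,
      ((adM_testBit hy7).mp hw.2.2.2).2⟩
  omega

theorem settled_instance {Ls : List (List ℕ)} {w : ℕ} {s g : Node} (h : isInstance w s g = true)
    (hg : Settled Ls g) : Settled Ls s := by
  intro T hT hI hO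
  rw [isInstance, Bool.and_eq_true] at h
  obtain ⟨τ, hs, h0, h1⟩ := exists_isSym_word 16 w
  refine Embeds.of_preim hs hT.lt (hg _ (IsPointed.preim hs (by norm_num) (by norm_num) ?_) ?_ ?_)
  · rwa [h0, h1]
  · intro x hx
    have := of_allBits h.1 x hx
    rw [Nat.zero_add, tb_eq, Bool.and_eq_true, blt_eq] at this
    exact mem_preim.mpr ⟨by omega, hI _ this.2⟩
  · intro x hx hm
    have := of_allBits h.2 x hx
    rw [Nat.zero_add, tb_eq] at this
    exact hO _ this (mem_preim.mp hm).2

theorem settled_of_search {Ls : List (List ℕ)} {goals : List Node}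
    (hg : ∀ g ∈ goals, Settled Ls g) : ∀ (ts : List ℕ) (st : List Node),
    search goals ts st = true → ∀ s ∈ st, Settled Ls s := by
  intro ts
  induction ts with
  | nil =>
    intro st h
    cases st with
    | nil => simp
    | cons s st => simp [search] at h
  | cons t ts ih =>
    intro st h
    cases st with
    | nil => simp
    | cons s st =>
      rw [search] at h
      rw [List.forall_mem_cons]
      cases h1 : Nat.blt t 128
      · rw [h1, cond_false] at h
        cases h2 : Nat.blt t 256
        · rw [h2, cond_false] at h
          cases h3 : Nat.blt t 32768
          · rw [h3, cond_false, Bool.and_eq_true] at h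
            refine ⟨settled_instance h.1 ?_, ih st h.2⟩
            have h' := h.1
            generalize Nat.pred (Nat.land (Nat.shiftRight t 15) 255) = k at h' ⊢
            by_cases hk : k < goals.length
            · rw [List.getD_eq_getElem _ _ hk]
              exact hg _ (List.getElem_mem hk)
            · exfalso
              rw [List.getD_eq_default _ _ (by omega), isInstance, Bool.and_eq_true] at h'
              have := of_allBits h'.1 127 (by decide)
              simp [Nat.blt] at this
          · rw [h3, cond_true] at h
            simp only [Bool.and_eq_true, blt_eq, tb_eq] at h
            obtain ⟨hx, hy, hxy, hlt, h⟩ := h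
            exact ⟨settled_edge hx hy hxy hlt, ih st h⟩
        · rw [h2, cond_true] at h
          simp only [Bool.and_eq_true, blt_eq, tb_eq, Nat.beq_eq] at h
          obtain ⟨hx, hs, hn, h⟩ := h
          exact ⟨settled_full hx hs hn, ih st h⟩
      · rw [h1, cond_true, Bool.and_eq_true, blt_eq] at h
        have h' := ih _ h.2
        rw [List.forall_mem_cons, List.forall_mem_cons] at h'
        exact ⟨settled_split h.1 h'.1 h'.2.1, h'.2.2⟩

/-! ### The 39 maximal sets of roots and the completeness of the list -/

/-- The 39 maximal representable graphs, given by roots that represent them. -/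
def maximalLists : List (List ℕ) := [
   [0, 1, 3, 4, 5, 6, 11, 12, 13, 14, 15, 16, 17, 22, 23, 24, 25, 32, 37, 38, 39, 40, 47, 58,
   63, 68, 73],
   [0, 1, 5, 6, 9, 10, 12, 13, 14, 15, 32, 33, 34, 37, 38, 41, 46],
   [0, 1, 4, 5, 9, 10, 12, 13, 15, 32, 33, 36, 37, 38, 41, 44, 46],
   [0, 1, 4, 5, 6, 9, 10, 12, 13, 14, 15, 32, 33, 37, 38, 41, 46],
   [0, 1, 4, 5, 8, 10, 12, 13, 32, 33, 36, 37, 39, 41, 44, 45, 46],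
   [0, 1, 4, 5, 6, 8, 9, 10, 12, 13, 32, 33, 37, 41, 44, 45, 46],
   [0, 1, 4, 5, 6, 8, 9, 10, 12, 15, 32, 33, 37, 41, 43, 44, 46],
   [0, 1, 4, 5, 6, 8, 9, 12, 13, 15, 32, 33, 37, 40, 41, 44, 46],
   [0, 1, 4, 5, 6, 8, 9, 10, 12, 13, 15, 32, 33, 37, 41, 44, 46],
   [0, 1, 4, 5, 6, 8, 9, 10, 12, 13, 14, 15, 32, 33, 37, 41, 46],
   [0, 1, 4, 5, 6, 8, 9, 10, 11, 12, 13, 32, 33, 37, 44, 45, 46],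
   [0, 1, 4, 5, 6, 8, 9, 10, 11, 12, 13, 15, 32, 33, 37, 44, 46],
   [0, 1, 4, 5, 6, 8, 9, 10, 11, 12, 13, 15, 16, 32, 33, 37, 44],
   [0, 1, 3, 5, 8, 10, 12, 15, 32, 34, 36, 37, 39, 41, 43, 44, 46],
   [0, 1, 3, 5, 6, 8, 9, 10, 12, 13, 14, 15, 32, 34, 37, 41, 46],
   [0, 1, 3, 4, 6, 8, 9, 10, 12, 13, 15, 32, 35, 37, 41, 44, 46],
   [0, 1, 3, 4, 6, 8, 9, 10, 12, 13, 15, 16, 32, 35, 37, 41, 44],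
   [0, 1, 3, 4, 5, 8, 9, 10, 12, 13, 15, 32, 36, 37, 41, 44, 46],
   [0, 1, 3, 4, 5, 6, 8, 9, 10, 12, 13, 15, 32, 37, 41, 44, 46],
   [0, 1, 3, 4, 5, 6, 8, 9, 10, 12, 13, 16, 32, 37, 41, 44, 45],
   [0, 1, 3, 4, 5, 6, 8, 9, 10, 12, 13, 15, 16, 32, 37, 41, 44],
   [0, 1, 3, 4, 5, 6, 8, 9, 10, 12, 13, 14, 15, 32, 37, 41, 46],
   [0, 1, 3, 4, 5, 6, 9, 10, 11, 12, 13, 14, 15, 32, 37, 38, 46],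
   [0, 1, 3, 4, 5, 6, 8, 9, 10, 11, 12, 13, 15, 32, 37, 44, 46],
   [0, 1, 3, 4, 5, 6, 8, 9, 10, 11, 12, 13, 15, 16, 32, 37, 44],
   [0, 1, 3, 4, 5, 6, 7, 8, 9, 10, 12, 13, 14, 15, 32, 41, 46],
   [0, 1, 3, 4, 5, 6, 7, 8, 9, 10, 12, 13, 14, 15, 16, 32, 41],
   [0, 1, 2, 3, 4, 5, 6, 7, 8, 9, 10, 11, 12, 13, 14, 15, 16],
   [0, 1, 4, 6, 9, 10, 13, 15, 16, 20, 23, 32, 44, 74],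
   [0, 1, 3, 5, 6, 8, 9, 10, 12, 13, 14, 15, 16, 19, 22, 32, 41],
   [0, 1, 3, 4, 5, 6, 8, 9, 10, 14, 15, 16, 22, 32, 37, 41, 42, 43],
   [0, 1, 3, 4, 5, 6, 8, 9, 13, 14, 15, 16, 22, 32, 37, 40, 41, 42],
   [0, 1, 3, 4, 5, 6, 8, 9, 10, 13, 14, 15, 16, 22, 32, 37, 41, 42],
   [0, 1, 3, 4, 5, 6, 8, 9, 10, 12, 13, 14, 15, 16, 22, 32, 37, 41],
   [0, 1, 3, 4, 5, 6, 7, 8, 9, 10, 11, 12, 13, 14, 15, 16, 17, 32],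
   [0, 1, 3, 4, 5, 6, 8, 9, 10, 11, 12, 13, 14, 15, 16, 17, 22, 32, 37],
   [0, 1, 4, 5, 6, 8, 9, 10, 11, 12, 13, 14, 15, 16, 17, 18, 22, 32, 33, 37],
   [0, 1, 3, 4, 5, 6, 9, 10, 11, 12, 13, 14, 15, 16, 17, 22, 23, 32, 37, 38],
   [0, 1, 3, 4, 5, 6, 10, 11, 12, 13, 14, 15, 16, 17, 22, 23, 24, 32, 37, 38, 39, 73]]

/-- The maximal sets of roots in which the edge `0 1` has as many common neighbours as possible, up
to symmetries that fix `0` and `1`, with isomorphisms to the graphs in the list of maximal graphs. -/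
def leafLists : List (ℕ × List ℕ) := [
   (1, [0, 1, 5, 6, 9, 10, 12, 13, 14, 15, 32, 33, 34, 37, 38, 41, 46]),
   (1, [1, 0, 5, 6, 9, 10, 12, 13, 14, 15, 17, 18, 19, 22, 23, 26, 31]),
   (28, [0, 1, 4, 6, 9, 10, 13, 15, 16, 20, 23, 32, 44, 74]),
   (28, [0, 1, 4, 6, 9, 16, 13, 15, 10, 17, 29, 35, 38, 74]),
   (2, [0, 1, 4, 5, 9, 10, 12, 13, 15, 32, 33, 36, 37, 38, 41, 44, 46]),
   (2, [1, 0, 4, 5, 9, 10, 12, 13, 15, 17, 18, 21, 22, 23, 26, 29, 31]),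
   (3, [0, 1, 4, 5, 6, 9, 10, 12, 13, 14, 15, 32, 33, 37, 38, 41, 46]),
   (3, [1, 0, 4, 5, 6, 9, 10, 12, 13, 14, 15, 17, 18, 22, 23, 26, 31]),
   (4, [0, 1, 4, 5, 8, 10, 12, 13, 32, 33, 36, 37, 39, 41, 44, 45, 46]),
   (4, [1, 0, 4, 5, 8, 10, 12, 13, 17, 18, 21, 22, 24, 26, 29, 30, 31]),
   (5, [0, 1, 4, 5, 6, 8, 9, 10, 12, 13, 32, 33, 37, 41, 44, 45, 46]),
   (5, [1, 0, 4, 5, 6, 8, 9, 10, 12, 13, 17, 18, 22, 26, 29, 30, 31]),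
   (6, [0, 1, 4, 5, 6, 8, 9, 10, 12, 15, 32, 33, 37, 41, 43, 44, 46]),
   (6, [1, 0, 4, 5, 6, 8, 9, 10, 12, 15, 17, 18, 22, 26, 28, 29, 31]),
   (7, [0, 1, 4, 5, 6, 8, 9, 12, 13, 15, 32, 33, 37, 40, 41, 44, 46]),
   (7, [1, 0, 4, 5, 6, 8, 9, 12, 13, 15, 17, 18, 22, 25, 26, 29, 31]),
   (8, [0, 1, 4, 5, 6, 8, 9, 10, 12, 13, 15, 32, 33, 37, 41, 44, 46]),
   (8, [1, 0, 4, 5, 6, 8, 9, 10, 12, 13, 15, 17, 18, 22, 26, 29, 31]),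
   (9, [0, 1, 4, 5, 6, 8, 9, 10, 12, 13, 14, 15, 32, 33, 37, 41, 46]),
   (9, [1, 0, 4, 5, 6, 8, 9, 10, 12, 13, 14, 15, 17, 18, 22, 26, 31]),
   (10, [0, 1, 4, 5, 6, 8, 9, 10, 11, 12, 13, 32, 33, 37, 44, 45, 46]),
   (10, [1, 0, 4, 5, 6, 8, 9, 10, 11, 12, 13, 17, 18, 22, 29, 30, 31]),
   (11, [0, 1, 4, 5, 6, 8, 9, 10, 11, 12, 13, 15, 32, 33, 37, 44, 46]),
   (11, [1, 0, 4, 5, 6, 8, 9, 10, 11, 12, 13, 15, 17, 18, 22, 29, 31]),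
   (12, [0, 1, 4, 5, 6, 8, 9, 10, 11, 12, 13, 15, 16, 32, 33, 37, 44]),
   (12, [1, 0, 4, 5, 6, 8, 9, 10, 11, 12, 13, 15, 16, 17, 18, 22, 29]),
   (36, [0, 1, 4, 5, 6, 8, 9, 10, 11, 12, 13, 14, 15, 16, 17, 18, 22, 32, 33, 37]),
   (13, [0, 1, 3, 5, 8, 10, 12, 15, 32, 34, 36, 37, 39, 41, 43, 44, 46]),
   (13, [1, 0, 3, 5, 8, 10, 12, 15, 17, 19, 21, 22, 24, 26, 28, 29, 31]),
   (5, [0, 6, 3, 1, 5, 44, 10, 41, 15, 37, 32, 34, 12, 9, 43, 8, 46]),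
   (5, [1, 6, 3, 0, 5, 29, 10, 26, 15, 22, 17, 19, 12, 9, 28, 8, 31]),
   (7, [0, 5, 1, 6, 3, 9, 41, 37, 40, 12, 32, 34, 13, 15, 44, 46, 8]),
   (7, [1, 5, 0, 6, 3, 9, 26, 22, 25, 12, 17, 19, 13, 15, 29, 31, 8]),
   (8, [0, 6, 3, 5, 1, 44, 41, 10, 37, 15, 13, 32, 34, 12, 9, 8, 46]),
   (8, [1, 6, 3, 5, 0, 29, 26, 10, 22, 15, 13, 17, 19, 12, 9, 8, 31]),
   (14, [0, 1, 3, 5, 6, 8, 9, 10, 12, 13, 14, 15, 32, 34, 37, 41, 46]),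
   (14, [1, 0, 3, 5, 6, 8, 9, 10, 12, 13, 14, 15, 17, 19, 22, 26, 31]),
   (29, [0, 1, 3, 5, 6, 8, 9, 10, 12, 13, 14, 15, 16, 19, 22, 32, 41]),
   (29, [0, 1, 3, 5, 6, 8, 14, 15, 12, 13, 9, 10, 16, 17, 26, 34, 37]),
   (15, [0, 1, 3, 4, 6, 8, 9, 10, 12, 13, 15, 32, 35, 37, 41, 44, 46]),
   (15, [1, 0, 3, 4, 6, 8, 9, 10, 12, 13, 15, 17, 20, 22, 26, 29, 31]),
   (16, [0, 1, 3, 4, 6, 8, 9, 10, 12, 13, 15, 16, 32, 35, 37, 41, 44]),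
   (16, [1, 0, 3, 4, 6, 8, 9, 10, 12, 13, 15, 16, 17, 20, 22, 26, 29]),
   (17, [0, 1, 3, 4, 5, 8, 9, 10, 12, 13, 15, 32, 36, 37, 41, 44, 46]),
   (17, [1, 0, 3, 4, 5, 8, 9, 10, 12, 13, 15, 17, 21, 22, 26, 29, 31]),
   (18, [0, 1, 3, 4, 5, 6, 8, 9, 10, 12, 13, 15, 32, 37, 41, 44, 46]),
   (18, [1, 0, 3, 4, 5, 6, 8, 9, 10, 12, 13, 15, 17, 22, 26, 29, 31]),
   (19, [0, 1, 3, 4, 5, 6, 8, 9, 10, 12, 13, 16, 32, 37, 41, 44, 45]),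
   (19, [1, 0, 3, 4, 5, 6, 8, 9, 10, 12, 13, 16, 17, 22, 26, 29, 30]),
   (19, [0, 6, 4, 3, 1, 5, 44, 10, 41, 15, 37, 16, 32, 12, 9, 43, 8]),
   (19, [1, 6, 4, 3, 0, 5, 29, 10, 26, 15, 22, 16, 17, 12, 9, 28, 8]),
   (20, [0, 1, 3, 4, 5, 6, 8, 9, 10, 12, 13, 15, 16, 32, 37, 41, 44]),
   (20, [1, 0, 3, 4, 5, 6, 8, 9, 10, 12, 13, 15, 16, 17, 22, 26, 29]),
   (30, [0, 1, 3, 4, 5, 6, 8, 9, 10, 14, 15, 16, 22, 32, 37, 41, 42, 43]),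
   (30, [1, 0, 3, 4, 5, 6, 8, 9, 10, 14, 15, 16, 37, 17, 22, 26, 27, 28]),
   (31, [0, 1, 3, 4, 5, 6, 8, 9, 13, 14, 15, 16, 22, 32, 37, 40, 41, 42]),
   (31, [1, 0, 3, 4, 5, 6, 8, 9, 13, 14, 15, 16, 37, 17, 22, 25, 26, 27]),
   (32, [0, 1, 3, 4, 5, 6, 8, 9, 10, 13, 14, 15, 16, 22, 32, 37, 41, 42]),
   (32, [1, 0, 3, 4, 5, 6, 8, 9, 10, 13, 14, 15, 16, 37, 17, 22, 26, 27]),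
   (21, [0, 1, 3, 4, 5, 6, 8, 9, 10, 12, 13, 14, 15, 32, 37, 41, 46]),
   (21, [1, 0, 3, 4, 5, 6, 8, 9, 10, 12, 13, 14, 15, 17, 22, 26, 31]),
   (33, [0, 1, 3, 4, 5, 6, 8, 9, 10, 12, 13, 14, 15, 16, 22, 32, 37, 41]),
   (33, [1, 0, 3, 4, 5, 6, 8, 9, 10, 12, 13, 14, 15, 16, 37, 17, 22, 26]),
   (0, [0, 1, 3, 4, 5, 6, 11, 12, 13, 14, 15, 16, 17, 22, 23, 24, 25, 32, 37, 38, 39, 40, 47, 58,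
   63, 68, 73]),
   (38, [0, 1, 3, 4, 5, 6, 10, 11, 12, 13, 14, 15, 16, 17, 22, 23, 24, 32, 37, 38, 39, 73]),
   (22, [0, 1, 3, 4, 5, 6, 9, 10, 11, 12, 13, 14, 15, 32, 37, 38, 46]),
   (22, [1, 0, 3, 4, 5, 6, 9, 10, 11, 12, 13, 14, 15, 17, 22, 23, 31]),
   (37, [0, 1, 3, 4, 5, 6, 9, 10, 11, 12, 13, 14, 15, 16, 17, 22, 23, 32, 37, 38]),
   (23, [0, 1, 3, 4, 5, 6, 8, 9, 10, 11, 12, 13, 15, 32, 37, 44, 46]),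
   (23, [1, 0, 3, 4, 5, 6, 8, 9, 10, 11, 12, 13, 15, 17, 22, 29, 31]),
   (24, [0, 1, 3, 4, 5, 6, 8, 9, 10, 11, 12, 13, 15, 16, 32, 37, 44]),
   (24, [1, 0, 3, 4, 5, 6, 8, 9, 10, 11, 12, 13, 15, 16, 17, 22, 29]),
   (35, [0, 1, 3, 4, 5, 6, 8, 9, 10, 11, 12, 13, 14, 15, 16, 17, 22, 32, 37]),
   (25, [0, 1, 3, 4, 5, 6, 7, 8, 9, 10, 12, 13, 14, 15, 32, 41, 46]),
   (25, [1, 0, 3, 4, 5, 6, 7, 8, 9, 10, 12, 13, 14, 15, 17, 26, 31]),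
   (26, [0, 1, 3, 4, 5, 6, 7, 8, 9, 10, 12, 13, 14, 15, 16, 32, 41]),
   (26, [1, 0, 3, 4, 5, 6, 7, 8, 9, 10, 12, 13, 14, 15, 16, 17, 26]),
   (34, [0, 1, 3, 4, 5, 6, 7, 8, 9, 10, 11, 12, 13, 14, 15, 16, 17, 32]),
   (27, [0, 1, 2, 3, 4, 5, 6, 7, 8, 9, 10, 11, 12, 13, 14, 15, 16])]

/-- A mask with the given elements. -/
def toMask : List ℕ → ℕ
  | [] => 0
  | x :: l => Nat.lor (Nat.shiftLeft 1 x) (toMask l)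

theorem toMask_testBit (l : List ℕ) (x : ℕ) : (toMask l).testBit x ↔ x ∈ l := by
  induction l with
  | nil => simp [toMask]
  | cons y l ih =>
    rw [toMask, List.mem_cons, ← ih]
    change (1 <<< y ||| toMask l).testBit x = true ↔ _
    rw [Nat.testBit_lor, Bool.or_eq_true, Nat.one_shiftLeft, Nat.testBit_two_pow,
      decide_eq_true_iff, eq_comm]

/-- Checks that two lists of roots represent the same graph. -/
def sameGraph : List ℕ → List ℕ → Bool
  | [], [] => true
  | x :: l, y :: m => (Nat.blt x 77 && Nat.blt y 77) &&
      (((l.zip m).all fun p => tb (adM x) p.1 == tb (adM y) p.2) && sameGraph l m)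
  | _, _ => false

theorem of_sameGraph : ∀ {l m : List ℕ}, sameGraph l m = true →
    l.length = m.length ∧ (∀ x ∈ l, x < 77) ∧ (∀ x ∈ m, x < 77) ∧
      (l.zip m).Pairwise fun p q => ip p.1 q.1 = 4 ↔ ip p.2 q.2 = 4
  | [], [], _ => by simp
  | x :: l, y :: m, h => by
    rw [sameGraph, Bool.and_eq_true, Bool.and_eq_true, Bool.and_eq_true, blt_eq, blt_eq,
      List.all_eq_true] at h
    obtain ⟨⟨hx, hy⟩, ha, hr⟩ := h
    obtain ⟨h1, h2, h3, h4⟩ := of_sameGraph hr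
    refine ⟨by simp [h1], by simpa using ⟨hx, h2⟩, by simpa using ⟨hy, h3⟩, ?_⟩
    rw [List.zip_cons_cons, List.pairwise_cons]
    refine ⟨fun p hp => ?_, h4⟩
    have h5 := ha p hp
    rw [beq_iff_eq, tb_eq, tb_eq, Bool.eq_iff_iff, adM_testBit hx, adM_testBit hy] at h5
    have := h2 _ (List.of_mem_zip hp).1
    have := h3 _ (List.of_mem_zip hp).2
    tauto
  | [], _ :: _, h => by simp [sameGraph] at h
  | _ :: _, [], h => by simp [sameGraph] at h

theorem leafLists_sameGraph :
    (leafLists.all fun p => Nat.blt p.1 39 && sameGraph p.2 (maximalLists.getD p.1 [])) = true := by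
  decide +kernel

theorem embeds_of_sameGraph {Ls : List (List ℕ)} {l m : List ℕ} (hm : m ∈ Ls)
    (h : sameGraph l m = true) {T : Finset ℕ} (hT : ∀ x ∈ T, x ∈ l) (hne : T.Nonempty) :
    Embeds Ls T := by
  obtain ⟨hlen, h1, h2, hp⟩ := of_sameGraph h
  obtain ⟨x0, hx0⟩ := hne
  have hpos : 0 < m.length := by
    rw [← hlen]; exact List.length_pos_of_mem (hT x0 hx0)
  refine ⟨m, hm, fun x => if hx : l.idxOf x < m.length then ⟨_, hx⟩ else ⟨0, hpos⟩, ?_, ?_⟩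
  · intro x hx y hy e
    have ex := List.idxOf_lt_length_of_mem (hT x hx)
    have ey := List.idxOf_lt_length_of_mem (hT y hy)
    simp only [← hlen, ex, ey, dif_pos, Fin.mk.injEq] at e
    exact (List.idxOf_inj (hT x hx)).mp e
  · have key : ∀ x ∈ T, ∀ y ∈ T, l.idxOf x < l.idxOf y →
        (ip x y = 4 ↔ ip (m.getD (l.idxOf x) 0) (m.getD (l.idxOf y) 0) = 4) := by
      intro x hx y hy hxy
      have ex := List.idxOf_lt_length_of_mem (hT x hx)
      have ey := List.idxOf_lt_length_of_mem (hT y hy)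
      have := List.pairwise_iff_getElem.mp hp (l.idxOf x) (l.idxOf y) (by simp; omega)
        (by simp; omega) hxy
      simpa [List.getElem_zip, hlen ▸ ex, hlen ▸ ey] using this
    intro x hx y hy hxy
    have ex := List.idxOf_lt_length_of_mem (hT x hx)
    have ey := List.idxOf_lt_length_of_mem (hT y hy)
    rw [hlen] at ex ey
    simp only [ex, ey, dif_pos]
    have e : ∀ (i : ℕ) (hi : i < m.length), m.get ⟨i, hi⟩ = m.getD i 0 := by
      intro i hi; simp [hi]
    rw [e, e]
    rcases lt_trichotomy (l.idxOf x) (l.idxOf y) with h | h | h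
    · exact key x hx y hy h
    · exact absurd ((List.idxOf_inj (hT x hx)).mp h) hxy
    · rw [ip_comm, key y hy x hx h, ip_comm]

/-- The node of all sets inside a list of roots. -/
def leafNode (p : ℕ × List ℕ) : Node := (0, Nat.xor fullMask (toMask p.2))

theorem settled_leafNode : ∀ g ∈ leafLists.map leafNode, Settled maximalLists g := by
  intro g hg
  obtain ⟨p, hp, rfl⟩ := List.mem_map.mp hg
  have h := List.all_eq_true.mp leafLists_sameGraph p hp
  rw [Bool.and_eq_true, blt_eq] at h
  have hm : maximalLists.getD p.1 [] ∈ maximalLists := by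
    rw [List.getD_eq_getElem _ _ h.1]
    exact List.getElem_mem _
  intro T hT hI hO
  refine embeds_of_sameGraph hm h.2 (fun x hx => ?_) ⟨0, hT.left_mem⟩
  by_contra hx'
  refine hO x ?_ hx
  change (fullMask ^^^ toMask p.2).testBit x = true
  rw [Nat.testBit_xor, fullMask_testBit, show (toMask p.2).testBit x = false by
    rw [Bool.eq_false_iff, Ne, toMask_testBit]; exact hx']
  simpa using hT.lt_77 hx

/-- Adds the roots incompatible with an element of a mask. -/
def closeMask : ℕ → ℕ → ℕ → ℕ → ℕ
  | 0, _, _, acc => acc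
  | n + 1, m, x, acc => cond (Nat.beq m 0) acc (closeMask n (Nat.shiftRight m 1) (Nat.succ x)
      (cond (Nat.beq (Nat.land m 1) 1) (Nat.lor acc (ncM x)) acc))

theorem of_closeMask (n : ℕ) : ∀ {m x acc y : ℕ}, (closeMask n m x acc).testBit y →
    acc.testBit y ∨ ∃ z, m.testBit z ∧ (ncM (x + z)).testBit y := by
  induction n with
  | zero => intro m x acc y h; exact Or.inl h
  | succ n ih =>
    intro m x acc y h
    rw [closeMask] at h
    by_cases hm : m = 0
    · rw [hm] at h
      exact Or.inl h
    rw [beq_zero_false hm, cond_false] at h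
    rcases ih h with h | ⟨z, hz, hy⟩
    · have e : Nat.beq (Nat.land m 1) 1 = m.testBit 0 := by
        rw [Bool.eq_iff_iff, Nat.beq_eq, Nat.testBit_zero, decide_eq_true_iff]
        change m &&& 1 = 1 ↔ _
        rw [Nat.and_one_is_mod]
      rw [e] at h
      cases hb : m.testBit 0
      · rw [hb] at h
        exact Or.inl h
      · rw [hb, cond_true] at h
        change (acc ||| ncM x).testBit y = true at h
        rw [Nat.testBit_lor, Bool.or_eq_true] at h
        exact h.imp_right fun h => ⟨0, hb, h⟩
    · refine Or.inr ⟨z + 1, ?_, ?_⟩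
      · change (m >>> 1).testBit z = true at hz
        rwa [Nat.testBit_shiftRight, Nat.add_comm] at hz
      · rwa [← Nat.add_assoc, Nat.add_right_comm]

/-- Excludes the roots incompatible with the required ones. -/
def closeNode (s : Node) : Node := (s.1, closeMask 77 s.1 0 s.2)

theorem settled_of_closeNode {Ls : List (List ℕ)} {s : Node} (h : Settled Ls (closeNode s)) :
    Settled Ls s := by
  intro T hT hI hO
  refine h T hT hI fun x hx hxT => ?_
  rcases of_closeMask 77 hx with h | ⟨z, hz, hx⟩
  · exact hO x h hxT
  · have hzT := hI z hz
    rw [Nat.zero_add, ncM_testBit (hT.lt_77 hzT)] at hx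
    have := hT.compat z hzT x hxT
    omega

/-- The node that prescribes the edges of a graph on some of the six indices: the common
neighbours of the roots `0` and `1` correspond to the edges of `K₆`. -/
def graphNode (scope A : ℕ) : Node :=
  (Nat.lor 3 (Nat.shiftLeft A 2), Nat.shiftLeft (Nat.xor A scope) 2)

/-- The graphs on two vertices, up to isomorphism, as sets of edges. -/
def graphs2 : List ℕ := [0, 1]

/-- The graphs on three vertices, up to isomorphism. -/
def graphs3 : List ℕ := [0, 2, 34, 35]

/-- The graphs on four vertices, up to isomorphism. -/
def graphs4 : List ℕ := [0, 4, 68, 580, 66, 70, 518, 582, 102, 614, 615]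

/-- The graphs on five vertices, up to isomorphism. -/
def graphs5 : List ℕ := [0, 8, 136, 1160, 5256, 132, 140, 1156, 1164, 4108, 4236, 5260, 204, 1100, 1228, 4300, 5196,
   5324, 1740, 5836, 1098, 1226, 5322, 1222, 1230, 4302, 5326, 5646, 5774, 1742, 5838, 5358,
   5870, 5871]

/-- The graphs on six vertices, up to isomorphism. -/
def graphs6 : List ℕ := [0, 16, 272, 2320, 10512, 26896, 264, 280, 2312, 2328, 10504, 10520, 16408, 16664, 18712,
   26904, 408, 2200, 2456, 10376, 10392, 10648, 16792, 18584, 18840, 26760, 26776, 27032, 3480,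
   9624, 11672, 19864, 26008, 28056, 15768, 32152, 2180, 2196, 2452, 8340, 8596, 10388, 10644,
   24980, 27028, 2444, 2460, 8588, 8604, 10396, 10636, 10652, 16796, 18588, 18844, 24988,
   27036, 3460, 3476, 9364, 9620, 11668, 19844, 19860, 25748, 26004, 28052, 3484, 9628, 11660,
   11676, 19868, 25756, 26012, 28044, 28060, 28700, 28956, 31004, 12700, 14492, 14748, 29084,
   30876, 31132, 15772, 32156, 10460, 10716, 25052, 27100, 3404, 3420, 9564, 11596, 11612,
   25948, 27980, 27996, 3548, 9692, 11484, 11740, 19932, 26076, 27868, 28124, 29148, 30940,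
   31196, 32076, 32092, 15836, 32220, 4060, 12252, 28636, 32732, 9546, 9562, 11610, 19546,
   19802, 27994, 9690, 11482, 11738, 19930, 26074, 27866, 28122, 15834, 32218, 11734, 28118,
   11726, 11742, 19934, 26078, 28126, 29150, 30942, 31198, 15838, 32222, 32286, 32542, 16286,
   32670, 12254, 28638, 32734, 15870, 32254, 32766, 32767]

/-- Certificates that every one-vertex extension of the one-vertex graph is in `graphs2`. -/
def extend1 : List ℕ := [2, 32768, 65536]

/-- Certificates that every one-vertex extension of a graph in `graphs2` is isomorphic to a graph
in `graphs3`. -/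
def extend2 : List ℕ := [3, 7, 32768, 42008576, 7, 65536, 98304, 3, 7, 8454144, 8486912, 7, 344031232, 131072]

/-- Certificates that every one-vertex extension of a graph in `graphs3` is isomorphic to a graph
in `graphs4`. -/
def extend3 : List ℕ := [4, 8, 11, 32768, 109117440, 11, 42008576, 344031232, 8, 11, 65536, 8486912, 11, 98304,
   131072, 4, 8, 11, 16842752, 142704640, 11, 163840, 1182990336, 8, 11, 178920718336, 229376,
   11, 196608, 262144, 4, 8, 11, 16875520, 16908288, 11, 176357376, 176422912, 8, 11, 16973824,
   17039360, 11, 294912, 327680, 4, 8, 11, 142835712, 142868480, 11, 679739392, 142934016, 8,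
   11, 22154575872, 2827288576, 11, 7122255872, 360448]

/-- Certificates that every one-vertex extension of a graph in `graphs4` is isomorphic to a graph
in `graphs5`. -/
def extend4 : List ℕ := [5, 9, 12, 14, 32768, 1182859264, 14, 109117440, 7122026496, 12, 14, 42008576, 2827059200,
   14, 344031232, 2768371712, 9, 12, 14, 65536, 142704640, 14, 8486912, 84017152, 12, 14,
   98304, 16908288, 14, 131072, 163840, 5, 9, 12, 14, 25231360, 1753317376, 14, 8585216,
   14067924992, 12, 14, 196608, 48427663360, 14, 262144, 177276747776, 9, 12, 14,
   90767297183744, 327680, 14, 8617984, 8749056, 12, 14, 229376, 360448, 14, 294912, 393216, 5,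
   9, 12, 14, 25264128, 218234880, 14, 1719926784, 14067990528, 12, 14, 243499008, 243630080,
   14, 42401792, 42500096, 9, 12, 14, 25395200, 25526272, 14, 458752, 557056, 12, 14, 425984,
   524288, 14, 491520, 589824, 5, 9, 12, 14, 25296896, 25329664, 14, 1719959552, 1720057856,
   12, 14, 243564544, 243662848, 14, 2894561280, 2894659584, 9, 12, 14, 25460736, 25559040, 14,
   210206720, 210305024, 12, 14, 25657344, 25755648, 14, 622592, 655360, 5, 9, 12, 14,
   218300416, 218365952, 14, 10376970240, 14068154368, 12, 14, 43704909824, 176848896, 14,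
   2797206962176, 2768961536, 9, 12, 14, 177385766912, 11352781815808, 14, 688128, 680198144,
   12, 14, 29185486028800, 176881664, 14, 720896, 753664, 5, 9, 12, 14, 218333184, 218398720,
   14, 1292304384, 1753710592, 12, 14, 3648214466560, 1787494400, 14, 786432, 14068514816, 9,
   12, 14, 91609144524800, 11352781914112, 14, 11451138506752, 1431407755264, 12, 14,
   732882088198144, 851968, 14, 819200, 884736, 5, 9, 12, 14, 218431488, 1753579520, 14,
   10343514112, 1753743360, 12, 14, 25853952, 6048907264, 14, 74768384000, 14068547584, 9, 12,
   14, 11361942077440, 1431977852928, 14, 11602460409856, 917504, 12, 14, 91609111396352,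
   11455861424128, 14, 92819721879552, 950272, 5, 9, 12, 14, 218464256, 218497024, 14,
   1292402688, 1753808896, 12, 14, 25886720, 25919488, 14, 23195320320, 14068580352, 9, 12, 14,
   1419126538240, 1431977918464, 14, 11602460737536, 26116096, 12, 14, 25985024, 26050560, 14,
   983040, 1015808, 5, 9, 12, 14, 218529792, 218595328, 14, 1292337152, 218726400, 12, 14,
   456021999616, 1787592704, 14, 10377527296, 1787756544, 9, 12, 14, 11451138277376, 218923008,
   14, 1292664832, 219086848, 12, 14, 456022130688, 3648214990848, 14, 456022491136, 1048576,
   5, 9, 12, 14, 218628096, 218693632, 14, 1292435456, 218759168, 12, 14, 1787625472,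
   1787658240, 14, 10377592832, 1787789312, 9, 12, 14, 218955776, 218988544, 14, 1292730368,
   219119616, 12, 14, 3648181436416, 26214400, 14, 160432128, 1081344, 5, 9, 12, 14,
   1754136576, 1754169344, 14, 10344103936, 1754234880, 12, 14, 44703842304, 6049202176, 14,
   74768678912, 1754300416, 9, 12, 14, 1419093377024, 177847894016, 14, 1449158213632,
   23229136896, 12, 14, 3648181469184, 57588875264, 14, 607344689152, 1114112]

/-- Certificates that every one-vertex extension of a graph in `graphs5` is isomorphic to a graph
in `graphs6`. -/
def extend5 : List ℕ := [6, 10, 13, 15, 16, 32768, 14067761152, 16, 1182859264, 607343706112, 15, 16, 109117440,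
   57587892224, 16, 7122026496, 456021639168, 13, 15, 16, 42008576, 23228153856, 16,
   2827059200, 181143732224, 15, 16, 344031232, 22229942272, 16, 2768371712, 22171254784, 10,
   13, 15, 16, 65536, 1753317376, 16, 142704640, 9345040384, 15, 16, 8486912, 755105792, 16,
   84017152, 696418304, 13, 15, 16, 98304, 218234880, 16, 16908288, 159547392, 15, 16, 131072,
   25329664, 16, 163840, 196608, 6, 10, 13, 15, 16, 33619968, 18933186560, 16, 142835712,
   151506911232, 15, 16, 8617984, 701262725120, 16, 84180992, 732872927674368, 13, 15, 16,
   229376, 2900285980672, 16, 17072128, 90758137053184, 15, 16, 294912, 11352781684736, 16,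
   360448, 11352781750272, 10, 13, 15, 16, 46501011371687936, 425984, 16, 142868480, 143065088,
   15, 16, 8650752, 8847360, 16, 84213760, 84377600, 13, 15, 16, 262144, 458752, 16, 17104896,
   17268736, 15, 16, 327680, 491520, 16, 393216, 524288, 6, 10, 13, 15, 16, 33652736,
   2365718528, 16, 18362957824, 151506976768, 15, 16, 2256830464, 701262790656, 16, 655360,
   851968, 13, 15, 16, 310640640, 310837248, 16, 176750592, 176947200, 15, 16, 42532864,
   42729472, 16, 42631168, 42827776, 10, 13, 15, 16, 33816576, 34013184, 16, 17367040,
   17563648, 15, 16, 589824, 786432, 16, 688128, 884736, 13, 15, 16, 557056, 753664, 16,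
   17399808, 17596416, 15, 16, 622592, 819200, 16, 720896, 917504, 6, 10, 13, 15, 16, 33685504,
   293765120, 16, 18363023360, 151507042304, 15, 16, 2256863232, 2257027072, 16, 58125352960,
   58125549568, 13, 15, 16, 310706176, 310870016, 16, 23765614592, 23765811200, 15, 16,
   2961801216, 2961997824, 16, 344915968, 345014272, 10, 13, 15, 16, 33882112, 34045952, 16,
   2290778112, 2290974720, 15, 16, 277446656, 277643264, 16, 9371648, 9469952, 13, 15, 16,
   34177024, 34373632, 16, 983040, 1081344, 15, 16, 950272, 1048576, 16, 1015808, 1114112, 6,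
   10, 13, 15, 16, 33718272, 33751040, 16, 18363056128, 18363187200, 15, 16, 2256928768,
   2257059840, 16, 58125385728, 58125582336, 13, 15, 16, 310771712, 310902784, 16, 23765647360,
   23765843968, 15, 16, 2961899520, 2962096128, 16, 22297935872, 22298034176, 10, 13, 15, 16,
   33947648, 34078720, 16, 2290810880, 2291007488, 15, 16, 277544960, 277741568, 16, 823099392,
   823197696, 13, 15, 16, 34275328, 34471936, 16, 286228480, 286326784, 15, 16, 34570240,
   34668544, 16, 1146880, 1179648, 6, 10, 13, 15, 16, 293830656, 2365882368, 16, 122046152704,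
   151507238912, 15, 16, 1212416, 48428679168, 16, 177277698048, 29194647207936, 13, 15, 16,
   22890246602752, 244580352, 16, 1464975873343488, 177378459648, 15, 16, 244514816, 244645888,
   16, 177277730816, 177378525184, 10, 13, 15, 16, 90819449356288, 5809146314686464, 16,
   1310720, 44704235520, 15, 16, 1245184, 44704169984, 16, 1376256, 44704301056, 13, 15, 16,
   956650309340954624, 244613120, 16, 1343488, 1441792, 15, 16, 1277952, 244678656, 16,
   1409024, 1474560, 6, 10, 13, 15, 16, 293863424, 2365915136, 16, 15251079168, 18933710848,
   15, 16, 278069248, 87653842944, 16, 151508156416, 151508189184, 13, 15, 16,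
   119581288696446976, 2392096768, 16, 1572864, 426386161664, 15, 16, 1507328,
   5863056745234432, 16, 1671168, 5863056745299968, 10, 13, 15, 16, 3001885050213302272,
   5809146314883072, 16, 46903884204244992, 5863056745332736, 15, 16, 2974262981628755968,
   1769472, 16, 1638400, 5863056745398272, 13, 15, 16, 24015080440703057920, 1736704, 16,
   1605632, 1835008, 15, 16, 1540096, 1802240, 16, 1703936, 1867776, 6, 10, 13, 15, 16,
   293896192, 293961728, 16, 18933743616, 151507337216, 15, 16, 18900779008, 18900910080, 16,
   11460157046784, 151508287488, 13, 15, 16, 2391998464, 2392129536, 16, 1427113443328,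
   426386194432, 15, 16, 1900544, 2064384, 16, 177278386176, 177278550016, 10, 13, 15, 16,
   1419244077056, 5809146314784768, 16, 1966080, 2129920, 15, 16, 278331392, 5809146315735040,
   16, 10387456, 10551296, 13, 15, 16, 35061760, 46904492915490816, 16, 1998848, 2162688, 15,
   16, 1933312, 2097152, 16, 2031616, 2195456, 6, 10, 13, 15, 16, 293928960, 293994496, 16,
   18933776384, 18933809152, 15, 16, 278102016, 18900942848, 16, 151508320256, 151508353024,
   13, 15, 16, 34832384, 2392162304, 16, 426386227200, 426386259968, 15, 16, 35487744,
   35651584, 16, 2293760, 2457600, 10, 13, 15, 16, 1419244273664, 5809146314981376, 16,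
   90831690170368, 2392064, 15, 16, 278364160, 278626304, 16, 10649600, 10813440, 13, 15, 16,
   35094528, 35356672, 16, 2260992, 2424832, 15, 16, 2228224, 2359296, 16, 2326528, 2490368, 6,
   10, 13, 15, 16, 294027264, 18933547008, 16, 122012762112, 18933841920, 15, 16, 278134784,
   87653908480, 16, 912287629312, 151508385792, 13, 15, 16, 34865152, 362531815424, 16,
   3111310884864, 426386292736, 15, 16, 35520512, 35684352, 16, 237010944, 1427114328064, 10,
   13, 15, 16, 5812484074569728, 726143284772864, 16, 5827877237653504, 2523136, 15, 16,
   46468300902006784, 5809146315833344, 16, 46623017938878464, 10944512, 13, 15, 16,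
   375231073700052992, 46904492915589120, 16, 375385790736924672, 2555904, 15, 16,
   11353857228800, 35946496, 16, 237273088, 2588672, 6, 10, 13, 15, 16, 294060032, 2366078976,
   16, 15251275776, 18933907456, 15, 16, 278200320, 87653974016, 16, 11460157177856,
   151508451328, 13, 15, 16, 34897920, 34996224, 16, 1427113541632, 426386391040, 15, 16,
   35553280, 35717120, 16, 1427114196992, 1427114360832, 10, 13, 15, 16, 726143284805632,
   726143284838400, 16, 46923223838392320, 36110336, 15, 16, 278462464, 5809146315898880, 16,
   2654208, 2752512, 13, 15, 16, 35160064, 35389440, 16, 2621440, 2719744, 15, 16, 35815424,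
   35979264, 16, 2686976, 2785280, 6, 10, 13, 15, 16, 294092800, 294125568, 16, 18933972992,
   18934005760, 15, 16, 278233088, 278298624, 16, 11460157243392, 151508516864, 13, 15, 16,
   34963456, 35028992, 16, 1427113639936, 426386423808, 15, 16, 35586048, 35749888, 16,
   1427114262528, 1427114426368, 10, 13, 15, 16, 726143284903936, 726143284936704, 16,
   1906606080, 36143104, 15, 16, 278528000, 278691840, 16, 279511040, 279609344, 13, 15, 16,
   35258368, 35422208, 16, 36241408, 36339712, 15, 16, 35880960, 36044800, 16, 2818048,
   2850816, 6, 10, 13, 15, 16, 294158336, 2366210048, 16, 15251111936, 2366537728, 15, 16,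
   18901434368, 151508582400, 16, 976142303232, 151508877312, 13, 15, 16, 14947661082361856,
   2392358912, 16, 15277260800, 2393374720, 15, 16, 956650309342298112, 246153216, 16,
   44826624, 732882090622976, 10, 13, 15, 16, 375235631272001536, 295206912, 16, 1905819648,
   296222720, 15, 16, 24015080401479237632, 28049408, 16, 2883584, 29194648846336, 13, 15, 16,
   14947661082689536, 14943103478136832, 16, 1867887931817984, 2949120, 15, 16,
   956650309342593024, 28082176, 16, 2916352, 2981888, 6, 10, 13, 15, 16, 294191104, 294289408,
   16, 15242788864, 18934071296, 15, 16, 121980256256, 18901532672, 16, 121980420096,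
   151508910080, 13, 15, 16, 2392260608, 2392424448, 16, 15277654016, 7023456583680, 15, 16,
   3014656, 212828160, 16, 3112960, 3211264, 10, 13, 15, 16, 46472858474610688, 295239680, 16,
   15243739136, 296255488, 15, 16, 46472858475266048, 212795392, 16, 15244984320, 212893696,
   13, 15, 16, 3001885050214907904, 296484864, 16, 3080192, 3178496, 15, 16, 3047424,
   212860928, 16, 3145728, 3244032, 6, 10, 13, 15, 16, 294223872, 294322176, 16, 1905197056,
   2366603264, 15, 16, 18901467136, 18901565440, 16, 121981042688, 151508975616, 13, 15, 16,
   2392293376, 2392457216, 16, 15277916160, 2393440256, 15, 16, 313425920, 23835181056, 16,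
   45285376, 45416448, 10, 13, 15, 16, 295141376, 295305216, 16, 1906475008, 296288256, 15, 16,
   36601856, 2360344576, 16, 3342336, 3473408, 13, 15, 16, 119581288698085376, 296517632, 16,
   3309568, 3440640, 15, 16, 3276800, 3407872, 16, 3375104, 3506176, 6, 10, 13, 15, 16,
   294354944, 2366406656, 16, 15251308544, 2366636032, 15, 16, 18901598208, 151508746240, 16,
   976142467072, 151509008384, 13, 15, 16, 2392489984, 2392588288, 16, 15277490176, 2393473024,
   15, 16, 313458688, 313556992, 16, 1924169728, 45514752, 10, 13, 15, 16, 295337984,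
   295436288, 16, 1906049024, 296321024, 15, 16, 36634624, 36732928, 16, 238059520, 3571712,
   13, 15, 16, 14943103511691264, 36503552, 16, 237830144, 3538944, 15, 16, 36864000, 36995072,
   16, 238321664, 3604480, 6, 10, 13, 15, 16, 294387712, 294486016, 16, 15242985472,
   18934169600, 15, 16, 761327657746432, 18901696512, 16, 761327657811968, 151509073920, 13,
   15, 16, 233562076413952, 233562076479488, 16, 15277817856, 7023456747520, 15, 16, 313491456,
   313589760, 16, 15144648704, 3637248, 10, 13, 15, 16, 295370752, 5863061610790912, 16,
   5827877238702080, 296353792, 15, 16, 1890320384, 2360377344, 16, 761327659024384,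
   1891008512, 13, 15, 16, 36438016, 233562077691904, 16, 1907392512, 37126144, 15, 16,
   36896768, 37027840, 16, 1890910208, 3670016, 6, 10, 13, 15, 16, 294420480, 294518784, 16,
   1905295360, 2366701568, 15, 16, 18901630976, 18901729280, 16, 121981206528, 151509139456,
   13, 15, 16, 2392555520, 2392621056, 16, 15278080000, 2393538560, 15, 16, 313524224,
   313622528, 16, 126914723840, 314048512, 10, 13, 15, 16, 295403520, 295469056, 16,
   1906638848, 296386560, 15, 16, 36700160, 36798464, 16, 15245574144, 37224448, 13, 15, 16,
   36470784, 36536320, 16, 1907654656, 37158912, 15, 16, 36929536, 37060608, 16, 3702784,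
   3735552, 6, 10, 13, 15, 16, 294551552, 294617088, 16, 1905229824, 294748160, 15, 16,
   18901762048, 18901860352, 16, 121981075456, 18902351872, 13, 15, 16, 2392981504, 2393079808,
   16, 15277981696, 2393571328, 15, 16, 23835312128, 23835410432, 16, 126914625536,
   23835738112, 10, 13, 15, 16, 295829504, 295927808, 16, 1906540544, 296419328, 15, 16,
   2360475648, 2360573952, 16, 15245475840, 2360901632, 13, 15, 16, 296878080, 296976384, 16,
   1907589120, 297304064, 15, 16, 3768320, 28966912, 16, 3801088, 3833856, 6, 10, 13, 15, 16,
   294649856, 294715392, 16, 1905328128, 294780928, 15, 16, 18901893120, 18902024192, 16,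
   121981239296, 18902384640, 13, 15, 16, 2393112576, 2393243648, 16, 15278145536, 2393604096,
   15, 16, 23835443200, 23835541504, 16, 126914756608, 23835770880, 10, 13, 15, 16, 295960576,
   296091648, 16, 1906704384, 296452096, 15, 16, 2360606720, 2360705024, 16, 15245606912,
   2360934400, 13, 15, 16, 297009152, 297107456, 16, 1907720192, 297336832, 15, 16, 37355520,
   37388288, 16, 238714880, 3866624, 6, 10, 13, 15, 16, 2366898176, 2366963712, 16, 2367553536,
   18935087104, 15, 16, 663791927296, 87688183808, 16, 5310334795776, 151509729280, 13, 15, 16,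
   350259904512, 2802073894912, 16, 3899392, 151510581248, 15, 16, 38295683629056,
   22416620191744, 16, 2797338624, 1419129946112, 10, 13, 15, 16, 726589995548672,
   1419706859520, 16, 5812758954016768, 91685852741632, 15, 16, 741970852937728, 3997696, 16,
   24105019803369472, 683507712, 13, 15, 16, 46903879305953280, 233522852724736, 16, 3932160,
   1295810560, 15, 16, 159213008624484352, 4030464, 16, 3964928, 4063232, 6, 10, 13, 15, 16,
   2366930944, 2366996480, 16, 2367586304, 2367619072, 15, 16, 2487698385862656, 87688216576,
   16, 151509762048, 151509794816, 13, 15, 16, 350260068352, 2802074058752, 16, 2327576576,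
   18970607616, 15, 16, 19901626074693632, 22416620290048, 16, 2797502464, 2797633536, 10, 13,
   15, 16, 3001885050214612992, 1419706892288, 16, 90823747141632, 91685852807168, 15, 16,
   19901626075512832, 37584896, 16, 4128768, 4259840, 13, 15, 16, 24015080440704696320,
   233522852823040, 16, 4096000, 4227072, 15, 16, 19901626075742208, 4194304, 16, 4161536,
   4292608, 6, 10, 13, 15, 16, 2367029248, 2367062016, 16, 2367750144, 2367782912, 15, 16,
   87688282112, 87688314880, 16, 151509860352, 151509893120, 13, 15, 16, 350260101120,
   350260133888, 16, 2327609344, 2327707648, 15, 16, 22416620322816, 22416620355584, 16,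
   22301081600, 22301212672, 10, 13, 15, 16, 1419706957824, 1419706990592, 16, 90861219151872,
   90861219184640, 15, 16, 37519360, 37617664, 16, 6589218816, 6589349888, 13, 15, 16,
   233522852855808, 233522852888576, 16, 2327805952, 2327937024, 15, 16, 37715968, 37847040,
   16, 4325376, 4358144, 6, 10, 13, 15, 16, 2367160320, 2367258624, 16, 7200153632768,
   2367881216, 15, 16, 5310368022528, 18936201216, 16, 5310368645120, 151509991424, 13, 15, 16,
   179020899123200, 1867883033362432, 16, 57640217444352, 18970771456, 15, 16, 179020899745792,
   1432167225688064, 16, 461121759936512, 22175481856, 10, 13, 15, 16, 11353965821952,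
   11353966444544, 16, 90831724707840, 726653818044416, 15, 16, 2487698353782784,
   90831759278080, 16, 663794679808, 349649960960, 13, 15, 16, 233485380026368,
   14943064287281152, 16, 1867883067932672, 10381099008, 15, 16, 19901586850643968,
   14072086528, 16, 4390912, 4423680, 6, 10, 13, 15, 16, 2367193088, 2367291392, 16,
   2367848448, 2367913984, 15, 16, 663793434624, 18936233984, 16, 18936430592, 18936463360, 13,
   15, 16, 3001885050215235584, 29190387728384, 16, 1908310016, 18970804224, 15, 16,
   2487698387566592, 151511040000, 16, 4456448, 151511138304, 10, 13, 15, 16,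
   3001885050214678528, 11353966608384, 16, 90823747239936, 726653818175488, 15, 16,
   24015080440705581056, 90831759409152, 16, 732873116286976, 5863056748118016, 13, 15, 16,
   3001885050215301120, 46904492917325824, 16, 375235631275540480, 4554752, 15, 16,
   24015080440705810432, 4521984, 16, 4489216, 4587520, 6, 10, 13, 15, 16, 2367324160,
   2367389696, 16, 15252291584, 2367946752, 15, 16, 10958602240, 10958667776, 16, 114037882880,
   18936496128, 13, 15, 16, 1867883066458112, 5863061612167168, 16, 46923223839834112,
   18970836992, 15, 16, 233485407027200, 87690510336, 16, 912324231168, 151511171072, 10, 13,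
   15, 16, 732877828685824, 5863061611413504, 16, 46923223839080448, 726653818273792, 15, 16,
   5862984941076480, 5812484078338048, 16, 46501011375816704, 4653056, 13, 15, 16,
   375231073701396480, 5863061612429312, 16, 46923223840096256, 4620288, 15, 16,
   3001885050183581696, 38109184, 16, 239435776, 4685824, 6, 10, 13, 15, 16, 2367422464,
   2367455232, 16, 2368012288, 2368077824, 15, 16, 10958700544, 10958766080, 16, 18936561664,
   18936594432, 13, 15, 16, 29190387695616, 29190387761152, 16, 1908441088, 18970935296, 15,
   16, 37945344, 37978112, 16, 11460160028672, 151511236608, 10, 13, 15, 16, 732877828718592,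
   732877828784128, 16, 90823747665920, 90861219610624, 15, 16, 91609727270912, 91609727336448,
   16, 726693010833408, 11460160225280, 13, 15, 16, 5863061612462080, 5863061612494848, 16,
   1908768768, 38240256, 15, 16, 38043648, 38141952, 16, 4718592, 4751360, 6, 10, 13, 15, 16,
   2368110592, 18935644160, 16, 122014859264, 18935808000, 15, 16, 671770673152, 87655284736,
   16, 912289005568, 18936627200, 13, 15, 16, 297598976, 53296857088, 16, 877930577920,
   53297020928, 15, 16, 5275977089024, 603052834816, 16, 7200122601472, 151511269376, 10, 13,
   15, 16, 726693042388992, 90900443791360, 16, 728617187901440, 11460729503744, 15, 16,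
   5935904257048576, 92824589959168, 16, 761327659646976, 4784128, 13, 15, 16,
   5817294441512960, 732877796933632, 16, 5865398075392000, 91685854281728, 15, 16,
   47523694628569088, 742596737925120, 16, 6090621295427584, 4816896, 6, 10, 13, 15, 16,
   2368143360, 2368176128, 16, 15253241856, 18935873536, 15, 16, 83972718592, 87655350272, 16,
   18936659968, 18936692736, 13, 15, 16, 297631744, 297664512, 16, 1908473856, 53297119232, 15,
   16, 10498408448, 603052933120, 16, 57640218853376, 151511334912, 10, 13, 15, 16,
   90831757901824, 90900443856896, 16, 11460729536512, 11460729569280, 15, 16, 92824589991936,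
   92824590024704, 16, 761327660728320, 38371328, 13, 15, 16, 11353993576448, 732877797031936,
   16, 46923223841177600, 91685854347264, 15, 16, 380189596266594304, 742596737990656, 16,
   4849664, 4882432, 6, 10, 13, 15, 16, 2368208896, 2368274432, 16, 15253176320, 2368405504,
   15, 16, 310962295701504, 83973439488, 16, 663794024448, 18936791040, 13, 15, 16,
   310962296094720, 297762816, 16, 1908375552, 297926656, 15, 16, 310962296160256,
   190702714880, 16, 1015336435712, 151511367680, 10, 13, 15, 16, 375235631274295296,
   90831758622720, 16, 726589997645824, 11460729667584, 15, 16, 5940461830406144,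
   47523694662451200, 16, 5940461831520256, 298450944, 13, 15, 16, 375235631274754048,
   298090496, 16, 1908703232, 298319872, 15, 16, 310962296586240, 30081024, 16, 4915200,
   4947968, 6, 10, 13, 15, 16, 2368307200, 2368372736, 16, 15253274624, 2368438272, 15, 16,
   83973537792, 10959192064, 16, 114038407168, 18936823808, 13, 15, 16, 297795584, 297893888,
   16, 1908506624, 297959424, 15, 16, 190702747648, 190702813184, 16, 1015336534016,
   151511400448, 10, 13, 15, 16, 90831758721024, 11357683974144, 16, 91072276987904,
   11460729700352, 15, 16, 83974619136, 92824591106048, 16, 761327660793856, 298483712, 13, 15,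
   16, 298123264, 298188800, 16, 1908801536, 298352640, 15, 16, 38469632, 38502400, 16,
   239828992, 4980736, 6, 10, 13, 15, 16, 2368536576, 2368569344, 16, 2369028096, 2369093632,
   15, 16, 10958962688, 10959028224, 16, 114038439936, 2369421312, 13, 15, 16, 3648796262400,
   3648796327936, 16, 18971197440, 18971230208, 15, 16, 87690674176, 87690706944, 16,
   912324558848, 18971590656, 10, 13, 15, 16, 91609726484480, 91609726550016, 16, 2370142208,
   2370174976, 15, 16, 10960076800, 10960109568, 16, 114039455744, 2370535424, 13, 15, 16,
   233485381435392, 3648796655616, 16, 1867883068522496, 29190389465088, 15, 16,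
   233485382451200, 3648797769728, 16, 5013504, 5046272, 6, 10, 13, 15, 16, 2369126400,
   2369191936, 16, 15254093824, 2369323008, 15, 16, 83973570560, 10959257600, 16, 114038472704,
   2369454080, 13, 15, 16, 18971262976, 18971328512, 16, 122050543616, 18971394048, 15, 16,
   671806357504, 87690870784, 16, 912324591616, 18971623424, 10, 13, 15, 16, 2370207744,
   2370273280, 16, 15255175168, 2370338816, 15, 16, 83974651904, 10960273408, 16, 114039488512,
   2370568192, 13, 15, 16, 1867883035099136, 29190355910656, 16, 235898541932544, 298647552,
   15, 16, 2487698355617792, 1372389376, 16, 14257291264, 5079040, 6, 10, 13, 15, 16,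
   18937872384, 18937905152, 16, 122017120256, 18937970688, 15, 16, 671772934144, 87657447424,
   16, 912291168256, 18938068992, 13, 15, 16, 2870796189696, 362535354368, 16, 3111314423808,
   53297807360, 15, 16, 38295686512640, 603053621248, 16, 7200123387904, 18938167296, 10, 13,
   15, 16, 90831726411776, 11357651632128, 16, 91072244645888, 1427687342080, 15, 16,
   741983128289280, 11598169899008, 16, 95161053609984, 190736859136, 13, 15, 16,
   1867883035131904, 29190355943424, 16, 235898541965312, 465614766080, 15, 16,
   2487698355650560, 4863661277184, 16, 57640219410432, 5111808]

/-- Certificate that the nodes of the graphs on six vertices are settled. -/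
def finish : List ℕ := [47, 48, 49, 50, 51, 53, 65, 56, 29, 44, 58, 59, 25, 40, 55, 26, 28, 30, 24, 27, 21, 31, 18,
   22, 37, 39, 41, 43, 45, 42, 36, 46, 17, 54, 145, 19, 147, 34, 162, 8723, 32, 160, 19, 20,
   23, 33, 60, 61, 161, 164, 75, 139, 76, 140, 141, 66, 144, 146, 63, 147, 38, 166, 8192, 61,
   143, 149, 34, 162, 8192, 38, 136, 54, 139, 76, 140, 141, 64, 140, 142, 54, 143, 34, 162, 69,
   172, 38, 181, 72, 200, 36, 134, 137, 60, 137, 42, 140, 66, 141, 32, 159, 35, 163, 36, 164,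
   52, 167, 46, 174, 135, 63, 137, 142, 46, 144, 33, 161, 32, 130, 64, 135, 136, 32, 160, 8192,
   32, 160, 8192, 66, 144, 39, 146, 32, 160, 33, 161, 20, 168, 62, 190, 63, 191, 64, 192, 193,
   66, 144, 32, 160, 33, 161, 62, 190, 68, 136, 63, 137, 69, 139, 64, 140, 142, 23, 136, 54,
   139, 76, 140, 141, 64, 140, 142, 54, 143, 72, 130, 138, 61, 143, 35, 153, 57, 185, 186, 27,
   140, 17, 130, 66, 138, 69, 139, 142, 54, 142, 67, 130, 137, 31, 144, 17, 130, 23, 136, 71,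
   138, 140, 75, 136, 138, 60, 142, 42, 186, 62, 131, 34, 132, 73, 135, 139, 60, 142, 27, 186,
   62, 131, 19, 132, 73, 135, 139, 71, 141, 68, 135, 137, 76, 140, 141, 43, 141, 32, 130, 39,
   137, 34, 162, 35, 163, 38, 166, 8192, 28, 141, 17, 130, 24, 137, 19, 147, 20, 148, 23, 151,
   4353, 60, 137, 54, 139, 52, 180, 55, 183, 57, 130, 135, 74, 139, 143, 65, 76, 137, 138, 136,
   22, 23, 24, 26, 27, 29, 36, 164, 25, 28, 30, 31, 37, 38, 39, 40, 41, 42, 21, 44, 149, 65,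
   158, 159, 43, 45, 46, 53, 54, 55, 153, 159, 130, 130, 159, 158, 156, 63, 130, 132, 68, 130,
   133, 9216, 64, 131, 132, 69, 131, 133, 70, 132, 133, 46, 174, 9216, 45, 173, 9216, 43, 171,
   9216, 40, 168, 9216, 58, 130, 131, 63, 130, 132, 68, 130, 133, 64, 131, 132, 69, 131, 133,
   70, 132, 133, 22, 23, 25, 26, 28, 29, 30, 35, 51, 163, 46, 174, 12846, 24, 27, 31, 37, 38,
   39, 40, 41, 42, 43, 20, 45, 148, 66, 157, 159, 44, 46, 53, 54, 56, 152, 159, 130, 130, 159,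
   157, 63, 130, 132, 45, 155, 75, 159, 60, 169, 44, 172, 54, 182, 55, 183, 130, 73, 130, 134,
   64, 131, 132, 8960, 74, 131, 134, 75, 132, 134, 46, 174, 8960, 42, 170, 8960, 39, 167, 8960,
   58, 130, 131, 44, 172, 11293, 63, 130, 132, 73, 130, 134, 64, 131, 132, 74, 131, 134, 75,
   132, 134, 22, 24, 25, 27, 28, 29, 30, 31, 23, 26, 37, 39, 40, 41, 42, 43, 38, 44, 45, 46,
   50, 19, 51, 147, 158, 34, 162, 53, 55, 56, 151, 158, 130, 130, 157, 58, 130, 131, 158, 157,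
   46, 151, 71, 157, 158, 68, 130, 133, 73, 130, 134, 46, 154, 54, 182, 130, 69, 131, 133, 74,
   131, 134, 76, 133, 134, 41, 169, 10522, 38, 166, 9751, 58, 130, 131, 45, 173, 11550, 44,
   172, 11293, 68, 130, 133, 73, 130, 134, 69, 131, 133, 74, 131, 134, 76, 133, 134, 23, 24,
   25, 29, 28, 30, 27, 31, 22, 26, 38, 39, 40, 41, 42, 43, 44, 45, 37, 46, 49, 50, 18, 51, 146,
   156, 33, 161, 53, 54, 55, 56, 150, 156, 130, 130, 130, 155, 154, 63, 130, 132, 46, 150, 71,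
   155, 156, 68, 130, 133, 73, 130, 134, 44, 156, 65, 169, 170, 45, 155, 66, 169, 43, 171, 53,
   181, 130, 46, 154, 53, 181, 130, 70, 132, 133, 75, 132, 134, 76, 133, 134, 41, 169, 10522,
   37, 165, 9494, 63, 130, 132, 42, 170, 10779, 68, 130, 133, 43, 171, 11036, 73, 130, 134, 70,
   132, 133, 75, 132, 134, 76, 133, 134, 26, 27, 28, 29, 25, 30, 24, 31, 22, 23, 41, 42, 40,
   43, 38, 39, 44, 45, 37, 46, 48, 49, 50, 17, 51, 145, 153, 32, 160, 58, 59, 60, 61, 150, 153,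
   131, 131, 131, 152, 151, 150, 64, 131, 132, 46, 150, 71, 152, 153, 69, 131, 133, 74, 131,
   134, 45, 152, 66, 166, 168, 46, 151, 76, 168, 131, 70, 132, 133, 44, 153, 131, 75, 132, 134,
   76, 133, 134, 38, 166, 9751, 37, 165, 9494, 64, 131, 132, 39, 167, 10008, 69, 131, 133, 40,
   168, 10265, 74, 131, 134, 70, 132, 133, 75, 132, 134, 76, 133, 134, 22, 23, 24, 26, 27, 29,
   37, 38, 39, 41, 42, 44, 53, 54, 55, 51, 58, 59, 20, 28, 19, 25, 30, 31, 60, 165, 65, 166,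
   167, 132, 60, 133, 47, 135, 50, 140, 141, 70, 132, 133, 69, 141, 144, 65, 133, 47, 136, 50,
   142, 143, 30, 143, 46, 151, 34, 152, 157, 72, 131, 68, 138, 140, 72, 131, 141, 25, 153, 40,
   168, 47, 175, 10265, 72, 130, 138, 72, 130, 138, 72, 130, 138, 1536, 1536, 1536, 1536, 1536,
   1536, 1537, 1537, 1537, 1537, 1537, 1537, 18, 19, 20, 22, 23, 24, 26, 27, 28, 29, 30, 31,
   33, 34, 35, 37, 38, 39, 41, 42, 43, 44, 45, 46, 48, 49, 69, 70, 148, 53, 151, 154, 72, 133,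
   73, 137, 75, 142, 70, 143, 144, 73, 130, 69, 141, 144, 73, 130, 150, 32, 130, 64, 131, 132,
   32, 130, 69, 131, 133, 32, 157, 65, 162, 163, 32, 130, 70, 132, 133, 1536, 1536, 1536, 1536,
   1536, 2560, 2560, 2560, 17, 130, 64, 131, 132, 17, 130, 69, 131, 133, 1537, 17, 130, 70,
   132, 133, 1537, 1537, 1537, 1537, 1537, 2561, 2561, 2561, 17, 18, 22, 44, 172, 1536, 1537,
   2561, 3329, 76, 204, 2566, 72, 200, 73, 201, 74, 202, 75, 203, 76, 204, 2566, 48, 49, 50,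
   22, 17, 21, 23, 24, 39, 73, 137, 144, 36, 134, 41, 139, 46, 144, 32, 160, 33, 64, 131, 132,
   34, 132, 37, 135, 38, 136, 42, 140, 43, 141, 44, 142, 45, 143, 1280, 134, 67, 134, 73, 137,
   74, 140, 69, 141, 75, 142, 70, 143, 144, 24, 137, 26, 139, 31, 144, 145, 31, 144, 64, 135,
   136, 31, 144, 27, 155, 17, 130, 19, 132, 21, 134, 23, 136, 24, 137, 26, 139, 28, 141, 29,
   142, 30, 143, 18, 146, 1281, 73, 130, 134, 73, 130, 134, 73, 130, 134, 17, 32, 73, 130, 50,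
   144, 24, 41, 152, 1536, 1537, 46, 144, 39, 167, 41, 139, 1536, 31, 144, 24, 152, 26, 139,
   1537, 17, 18, 19, 21, 36, 67, 134, 73, 137, 74, 140, 75, 142, 70, 143, 144, 37, 135, 39,
   137, 41, 139, 42, 140, 44, 142, 45, 143, 46, 144, 32, 160, 33, 161, 34, 162, 38, 166, 1280,
   22, 135, 24, 137, 26, 139, 27, 140, 29, 142, 30, 143, 31, 144, 145, 31, 144, 30, 158, 130,
   31, 144, 130, 31, 144, 18, 131, 19, 132, 22, 135, 23, 136, 24, 137, 26, 139, 27, 140, 29,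
   142, 30, 143, 21, 149, 1281, 17, 32, 73, 130, 50, 144, 49, 177, 75, 203, 74, 131, 2566, 46,
   144, 38, 166, 39, 167, 44, 172, 33, 131, 34, 132, 37, 135, 41, 139, 42, 140, 45, 143, 1280,
   31, 144, 23, 151, 24, 152, 29, 157, 18, 131, 19, 132, 22, 135, 26, 139, 27, 140, 30, 143,
   1281, 17, 18, 19, 21, 36, 67, 134, 73, 137, 74, 140, 75, 142, 144, 37, 135, 38, 136, 39,
   137, 41, 139, 42, 140, 44, 142, 46, 144, 32, 160, 33, 161, 34, 162, 2560, 22, 135, 23, 136,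
   24, 137, 26, 139, 27, 140, 29, 142, 31, 144, 145, 31, 144, 44, 145, 130, 31, 144, 42, 145,
   130, 31, 144, 18, 131, 19, 132, 22, 135, 23, 136, 24, 137, 26, 139, 27, 140, 29, 142, 21,
   149, 2561, 17, 32, 73, 130, 50, 144, 74, 202, 75, 203, 2566, 46, 144, 37, 165, 38, 166, 39,
   167, 42, 170, 44, 172, 33, 131, 34, 132, 41, 139, 1536, 31, 144, 22, 150, 23, 151, 24, 152,
   27, 155, 29, 157, 18, 131, 19, 132, 26, 139, 1537, 17, 18, 19, 22, 23, 24, 25, 26, 27, 28,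
   29, 30, 32, 33, 34, 37, 54, 59, 165, 38, 166, 47, 175, 49, 177, 131, 130, 1280, 49, 177,
   4096, 4096, 4096, 45, 173, 49, 177, 70, 198, 1280, 44, 172, 49, 177, 75, 203, 1536, 48, 176,
   1281, 48, 176, 1537, 41, 169, 1280, 47, 175, 1281, 47, 175, 1537, 1281, 1281, 4097, 4097,
   4097, 17, 24, 41, 169, 1536, 1537, 4097, 75, 203, 4102, 73, 201, 74, 202, 75, 203, 2566, 17,
   32, 130, 46, 144, 41, 169, 33, 64, 131, 132, 34, 132, 37, 135, 38, 136, 42, 140, 43, 141,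
   44, 142, 45, 143, 1280, 31, 144, 26, 154, 18, 64, 131, 132, 19, 132, 22, 135, 23, 136, 27,
   140, 28, 141, 29, 142, 30, 143, 1281, 31, 46, 144, 32, 130, 33, 131, 34, 132, 37, 135, 38,
   136, 40, 138, 41, 139, 42, 140, 44, 142, 45, 143, 1280, 17, 130, 18, 131, 19, 132, 22, 135,
   23, 136, 25, 138, 26, 139, 27, 140, 29, 142, 30, 143, 1281, 17, 32, 130, 46, 144, 34, 162,
   38, 166, 41, 169, 44, 172, 45, 173, 33, 131, 37, 135, 42, 140, 1280, 31, 144, 19, 147, 23,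
   151, 26, 154, 29, 157, 30, 158, 18, 131, 22, 135, 27, 140, 1281, 31, 46, 144, 32, 130, 33,
   131, 34, 132, 37, 135, 38, 136, 40, 138, 41, 139, 42, 140, 44, 142, 36, 164, 1280, 17, 130,
   18, 131, 19, 132, 22, 135, 23, 136, 25, 138, 26, 139, 27, 140, 29, 142, 21, 149, 1281, 31,
   46, 144, 32, 130, 33, 131, 34, 132, 37, 135, 38, 136, 40, 138, 41, 139, 42, 140, 44, 142,
   1280, 17, 130, 18, 131, 19, 132, 22, 135, 23, 136, 25, 138, 26, 139, 27, 140, 29, 142, 1281,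
   17, 32, 130, 46, 144, 33, 161, 34, 162, 37, 165, 38, 166, 41, 169, 42, 170, 44, 172, 1536,
   31, 144, 18, 146, 19, 147, 22, 150, 23, 151, 26, 154, 27, 155, 29, 157, 1537, 17, 32, 130,
   41, 169, 4096, 4097, 17, 25, 41, 169, 4096, 18, 131, 27, 140, 29, 142, 30, 143, 145, 4097,
   75, 203, 17, 32, 130, 41, 169, 4096, 4097, 17, 18, 19, 21, 25, 41, 169, 4096, 67, 131, 26,
   139, 140, 26, 139, 27, 140, 29, 142, 145, 4097, 4097, 4097, 17, 25, 41, 169, 4096, 18, 131,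
   19, 132, 26, 139, 27, 140, 29, 142, 145, 4097, 74, 202, 75, 203, 4102, 17, 32, 130, 46, 144,
   34, 162, 38, 166, 41, 169, 44, 172, 45, 173, 33, 131, 37, 135, 1280, 31, 144, 19, 147, 23,
   151, 26, 154, 29, 157, 30, 158, 18, 131, 22, 135, 1281, 17, 32, 130, 46, 144, 33, 161, 34,
   162, 37, 165, 38, 166, 41, 169, 43, 171, 44, 172, 1280, 31, 144, 18, 146, 19, 147, 22, 150,
   23, 151, 26, 154, 28, 156, 29, 157, 1281, 17, 32, 130, 46, 144, 33, 161, 34, 162, 37, 165,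
   38, 166, 41, 169, 44, 172, 1536, 31, 144, 18, 146, 19, 147, 22, 150, 23, 151, 26, 154, 29,
   157, 1537, 70, 198, 75, 203, 17, 32, 130, 41, 169, 4096, 4097, 17, 32, 130, 41, 169, 4096,
   4097, 75, 203, 17, 32, 130, 41, 169, 4096, 4097, 17, 32, 130, 41, 139, 46, 144, 33, 161, 34,
   162, 37, 165, 38, 166, 32768, 26, 139, 31, 144, 18, 146, 19, 147, 22, 150, 23, 151, 65536,
   17, 32, 130, 41, 139, 4096, 26, 139, 4097, 49, 22, 17, 18, 20, 21, 23, 38, 68, 136, 74, 140,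
   142, 35, 133, 44, 172, 32, 130, 3328, 74, 131, 133, 68, 135, 26, 139, 140, 74, 135, 23, 136,
   138, 30, 143, 68, 130, 133, 29, 142, 74, 135, 138, 29, 142, 30, 143, 31, 144, 17, 145, 18,
   146, 20, 148, 21, 149, 23, 151, 25, 153, 26, 154, 27, 155, 1025, 68, 130, 74, 131, 133, 17,
   32, 68, 130, 133, 44, 142, 45, 143, 46, 144, 33, 161, 35, 163, 37, 165, 38, 166, 40, 168,
   41, 169, 42, 170, 1024, 29, 142, 30, 143, 31, 144, 18, 146, 20, 148, 22, 150, 23, 151, 25,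
   153, 26, 154, 27, 155, 1025, 17, 32, 130, 44, 142, 45, 143, 46, 144, 33, 161, 35, 163, 37,
   165, 38, 166, 41, 169, 42, 170, 1536, 29, 142, 30, 143, 31, 144, 18, 146, 20, 148, 22, 150,
   23, 151, 26, 154, 27, 155, 1537, 17, 32, 68, 130, 133, 44, 142, 46, 144, 33, 161, 35, 163,
   42, 170, 37, 135, 38, 136, 40, 138, 41, 139, 43, 141, 1024, 29, 142, 31, 144, 18, 146, 20,
   148, 27, 155, 22, 135, 23, 136, 25, 138, 26, 139, 28, 141, 1025, 17, 32, 130, 44, 142, 46,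
   144, 33, 161, 35, 163, 42, 170, 37, 135, 38, 136, 41, 139, 43, 141, 1024, 29, 142, 31, 144,
   18, 146, 20, 148, 27, 155, 22, 135, 23, 136, 26, 139, 28, 141, 1025, 17, 32, 68, 130, 133,
   44, 142, 46, 144, 33, 161, 35, 163, 42, 170, 37, 135, 38, 136, 40, 138, 41, 139, 1024, 29,
   142, 31, 144, 18, 146, 20, 148, 27, 155, 22, 135, 23, 136, 25, 138, 26, 139, 1025, 17, 32,
   130, 44, 142, 46, 144, 33, 161, 35, 163, 42, 170, 37, 135, 38, 136, 41, 139, 1536, 29, 142,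
   31, 144, 18, 146, 20, 148, 27, 155, 22, 135, 23, 136, 26, 139, 1537, 74, 202, 17, 32, 130,
   44, 142, 43, 141, 33, 161, 35, 163, 37, 165, 38, 166, 41, 169, 42, 170, 1536, 29, 142, 28,
   141, 18, 146, 20, 148, 22, 150, 23, 151, 26, 154, 27, 155, 1537, 74, 202, 18, 17, 32, 130,
   44, 142, 20, 35, 133, 38, 136, 33, 161, 37, 165, 41, 169, 42, 170, 1536, 23, 136, 98304, 29,
   142, 38, 146, 35, 133, 131072, 23, 136, 29, 142, 22, 150, 26, 154, 27, 155, 17, 130, 20,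
   133, 1537, 17, 32, 130, 44, 142, 45, 143, 46, 144, 33, 161, 36, 164, 37, 165, 38, 166, 41,
   169, 42, 170, 1280, 29, 142, 30, 143, 31, 144, 18, 146, 21, 149, 22, 150, 23, 151, 26, 154,
   27, 155, 1281, 17, 32, 130, 44, 142, 45, 143, 46, 144, 33, 161, 37, 165, 38, 166, 41, 169,
   42, 170, 1280, 29, 142, 30, 143, 31, 144, 18, 146, 22, 150, 23, 151, 26, 154, 27, 155, 1281,
   17, 32, 130, 44, 142, 46, 144, 33, 161, 36, 164, 37, 165, 38, 166, 41, 169, 42, 170, 43,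
   171, 1024, 29, 142, 31, 144, 18, 146, 21, 149, 22, 150, 23, 151, 26, 154, 27, 155, 28, 156,
   1025, 17, 32, 130, 44, 142, 46, 144, 33, 161, 37, 165, 38, 166, 41, 169, 42, 170, 43, 171,
   1024, 29, 142, 31, 144, 18, 146, 22, 150, 23, 151, 26, 154, 27, 155, 28, 156, 1025, 29, 44,
   142, 32, 130, 40, 138, 41, 139, 42, 140, 46, 144, 33, 161, 37, 165, 38, 166, 1024, 17, 130,
   25, 138, 26, 139, 27, 140, 31, 144, 18, 146, 22, 150, 23, 151, 1025, 17, 32, 130, 44, 142,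
   46, 144, 33, 161, 36, 164, 37, 165, 38, 166, 41, 169, 42, 170, 2560, 29, 142, 31, 144, 18,
   146, 21, 149, 22, 150, 23, 151, 26, 154, 27, 155, 2561, 17, 32, 130, 44, 142, 46, 144, 33,
   161, 37, 165, 38, 166, 41, 169, 42, 170, 1536, 29, 142, 31, 144, 18, 146, 22, 150, 23, 151,
   26, 154, 27, 155, 1537, 17, 32, 130, 44, 142, 45, 143, 37, 165, 38, 166, 41, 169, 33, 131,
   42, 140, 43, 141, 1280, 29, 142, 30, 143, 22, 150, 23, 151, 26, 154, 18, 131, 27, 140, 28,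
   141, 1281, 17, 32, 68, 130, 74, 140, 49, 142, 22, 150, 23, 151, 26, 154, 37, 165, 38, 166,
   41, 169, 1280, 44, 142, 45, 143, 37, 165, 38, 166, 40, 168, 41, 169, 33, 131, 42, 140, 1280,
   29, 142, 30, 143, 22, 150, 23, 151, 25, 153, 26, 154, 18, 131, 27, 140, 1281, 17, 32, 130,
   44, 142, 45, 143, 37, 165, 38, 166, 41, 169, 33, 131, 42, 140, 1280, 29, 142, 30, 143, 22,
   150, 23, 151, 26, 154, 18, 131, 27, 140, 1281, 74, 202, 17, 32, 130, 44, 142, 37, 165, 38,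
   166, 41, 169, 43, 141, 33, 161, 42, 170, 1280, 29, 142, 22, 150, 23, 151, 26, 154, 28, 141,
   18, 146, 27, 155, 1281, 74, 202, 17, 32, 130, 44, 142, 37, 165, 38, 166, 41, 169, 1536, 29,
   142, 22, 150, 23, 151, 26, 154, 1537, 22, 37, 135, 46, 144, 32, 62, 130, 136, 38, 136, 41,
   139, 44, 142, 45, 143, 33, 161, 35, 163, 36, 164, 2304, 31, 144, 17, 62, 130, 136, 23, 136,
   26, 139, 29, 142, 30, 143, 18, 146, 20, 148, 21, 149, 2305, 17, 32, 130, 41, 139, 44, 142,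
   45, 143, 46, 144, 33, 161, 35, 163, 37, 165, 38, 166, 1536, 26, 139, 29, 142, 30, 143, 31,
   144, 18, 146, 20, 148, 22, 150, 23, 151, 1537, 20, 35, 133, 37, 135, 38, 136, 40, 138, 41,
   139, 43, 141, 44, 142, 46, 144, 32, 160, 33, 161, 1024, 22, 135, 23, 136, 25, 138, 26, 139,
   28, 141, 29, 142, 31, 144, 17, 145, 18, 146, 1025, 17, 32, 130, 44, 142, 46, 144, 33, 161,
   35, 163, 37, 135, 38, 136, 41, 139, 43, 141, 1536, 29, 142, 31, 144, 18, 146, 20, 148, 22,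
   135, 23, 136, 26, 139, 28, 141, 1537, 17, 32, 130, 41, 139, 44, 142, 46, 144, 33, 161, 35,
   163, 37, 165, 38, 166, 1536, 26, 139, 29, 142, 31, 144, 18, 146, 20, 148, 22, 150, 23, 151,
   1537, 17, 32, 62, 130, 136, 41, 139, 44, 142, 45, 143, 37, 165, 38, 166, 33, 131, 35, 133,
   36, 134, 2304, 26, 139, 29, 142, 30, 143, 22, 150, 23, 151, 18, 131, 20, 133, 21, 134, 2305,
   17, 32, 130, 41, 139, 44, 142, 45, 143, 37, 165, 38, 166, 33, 131, 35, 133, 1536, 26, 139,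
   29, 142, 30, 143, 22, 150, 23, 151, 18, 131, 20, 133, 1537, 20, 35, 133, 37, 135, 38, 136,
   40, 138, 41, 139, 43, 141, 44, 142, 32, 160, 33, 161, 1536, 22, 135, 23, 136, 25, 138, 26,
   139, 28, 141, 29, 142, 17, 145, 18, 146, 1537, 17, 32, 130, 44, 142, 33, 131, 37, 135, 38,
   136, 41, 139, 43, 141, 35, 163, 1536, 29, 142, 18, 131, 22, 135, 23, 136, 26, 139, 28, 141,
   20, 148, 1537, 17, 32, 130, 41, 139, 44, 142, 37, 165, 38, 166, 33, 131, 35, 133, 1536, 26,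
   139, 29, 142, 22, 150, 23, 151, 18, 131, 20, 133, 1537, 17, 32, 130, 41, 139, 44, 142, 45,
   143, 46, 144, 33, 161, 37, 165, 38, 166, 1280, 26, 139, 29, 142, 30, 143, 31, 144, 18, 146,
   22, 150, 23, 151, 1281, 17, 32, 130, 44, 142, 46, 144, 33, 161, 37, 165, 38, 166, 41, 169,
   43, 171, 1280, 29, 142, 31, 144, 18, 146, 22, 150, 23, 151, 26, 154, 28, 156, 1281, 17, 32,
   130, 41, 139, 44, 142, 46, 144, 33, 161, 36, 164, 37, 165, 38, 166, 163840, 26, 139, 29,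
   142, 31, 144, 18, 146, 21, 149, 22, 150, 23, 151, 196608, 17, 32, 130, 41, 139, 44, 142, 46,
   144, 33, 161, 37, 165, 38, 166, 1536, 26, 139, 29, 142, 31, 144, 18, 146, 22, 150, 23, 151,
   1537, 17, 32, 130, 41, 139, 44, 142, 45, 143, 37, 165, 38, 166, 33, 131, 1280, 26, 139, 29,
   142, 30, 143, 22, 150, 23, 151, 18, 131, 1281, 22, 44, 150, 38, 166, 41, 169, 32, 130, 33,
   131, 37, 135, 40, 138, 43, 141, 1280, 29, 142, 23, 151, 26, 154, 17, 130, 18, 131, 25, 138,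
   28, 141, 1281, 17, 32, 130, 44, 142, 37, 165, 38, 166, 41, 169, 33, 131, 43, 141, 1280, 29,
   142, 22, 150, 23, 151, 26, 154, 18, 131, 28, 141, 1281, 17, 32, 130, 41, 139, 44, 142, 37,
   165, 38, 166, 33, 131, 36, 134, 4096, 26, 139, 29, 142, 22, 150, 23, 151, 18, 131, 21, 134,
   4097, 17, 32, 130, 41, 139, 44, 142, 37, 165, 38, 166, 33, 131, 1536, 26, 139, 29, 142, 22,
   150, 23, 151, 18, 131, 1537, 22, 150, 37, 165, 17, 18, 23, 24, 25, 26, 27, 28, 32, 48, 53,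
   160, 33, 161, 41, 169, 42, 170, 43, 171, 176, 1284, 3584, 43, 171, 48, 176, 64, 192, 69,
   197, 1024, 42, 170, 48, 176, 64, 192, 74, 202, 1024, 41, 169, 48, 176, 69, 197, 74, 202,
   1280, 47, 175, 1025, 47, 175, 1025, 47, 175, 1281, 3585, 3585, 22, 150, 37, 165, 74, 202,
   3846, 22, 150, 37, 165, 73, 201, 74, 202, 3846, 17, 32, 130, 46, 144, 33, 161, 37, 165, 41,
   169, 42, 170, 43, 171, 38, 136, 1024, 31, 144, 18, 146, 22, 150, 26, 154, 27, 155, 28, 156,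
   23, 136, 1025, 22, 46, 150, 32, 130, 33, 131, 37, 135, 38, 136, 40, 138, 41, 139, 42, 140,
   1024, 31, 144, 17, 130, 18, 131, 23, 136, 25, 138, 26, 139, 27, 140, 1025, 17, 32, 130, 46,
   144, 33, 161, 37, 165, 38, 166, 41, 169, 42, 170, 1536, 31, 144, 18, 146, 22, 150, 23, 151,
   26, 154, 27, 155, 1537, 22, 150, 37, 165, 69, 197, 74, 202, 17, 32, 130, 41, 169, 4096,
   4097, 22, 150, 37, 165, 17, 25, 41, 169, 4096, 18, 131, 26, 139, 27, 140, 145, 4097, 22,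
   150, 37, 165, 74, 202, 17, 32, 130, 41, 169, 4096, 4097, 17, 32, 130, 41, 139, 46, 144, 33,
   161, 37, 165, 38, 166, 229376, 26, 139, 31, 144, 18, 146, 22, 150, 23, 151, 262144, 22, 150,
   37, 165, 17, 32, 130, 41, 139, 4096, 26, 139, 4097, 17, 32, 130, 44, 142, 46, 144, 33, 161,
   37, 165, 40, 168, 41, 169, 42, 170, 1024, 29, 142, 31, 144, 18, 146, 22, 150, 25, 153, 26,
   154, 27, 155, 1025, 17, 32, 130, 44, 142, 46, 144, 33, 161, 37, 165, 41, 169, 42, 170, 1536,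
   29, 142, 31, 144, 18, 146, 22, 150, 26, 154, 27, 155, 1537, 74, 202, 17, 32, 130, 44, 142,
   33, 161, 37, 165, 41, 169, 42, 170, 43, 171, 1536, 29, 142, 18, 146, 22, 150, 26, 154, 27,
   155, 28, 156, 1537, 74, 202, 17, 32, 130, 44, 142, 33, 161, 37, 165, 41, 169, 42, 170, 1536,
   29, 142, 18, 146, 22, 150, 26, 154, 27, 155, 1537, 17, 32, 130, 41, 139, 44, 142, 45, 143,
   46, 144, 33, 161, 36, 164, 37, 165, 39, 167, 294912, 26, 139, 29, 142, 30, 143, 31, 144, 18,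
   146, 21, 149, 22, 150, 24, 152, 327680, 17, 32, 130, 41, 139, 44, 142, 45, 143, 46, 144, 33,
   161, 37, 165, 39, 167, 1536, 26, 139, 29, 142, 30, 143, 31, 144, 18, 146, 22, 150, 24, 152,
   1537, 17, 32, 130, 44, 142, 46, 144, 37, 165, 39, 167, 33, 131, 41, 139, 43, 141, 1024, 29,
   142, 31, 144, 22, 150, 24, 152, 18, 131, 26, 139, 28, 141, 1025, 17, 32, 130, 41, 139, 44,
   142, 46, 144, 33, 161, 36, 164, 37, 165, 39, 167, 3840, 26, 139, 29, 142, 31, 144, 18, 146,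
   21, 149, 22, 150, 24, 152, 3841, 17, 32, 130, 41, 139, 44, 142, 46, 144, 33, 161, 37, 165,
   39, 167, 1536, 26, 139, 29, 142, 31, 144, 18, 146, 22, 150, 24, 152, 1537, 17, 32, 130, 44,
   142, 37, 165, 39, 167, 33, 131, 41, 139, 43, 141, 1536, 29, 142, 22, 150, 24, 152, 18, 131,
   26, 139, 28, 141, 1537, 17, 32, 130, 41, 139, 44, 142, 33, 161, 36, 164, 37, 165, 39, 167,
   3840, 26, 139, 29, 142, 18, 146, 21, 149, 22, 150, 24, 152, 3841, 17, 32, 130, 41, 139, 44,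
   142, 33, 161, 37, 165, 39, 167, 1536, 26, 139, 29, 142, 18, 146, 22, 150, 24, 152, 1537, 17,
   32, 130, 41, 139, 44, 142, 45, 143, 46, 144, 33, 161, 37, 165, 360448, 26, 139, 29, 142, 30,
   143, 31, 144, 18, 146, 22, 150, 393216, 17, 32, 130, 44, 142, 46, 144, 33, 161, 37, 165, 41,
   169, 43, 171, 425984, 29, 142, 31, 144, 18, 146, 22, 150, 26, 154, 28, 156, 458752, 17, 32,
   130, 41, 139, 44, 142, 46, 144, 33, 161, 37, 165, 40, 168, 491520, 26, 139, 29, 142, 31,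
   144, 18, 146, 22, 150, 25, 153, 524288, 17, 32, 130, 41, 139, 44, 142, 46, 144, 33, 161, 37,
   165, 557056, 26, 139, 29, 142, 31, 144, 18, 146, 22, 150, 589824, 17, 32, 130, 41, 139, 44,
   142, 45, 143, 33, 161, 37, 165, 4096, 26, 139, 29, 142, 30, 143, 18, 146, 22, 150, 4097, 17,
   32, 130, 44, 142, 33, 161, 37, 165, 41, 169, 43, 171, 4096, 29, 142, 18, 146, 22, 150, 26,
   154, 28, 156, 4097, 17, 32, 130, 41, 139, 44, 142, 33, 161, 37, 165, 40, 168, 4096, 26, 139,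
   29, 142, 18, 146, 22, 150, 25, 153, 4097, 17, 32, 130, 41, 139, 44, 142, 33, 161, 37, 165,
   4096, 26, 139, 29, 142, 18, 146, 22, 150, 4097, 18, 146, 22, 150, 33, 161, 37, 165, 64, 192,
   69, 197, 74, 202, 3854, 22, 150, 37, 165, 18, 40, 146, 32, 160, 33, 131, 41, 139, 42, 140,
   3584, 25, 138, 26, 139, 27, 140, 17, 145, 3585, 18, 146, 22, 150, 33, 161, 37, 165, 74, 202,
   4111, 17, 32, 130, 41, 139, 33, 161, 37, 165, 36, 134, 39, 137, 3584, 26, 139, 18, 146, 22,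
   150, 21, 134, 24, 137, 3585, 22, 150, 37, 165, 17, 32, 130, 41, 139, 33, 161, 39, 137, 3840,
   26, 139, 18, 146, 24, 137, 3841, 17, 32, 130, 41, 139, 46, 144, 33, 161, 37, 165, 622592,
   26, 139, 31, 144, 18, 146, 22, 150, 655360, 18, 146, 22, 150, 33, 161, 37, 165, 17, 32, 130,
   41, 139, 4096, 26, 139, 4097, 17, 32, 130, 44, 142, 45, 143, 46, 144, 33, 161, 37, 165,
   688128, 29, 142, 30, 143, 31, 144, 18, 146, 22, 150, 720896, 17, 32, 130, 44, 142, 46, 144,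
   33, 161, 37, 165, 753664, 29, 142, 31, 144, 18, 146, 22, 150, 786432, 17, 32, 130, 44, 142,
   33, 161, 37, 165, 819200, 29, 142, 18, 146, 22, 150, 851968, 17, 145, 18, 146, 22, 150, 32,
   160, 33, 161, 37, 165, 884736, 17, 32, 130, 41, 139, 43, 141, 44, 142, 46, 144, 34, 162, 36,
   164, 37, 165, 39, 167, 917504, 26, 139, 28, 141, 29, 142, 31, 144, 19, 147, 21, 149, 22,
   150, 24, 152, 950272, 17, 32, 130, 41, 139, 43, 141, 44, 142, 46, 144, 34, 162, 37, 165, 39,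
   167, 1536, 26, 139, 28, 141, 29, 142, 31, 144, 19, 147, 22, 150, 24, 152, 1537, 17, 32, 130,
   41, 139, 44, 142, 46, 144, 34, 162, 37, 165, 39, 167, 1536, 26, 139, 29, 142, 31, 144, 19,
   147, 22, 150, 24, 152, 1537, 17, 32, 63, 130, 132, 41, 139, 44, 142, 45, 143, 34, 162, 37,
   135, 39, 137, 40, 138, 768, 26, 139, 29, 142, 30, 143, 19, 147, 22, 135, 24, 137, 25, 138,
   769, 17, 32, 130, 41, 139, 44, 142, 45, 143, 34, 162, 37, 135, 39, 137, 1536, 26, 139, 29,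
   142, 30, 143, 19, 147, 22, 135, 24, 137, 1537, 17, 32, 130, 41, 139, 44, 142, 34, 162, 37,
   135, 39, 137, 1536, 26, 139, 29, 142, 19, 147, 22, 135, 24, 137, 1537, 17, 32, 130, 41, 139,
   43, 141, 44, 142, 46, 144, 34, 162, 37, 165, 983040, 26, 139, 28, 141, 29, 142, 31, 144, 19,
   147, 22, 150, 1015808, 17, 32, 130, 41, 139, 44, 142, 46, 144, 34, 162, 37, 165, 40, 168,
   1048576, 26, 139, 29, 142, 31, 144, 19, 147, 22, 150, 25, 153, 1081344, 17, 32, 130, 41,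
   139, 44, 142, 46, 144, 34, 162, 37, 165, 1114112, 26, 139, 29, 142, 31, 144, 19, 147, 22,
   150, 1146880, 17, 32, 130, 41, 139, 44, 142, 45, 143, 34, 162, 37, 135, 4096, 26, 139, 29,
   142, 30, 143, 19, 147, 22, 135, 4097, 17, 32, 130, 41, 139, 43, 141, 44, 142, 34, 162, 37,
   165, 4096, 26, 139, 28, 141, 29, 142, 19, 147, 22, 150, 4097, 17, 32, 130, 41, 139, 44, 142,
   34, 162, 37, 135, 40, 138, 4096, 26, 139, 29, 142, 19, 147, 22, 135, 25, 138, 4097, 17, 32,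
   130, 41, 139, 44, 142, 34, 162, 37, 135, 4096, 26, 139, 29, 142, 19, 147, 22, 135, 4097, 17,
   32, 130, 41, 139, 46, 144, 34, 162, 37, 165, 1179648, 26, 139, 31, 144, 19, 147, 22, 150,
   1212416, 17, 32, 130, 41, 139, 19, 34, 132, 37, 135, 4096, 22, 135, 1245184, 26, 139, 19,
   34, 132, 37, 135, 1277952, 22, 135, 4097, 17, 32, 130, 41, 139, 44, 142, 46, 144, 35, 163,
   37, 165, 1310720, 26, 139, 29, 142, 31, 144, 20, 148, 22, 150, 1343488, 17, 32, 130, 41,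
   139, 44, 142, 35, 163, 37, 165, 1376256, 26, 139, 29, 142, 20, 148, 22, 150, 1409024, 17,
   32, 130, 41, 139, 44, 142, 46, 144, 36, 164, 37, 165, 1441792, 26, 139, 29, 142, 31, 144,
   21, 149, 22, 150, 1474560, 17, 32, 130, 41, 139, 44, 142, 46, 144, 37, 165, 1507328, 26,
   139, 29, 142, 31, 144, 22, 150, 1540096, 17, 32, 130, 41, 139, 44, 142, 45, 143, 37, 165,
   1572864, 26, 139, 29, 142, 30, 143, 22, 150, 1605632, 17, 32, 130, 41, 139, 43, 141, 44,
   142, 37, 165, 1638400, 26, 139, 28, 141, 29, 142, 22, 150, 1671168, 17, 32, 130, 41, 139,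
   44, 142, 37, 165, 1703936, 26, 139, 29, 142, 22, 150, 1736704, 22, 150, 37, 165, 48, 17, 32,
   130, 41, 139, 42, 140, 43, 141, 1769472, 26, 139, 27, 140, 28, 141, 1802240, 130, 22, 150,
   37, 165, 17, 32, 130, 41, 139, 42, 140, 40, 168, 1835008, 26, 139, 27, 140, 25, 153,
   1867776, 22, 150, 37, 165, 17, 32, 130, 41, 139, 42, 140, 1900544, 26, 139, 27, 140,
   1933312, 17, 32, 130, 41, 139, 46, 144, 37, 165, 1966080, 26, 139, 31, 144, 22, 150,
   1998848, 22, 150, 37, 165, 17, 32, 130, 41, 139, 2031616, 26, 139, 2064384, 17, 145, 22,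
   150, 23, 151, 24, 152, 25, 153, 32, 160, 37, 165, 38, 166, 39, 167, 40, 168, 47, 175, 58,
   186, 63, 191, 68, 196, 73, 201, 2097152, 17, 145, 22, 150, 23, 151, 24, 152, 32, 160, 37,
   165, 38, 166, 39, 167, 73, 201, 2129920, 17, 32, 130, 46, 144, 37, 165, 38, 166, 2162688,
   31, 144, 22, 150, 23, 151, 2195456, 17, 145, 22, 150, 23, 151, 32, 160, 37, 165, 38, 166,
   2228224, 17, 32, 130, 44, 142, 46, 144, 37, 165, 2260992, 29, 142, 31, 144, 22, 150,
   2293760, 17, 32, 130, 44, 142, 37, 165, 2326528, 29, 142, 22, 150, 2359296, 17, 145, 22,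
   150, 32, 160, 37, 165, 2392064, 17, 32, 130, 41, 139, 46, 144, 2424832, 26, 139, 31, 144,
   2457600, 17, 32, 130, 41, 139, 2490368, 26, 139, 2523136, 17, 145, 32, 160, 2555904, 2588672]

theorem search_extend1 :
    search (graphs2.map (graphNode 1)) extend1 [(3, 0)] = true := by
  decide +kernel

theorem search_extend2 : search (graphs3.map (graphNode 35)) extend2
    (graphs2.map (graphNode 1)) = true := by
  decide +kernel

theorem search_extend3 : search (graphs4.map (graphNode 615)) extend3
    (graphs3.map (graphNode 35)) = true := by
  decide +kernel

theorem search_extend4 : search (graphs5.map (graphNode 5871)) extend4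
    (graphs4.map (graphNode 615)) = true := by
  decide +kernel

theorem search_extend5 : search (graphs6.map (graphNode 32767)) extend5
    (graphs5.map (graphNode 5871)) = true := by
  decide +kernel

theorem search_finish : search (leafLists.map leafNode) finish
    ((graphs6.map (graphNode 32767)).map closeNode) = true := by
  decide +kernel

/-- Every pointed set embeds into one of the 39 graphs. -/
theorem embeds_of_isPointed {T : Finset ℕ} (hT : IsPointed T 0 1) : Embeds maximalLists T := by
  have h6 : ∀ g ∈ graphs6.map (graphNode 32767), Settled maximalLists g := fun g hg =>
    settled_of_closeNode (settled_of_search settled_leafNode _ _ search_finish _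
      (List.mem_map_of_mem hg))
  have h5 := settled_of_search h6 _ _ search_extend5
  have h4 := settled_of_search h5 _ _ search_extend4
  have h3 := settled_of_search h4 _ _ search_extend3
  have h2 := settled_of_search h3 _ _ search_extend2
  have h1 := settled_of_search h2 _ _ search_extend1 (3, 0) (by simp)
  refine h1 T hT (fun x hx => ?_) (fun x hx => by simp at hx)
  change Nat.testBit 3 x = true at hx
  match x, hx with
  | 0, _ => exact hT.left_mem
  | 1, _ => exact hT.right_mem
  | x + 2, hx => simp [Nat.testBit_succ] at hx

/-! ### Every representable graph embeds into one of the 39 graphs -/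

theorem card_le_of_orthogonal {ι : Type*} [Fintype ι] (v : ι → Fin 8 → ℤ)
    (h : ∀ a b, a ≠ b → v a ⬝ᵥ v b = 0) (h' : ∀ a, v a ⬝ᵥ v a ≠ 0) : Fintype.card ι ≤ 8 := by
  have hl : LinearIndependent ℤ v := by
    rw [Fintype.linearIndependent_iff]
    intro c hc a
    have h1 : (∑ b, c b • v b) ⬝ᵥ v a = 0 := by rw [hc, zero_dotProduct]
    rw [sum_dotProduct, Finset.sum_eq_single a] at h1
    · rw [smul_dotProduct, smul_eq_mul] at h1
      exact (mul_eq_zero.mp h1).resolve_right (h' a)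
    · intro b _ hb
      rw [smul_dotProduct, h b a hb, smul_zero]
    · simp
  simpa using hl.fintype_card_le_finrank

theorem card_le_seven {T : Finset ℕ} (hT : ∀ x ∈ T, x < 126)
    (h : ∀ x ∈ T, ∀ y ∈ T, x ≠ y → ip x y = 0) : T.card ≤ 7 := by
  have h8 := card_le_of_orthogonal (ι := Option T)
    (fun o => o.elim (1 : Fin 8 → ℤ) fun x => rt x) ?_ ?_
  · have h9 : T.card < 8 := by simpa using h8
    omega
  · rintro (_ | a) (_ | b) hab
    · exact absurd rfl hab
    · simpa [dotProduct_comm] using rt_sum (hT b b.2)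
    · simpa using rt_sum (hT a a.2)
    · exact h a a.2 b b.2 fun e => hab (congrArg some (Subtype.ext e))
  · rintro (_ | a)
    · simp [dotProduct_one]
    · have := ip_self (hT a a.2)
      simp only [ip] at this
      simp [this]

/-- One of the 39 graphs has seven pairwise non-adjacent vertices. -/
theorem exists_orthogonal : ∃ L ∈ maximalLists, ∃ p : Fin 7 → Fin L.length,
    ∀ a b, a ≠ b → p a ≠ p b ∧ ip (L.get (p a)) (L.get (p b)) ≠ 4 := by
  let pos : Fin 7 → Fin 14 := ![2, 4, 9, 10, 11, 12, 13]
  have hlen : (maximalLists.getD 28 []).length = 14 := by decide +kernel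
  have hmem : maximalLists.getD 28 [] ∈ maximalLists := by decide +kernel
  have hpos : ∀ a b, a ≠ b → pos a ≠ pos b := by decide +kernel
  have hlt : ∀ a, (maximalLists.getD 28 []).getD (pos a) 0 < 126 := by decide +kernel
  have hip : ∀ a b, a ≠ b → ipN ((maximalLists.getD 28 []).getD (pos a) 0)
      ((maximalLists.getD 28 []).getD (pos b) 0) = 32 := by decide +kernel
  have hget : ∀ a, (maximalLists.getD 28 []).get (Fin.cast hlen.symm (pos a)) =
      (maximalLists.getD 28 []).getD (pos a) 0 := fun a =>
    (List.getD_eq_getElem _ _ (by rw [hlen]; exact (pos a).2)).symm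
  refine ⟨_, hmem, fun a => Fin.cast hlen.symm (pos a), fun a b hab => ⟨?_, ?_⟩⟩
  · simpa using hpos a b hab
  · rw [hget, hget, ip_eq_ipN (hlt a) (hlt b), hip a b hab]
    norm_num

theorem embeds_of_orthogonal {T : Finset ℕ} (hT : ∀ x ∈ T, x < 126)
    (h : ∀ x ∈ T, ∀ y ∈ T, x ≠ y → ip x y = 0) : Embeds maximalLists T := by
  obtain ⟨L, hL, p, hp⟩ := exists_orthogonal
  have hc := card_le_seven hT h
  have hlt : ∀ x (hx : x ∈ T), (T.equivFin ⟨x, hx⟩ : ℕ) < 7 := fun x hx => by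
    have := (T.equivFin ⟨x, hx⟩).2
    omega
  have key : ∀ x (hx : x ∈ T) y (hy : y ∈ T), x ≠ y →
      (⟨_, hlt x hx⟩ : Fin 7) ≠ ⟨_, hlt y hy⟩ := by
    intro x hx y hy hxy e
    rw [Fin.mk.injEq] at e
    have := T.equivFin.injective (Fin.ext e)
    exact hxy (by simpa using this)
  refine ⟨L, hL, fun x => if hx : x ∈ T then p ⟨_, hlt x hx⟩ else p 0, ?_, ?_⟩
  · intro x hx y hy e
    by_contra hxy
    have hx' : x ∈ T := hx
    have hy' : y ∈ T := hy
    simp only [hx', hy', dif_pos] at e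
    exact (hp _ _ (key x hx y hy hxy)).1 e
  · intro x hx y hy hxy
    simp only [hx, hy, dif_pos, h x hx y hy hxy]
    exact iff_of_false (by norm_num) (hp _ _ (key x hx y hy hxy)).2

/-- Sets of roots with pairwise non-negative inner products embed. -/
theorem embeds_of_compat {T : Finset ℕ} (hT : ∀ x ∈ T, x < 126)
    (hc : ∀ x ∈ T, ∀ y ∈ T, 0 ≤ ip x y)
    (hv : ∀ x ∈ T, ∀ y ∈ T, x ≠ y → ip x y = 0 ∨ ip x y = 4) : Embeds maximalLists T := by
  by_cases he : ∃ x ∈ T, ∃ y ∈ T, ip x y = 4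
  · obtain ⟨x, hx, y, hy, hxy⟩ := he
    let S : Set (Finset ℕ) := {U | (∀ x ∈ U, x < 126) ∧ ∀ x ∈ U, ∀ y ∈ U, 0 ≤ ip x y}
    have hS : S.Finite := by
      refine (Finset.finite_toSet (Finset.range 126).powerset).subset fun U hU => ?_
      rw [Finset.mem_coe, Finset.mem_powerset]
      exact fun x hx => Finset.mem_range.mpr (hU.1 x hx)
    obtain ⟨U, hTU, hU⟩ := hS.exists_le_maximal (show T ∈ S from ⟨hT, hc⟩)
    obtain ⟨⟨p, q⟩, hpq, hmax⟩ := ((U ×ˢ U).filter fun e => ip e.1 e.2 = 4).exists_max_image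
      (fun e => (common U e.1 e.2).card) ⟨(x, y), by simp [hTU hx, hTU hy, hxy]⟩
    simp only [Finset.mem_filter, Finset.mem_product] at hpq hmax
    have hp := hU.prop.1 p hpq.1.1
    have hq := hU.prop.1 q hpq.1.2
    obtain ⟨σ, τ, hσ, hσp, hσq⟩ := exists_isSym_edge hp hq hpq.2
    have hP : IsPointed U p q := by
      refine ⟨hU.prop.1, hpq.1.1, hpq.1.2, hU.prop.2, fun z hz hzU => ?_, fun a ha b hb hab => ?_⟩
      · by_contra hcon
        push Not at hcon
        have hmem : insert z U ∈ S := by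
          refine ⟨fun a ha => ?_, fun a ha b hb => ?_⟩
          · rcases Finset.mem_insert.mp ha with rfl | ha
            · exact hz
            · exact hU.prop.1 a ha
          · rw [Finset.mem_insert] at ha hb
            rcases ha with ha | ha <;> rcases hb with hb | hb
            · rw [ha, hb, ip_self hz]; norm_num
            · rw [ha]; exact hcon b hb
            · rw [hb, ip_comm]; exact hcon a ha
            · exact hU.prop.2 a ha b hb
        exact hzU (hU.le_of_ge hmem (Finset.subset_insert z U) (Finset.mem_insert_self z U))
      · exact hmax (a, b) ⟨⟨ha, hb⟩, hab⟩
    have e0 : τ 0 = p := by rw [← hσp, hσ.left_inv p hp]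
    have e1 : τ 1 = q := by rw [← hσq, hσ.left_inv q hq]
    have hU' : Embeds maximalLists U := Embeds.of_preim hσ.symm hU.prop.1
      (embeds_of_isPointed (IsPointed.preim hσ.symm (by norm_num) (by norm_num)
        (by rwa [e0, e1])))
    exact hU'.of_map id (fun x hx => hTU hx) Function.injective_id.injOn fun _ _ _ _ => rfl
  · push Not at he
    exact embeds_of_orthogonal hT fun x hx y hy hxy => (hv x hx y hy hxy).resolve_right
      (he x hx y hy)

theorem exists_embedding {V : Type u} {G : SimpleGraph V} (hG : E7Representable G) :
    ∃ L ∈ maximalLists, Nonempty (G ↪g rootGraph L) := by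
  classical
  obtain ⟨f, hf⟩ := hG
  choose g hg hgf using fun v => exists_rt_eq (hf.mem v)
  have hinj : Function.Injective g := fun a b e => hf.injective (by rw [← hgf a, ← hgf b, e])
  have hip : ∀ a b, ip (g a) (g b) = f a ⬝ᵥ f b := fun a b => by rw [ip, hgf, hgf]
  have : Finite V := Finite.of_injective (fun v => (⟨g v, hg v⟩ : Fin 126))
    fun a b e => hinj (Fin.mk.inj_iff.mp e)
  have := Fintype.ofFinite V
  have hv : ∀ a b, a ≠ b → ip (g a) (g b) = 0 ∨ ip (g a) (g b) = 4 := fun a b hab => by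
    rw [hip]
    by_cases h : G.Adj a b
    · exact Or.inr (hf.adj a b h)
    · exact Or.inl (hf.not_adj a b hab h)
  obtain ⟨L, hL, h, hi, ha⟩ := embeds_of_compat (T := Finset.univ.image g) (by simpa using hg)
    (by
      simp only [Finset.mem_image, Finset.mem_univ, true_and, forall_exists_index,
        forall_apply_eq_imp_iff]
      intro a b
      by_cases hab : a = b
      · rw [hab, ip_self (hg b)]; norm_num
      · rcases hv a b hab with h | h <;> rw [h]; norm_num)
    (by
      simp only [Finset.mem_image, Finset.mem_univ, true_and, forall_exists_index,
        forall_apply_eq_imp_iff]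
      exact fun a b hab => hv a b fun e => hab (by rw [e]))
  have hmem : ∀ a, g a ∈ Finset.univ.image g := fun a => Finset.mem_image_of_mem g (by simp)
  have hinj' : Function.Injective fun a => h (g a) := fun a b e =>
    hinj (hi (hmem a) (hmem b) e)
  refine ⟨L, hL, ⟨⟨⟨fun a => h (g a), hinj'⟩, ?_⟩⟩⟩
  intro a b
  change (h (g a) ≠ h (g b) ∧ ip (L.get (h (g a))) (L.get (h (g b))) = 4) ↔ _
  by_cases hab : a = b
  · simp [hab]
  · rw [← ha _ (hmem a) _ (hmem b) (fun e => hab (hinj e)), hip]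
    refine ⟨fun h => ?_, fun h => ⟨fun e => hab (hinj' e), hf.adj a b h⟩⟩
    by_contra hn
    rw [hf.not_adj a b hab hn] at h
    exact absurd h.2 (by norm_num)

/-! ### The 39 graphs are representable -/

/-- Checks that the roots in a list have inner products `0` and `4`. -/
def compatible : List ℕ → Bool
  | [] => true
  | x :: l => Nat.blt x 77 && ((l.all fun y => Nat.beq (ipN x y) 32 || Nat.beq (ipN x y) 36) &&
      compatible l)

theorem maximalLists_compatible : maximalLists.all compatible = true := by decide +kernel

theorem of_compatible : ∀ {L : List ℕ}, compatible L = true →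
    (∀ x ∈ L, x < 77) ∧ L.Pairwise fun x y => ip x y = 0 ∨ ip x y = 4
  | [], _ => by simp
  | x :: L, h => by
    rw [compatible, Bool.and_eq_true, Bool.and_eq_true, List.all_eq_true, blt_eq] at h
    obtain ⟨h1, h2⟩ := of_compatible h.2.2
    refine ⟨by simpa using ⟨h.1, h1⟩, List.pairwise_cons.mpr ⟨fun y hy => ?_, h2⟩⟩
    have hx := h.1
    have hy' := h1 y hy
    have := h.2.1 y hy
    rw [Bool.or_eq_true, Nat.beq_eq, Nat.beq_eq] at this
    rw [ip_eq_ipN (by omega) (by omega)]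
    omega

theorem lt_of_mem {L : List ℕ} (hL : L ∈ maximalLists) {x : ℕ} (hx : x ∈ L) : x < 77 :=
  (of_compatible (List.all_eq_true.mp maximalLists_compatible L hL)).1 x hx

theorem ip_get {L : List ℕ} (hL : L ∈ maximalLists) {a b : Fin L.length} (hab : a ≠ b) :
    ip (L.get a) (L.get b) = 0 ∨ ip (L.get a) (L.get b) = 4 := by
  have h := (of_compatible (List.all_eq_true.mp maximalLists_compatible L hL)).2
  rw [List.pairwise_iff_getElem] at h
  rcases lt_or_gt_of_ne hab with h1 | h1
  · exact h a b a.2 b.2 h1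
  · rw [ip_comm]
    exact h b a b.2 a.2 h1

theorem isE7Representation_rootGraph {L : List ℕ} (hL : L ∈ maximalLists) :
    IsE7Representation (rootGraph L) fun a => rt (L.get a) where
  mem a := by
    have := lt_of_mem hL (L.get_mem a)
    exact rt_mem_rootsE7 ⟨L.get a, by omega⟩
  injective a b e := by
    by_contra hab
    have h8 := ip_self (show L.get a < 126 by have := lt_of_mem hL (L.get_mem a); omega)
    have e' : ip (L.get a) (L.get b) = ip (L.get a) (L.get a) := by
      unfold ip
      rw [show rt (L.get a) = rt (L.get b) from e]
    rcases ip_get hL hab with h | h <;> omega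
  adj a b h := h.2
  not_adj a b hab h := (ip_get hL hab).resolve_right fun h4 => h ⟨hab, h4⟩

/-! ### The 39 graphs have no representable extensions -/

/-- A vector orthogonal to the all-ones vector and to seven further vectors with an invertible Gram
matrix vanishes. -/
theorem eq_zero_of_orthogonal (b : Fin 7 → Fin 8 → ℤ) (P : Fin 7 → Fin 7 → ℤ)
    (hb : ∀ a, b a ⬝ᵥ (1 : Fin 8 → ℤ) = 0)
    (hP : ∀ a d, ∑ c, P a c * (b c ⬝ᵥ b d) = if a = d then 8 else 0) {u : Fin 8 → ℤ}
    (hu : ∀ a, b a ⬝ᵥ u = 0) (hu1 : u ⬝ᵥ (1 : Fin 8 → ℤ) = 0) : u = 0 := by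
  let R : Fin 8 → Fin 8 → ℤ := Fin.cons 1 b
  let S : Fin 8 → Fin 8 → ℤ := Fin.cons (Fin.cons 1 0) fun a => Fin.cons 0 (P a)
  let F : Matrix (Fin 8) (Fin 8) ℤ := Matrix.of R
  let Q : Matrix (Fin 8) (Fin 8) ℤ := Matrix.of S
  have hFF : ∀ i j, (F * Fᵀ) i j = R i ⬝ᵥ R j := fun i j => rfl
  have hQS : ∀ i j, Q i j = S i j := fun i j => rfl
  have hR0 : R 0 = 1 := rfl
  have hR : ∀ a : Fin 7, R a.succ = b a := fun a => rfl
  have hS00 : S 0 0 = 1 := rfl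
  have hS01 : ∀ a : Fin 7, S 0 a.succ = 0 := fun a => rfl
  have hS10 : ∀ a : Fin 7, S a.succ 0 = 0 := fun a => rfl
  have hS : ∀ a d : Fin 7, S a.succ d.succ = P a d := fun a d => rfl
  have hQ : Q * (F * Fᵀ) = (8 : ℤ) • (1 : Matrix (Fin 8) (Fin 8) ℤ) := by
    ext i j
    rw [Matrix.mul_apply, Fin.sum_univ_succ]
    simp only [hFF, hQS, Matrix.smul_apply, Matrix.one_apply]
    refine Fin.cases ?_ (fun a => ?_) i <;> refine Fin.cases ?_ (fun d => ?_) j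
    · simp [hR0, hS00, hS01, dotProduct_one]
    · rw [hS00, hR0, hR, dotProduct_comm, hb]
      simp [hS01, (Fin.succ_ne_zero d).symm]
    · simp [hS10, hS, hR, hR0, hb]
    · simp only [hS10, hS, hR, zero_mul, zero_add]
      rw [hP a d]
      simp [Fin.succ_inj]
  have hdet : F.det ≠ 0 := by
    intro h0
    have := congrArg Matrix.det hQ
    rw [Matrix.det_mul, Matrix.det_mul, h0, zero_mul, mul_zero, Matrix.det_smul, Matrix.det_one]
      at this
    norm_num at this
  refine Matrix.eq_zero_of_mulVec_eq_zero hdet (funext fun i => ?_)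
  refine Fin.cases ?_ (fun a => ?_) i
  · change (1 : Fin 8 → ℤ) ⬝ᵥ u = 0
    rw [dotProduct_comm, hu1]
  · exact hu a

/-- For each of the 39 graphs, seven roots that form a basis of the root lattice, and twice the
inverse of their Gram matrix, with entries increased by `64`, seven bits each. -/
def basisTable : List (List ℕ × ℕ) := [
   ([5, 37, 63, 3, 13, 4, 24], 0x447cfa03e8501f4484fa03e80fa1437d05f4180f9f448109f3e81060437d0613e7d09f447d020417d05f43),
   ([41, 0, 38, 37, 12, 34, 15], 0x437f05f417d09fc37f09fc07d05fc380fdf427d0a0447d01f417efdf438101f407d020447d09f427d01f44),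
   ([0, 41, 9, 36, 37, 5, 32], 0x4382f9fc082fe0c37d05f417ef9f448109f407f060437d05fc07d09f447d020c17d05f437efdfc07f01fc3),
   ([0, 37, 41, 13, 15, 1, 4], 0x447d021427cf9f437efdfc28101fc37f05f4084fdfc38301f427f060c37cf9f427d01f4480fa0407cfa044),
   ([33, 5, 37, 10, 44, 39, 32], 0x437b060c27ef5ec77afdd438b05ec37f09fbf82fdfc384fdec2750a14878e9fc37efde4386f62bf7aea1c7),
   ([37, 33, 10, 45, 0, 44, 46], 0x437cf60c37f09f4484f9e427cf61477aee0bc82f9ec386fe14378ee1c77b11fc282fdec37d09f3c8511f44),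
   ([0, 9, 12, 41, 43, 5, 44], 0x438305f4082fa0c37ef9f418105fc38109fbe7cfa04484fa0407d0a1447cfa0c17ef9f4380fa03e80fa044),
   ([0, 37, 44, 40, 33, 13, 4], 0x4485121427cea143870a0bf77121c7890deb7850a24484f9d42830e1437eedf3f7af9fc386e9db774ee1cf),
   ([0, 15, 10, 13, 46, 5, 44], 0x4480f9f3e850204385060c178fa144850a03c7d0614382fdf3e830a0c37efa14180fdfc37d01e3c7cf9f48),
   ([1, 4, 46, 33, 0, 10, 32], 0x4384f5fc183021447cfa0427cf5f477ef5fbe7ef9fc382fe14180f60c37f0a0c27efdfc37d01f3e8509f44),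
   ([11, 10, 6, 1, 33, 12, 4], 0x4788f5dbc8cf62447cf1f447cf5f438709e4176f21c784ea0bc7d0a144790a34478e9e487cf5f418309f43),
   ([15, 12, 1, 4, 33, 6, 11], 0x47890dec178ea24484fa03e790e1437f05f3c7af9fc37f0a1418105fc37cf9e3e7d09f4488e9e3c84fa248),
   ([6, 1, 15, 4, 10, 33, 11], 0x438301fbe7f0a0c37cfdf418501f448501f3e7efe14380fdf3e7d0204480f9fc17cfe043810a13e7cfa044),
   ([15, 0, 12, 36, 34, 10, 41], 0x4480fa142790a0437d060bf7ef9f447cfa1408505f4382f60c282fa0c37b05e3f84f5ec77b09fc08305ec3),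
   ([34, 1, 15, 6, 3, 5, 0], 0x4878f213a84f1e4484fa23e84f21447d11f4284f9f437b05fba8911ec77b0e13e7d05ec37ef21427f0dfc3),
   ([13, 3, 37, 1, 6, 35, 44], 0x4778ea2437b05e4488f9f427cea24878f213e88f9e4484fa0437cf21437f05ec284f9fc37f05f3e8105fc3),
   ([44, 1, 9, 4, 8, 41, 35], 0x4480f214280fa04484f9e427cf214778ee0c184f9e4488fa04278ee2477b0604282f9ec37ef9f418105fc3),
   ([46, 44, 0, 8, 13, 9, 5], 0x437f0613d8301fc382f9fbf85060c380f5fc284fa0447d09f3d7ef5f477efa0bf7f09fc37d021427cf9f44),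
   ([4, 41, 44, 5, 1, 0, 37], 0x447d0a0427cf9f447d01f408109f437f0603f8101fc382f9fc27d060c37cfdf4080f9f4484fa03f7efe143),
   ([12, 10, 16, 9, 6, 1, 4], 0x437cf9fc18505f44810203e7cfa04484f9f407f021437ef9fc180f9fc380fe13e7cfa0448505f407efe143),
   ([13, 1, 0, 37, 16, 5, 12], 0x437cfe13f82fdf4480fa03e84fe0437d05fbf84f9f447d0a03f8105f437efe0be7f09fc37efe13f80fdfc3),
   ([13, 37, 1, 5, 4, 12, 10], 0x43850a03d7efe14484f9f407d0a14480f1f4080fa0447cfa13d7cf1f4786fdfc07cfa1c37efdf4084fdfc3),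
   ([3, 13, 4, 9, 5, 0, 6], 0x4380fa0bf7d0604480f9f3e80fa0447d0213e82f9f4383020bf7d020c384fdf3e85021447d0603e82fdf43),
   ([12, 3, 10, 46, 44, 15, 13], 0x4778ee1c17ef5e4488f9f4084ee2477af5fc386f9ec382fdfc17cf60c382fdfc07efe0c37ef61437efdfc3),
   ([5, 12, 44, 1, 13, 10, 11], 0x438501ebf7f0a14480f1f4085020447cf9f427af1f478705e3f7cfa1c382f9fc07d060c37d0a14278f9f44),
   ([10, 5, 32, 4, 3, 9, 0], 0x4c78f1e3a80f1e44850a13e80f21438309fc1790a0c384fe0ba850a144810a03e7efe04382f2041830a0c3),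
   ([1, 8, 5, 14, 41, 12, 32], 0x447cf9e448501f438305f407efa0c386f1f4179061c774f20c47cf1d4888fa1407cf22447d01fc182f9f43),
   ([5, 4, 15, 6, 3, 9, 0], 0x447cfa03e8101f4383060417cfa0c37f09fc08105fc37d05f3e8109f447d0a0417f05f437d01f407d09f44),
   ([15, 23, 13, 44, 10, 32, 4], 0x438309f427ef20c38501f417d0a1447d0203c7d01f44790a2427d01e4878f1fc18109e4384f1f3c88f2148),
   ([3, 6, 16, 13, 14, 22, 1], 0x437efdfc080fdfc37f0603e82fdfc382fa13f7f060c37d01fc080f9f447d0a03e8501f447cfe0bf7f09f43),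
   ([22, 0, 8, 10, 9, 14, 42], 0x43850603e7cfe1487d11e3c7905f437d020418111f447cf9f3e7901f448509f3c80fa14484fde417d0a143),
   ([0, 9, 13, 4, 3, 5, 32], 0x437f0a0bf84f5fc37cfe0be8309f4480fa13e82fe0438309ebf82fa0c380fe13e850a04478f60be7afde47),
   ([42, 8, 10, 5, 13, 16, 32], 0x4770f22497af5c4c88e9a4488f22447cea14288e9f448cf9f4968ea34f76edec484f9dc382f62427cee0c3),
   ([22, 6, 14, 9, 8, 1, 4], 0x4480fa13e7d020437efe03f7ef9fc37f020c184fdfc37cfe0be8101f4484f9f3f82fe1437f01fc182f9fc3),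
   ([13, 7, 10, 32, 1, 15, 0], 0x4380fdf3f7f060447cf9f4280fdf438505fbf7cfa1448501f3f7d061437efdfc27f01fc37f0603f7cfdfc3),
   ([37, 11, 15, 13, 14, 10, 6], 0x437f05fc080f9fc37efdf428505fc38301f3e7efe0c380fa0407d020447cfa0427cf9f4484fa13e80fa144),
   ([0, 5, 17, 32, 14, 6, 11], 0x4383020be82f60c38505f3f7b0214480f9f3e83060437d05ebe7cf9f4481120bf7d060437ef5ebe7b11fc7),
   ([32, 0, 11, 23, 9, 17, 10], 0x437906143770de4c78e9c4c7105e43850ddc384ea14488ea243710e2476f15dcc76e9bcf6f0dc438915bc7),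
   ([15, 24, 0, 16, 17, 37, 14], 0x447cf213e8501f4386fa0bf7ef21c7790debf84f9e447d0a03e830df437efe13f7b09fc37f01fbf80fdfc3)]

/-- The sum of seven values. -/
def sum7 (f : ℕ → ℕ) : ℕ :=
  Nat.add (f 0) (Nat.add (f 1) (Nat.add (f 2) (Nat.add (f 3) (Nat.add (f 4) (Nat.add (f 5)
    (f 6))))))

theorem sum7_eq (f : ℕ → ℕ) : sum7 f = ∑ a : Fin 7, f a := by
  simp [sum7, Fin.sum_univ_seven, Nat.add_assoc]

/-- A quarter of the inner product of two roots in a compatible set. -/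
def ip4 (x y : ℕ) : ℕ := cond (Nat.beq x y) 2 (cond (tb (adM x) y) 1 0)

/-- A binary digit. -/
def bt (n a : ℕ) : ℕ := Nat.land (Nat.shiftRight n a) 1

/-- An entry of a packed matrix. -/
def entry (t a b : ℕ) : ℕ :=
  Nat.land (Nat.shiftRight t (Nat.add (Nat.mul 49 a) (Nat.mul 7 b))) 127

/-- The product of a packed matrix with a vector of binary digits. -/
def prodN (t n a : ℕ) : ℕ := sum7 fun b => Nat.mul (bt n b) (entry t b a)

/-- Checks that a packed matrix is twice the inverse of a Gram matrix. -/
def inverseCheck (B : List ℕ) (t : ℕ) : Bool :=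
  (List.range 7).all fun a => (List.range 7).all fun b =>
    Nat.beq (sum7 fun c => Nat.mul (entry t a c) (ip4 (B.getD c 0) (B.getD b 0)))
      (Nat.add (cond (Nat.beq a b) 2 0)
        (Nat.mul 64 (sum7 fun c => ip4 (B.getD c 0) (B.getD b 0))))

/-- Checks that a vector of norm `8` with given inner products with a basis has an inner product
other than `0` and `4` with some root in `L`. -/
def extensionCheck (L B : List ℕ) (t n : ℕ) : Bool :=
  cond (Nat.beq (sum7 fun a => Nat.mul (bt n a) (prodN t n a))
      (Nat.add 4 (Nat.mul 64 (Nat.mul (sum7 (bt n)) (sum7 (bt n))))))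
    (L.any fun v =>
      !(Nat.beq (sum7 fun a => Nat.mul (ip4 v (B.getD a 0)) (prodN t n a))
        (Nat.mul 64 (Nat.mul (sum7 (bt n)) (sum7 fun a => ip4 v (B.getD a 0))))) &&
      !(Nat.beq (sum7 fun a => Nat.mul (ip4 v (B.getD a 0)) (prodN t n a))
        (Nat.add 2 (Nat.mul 64 (Nat.mul (sum7 (bt n)) (sum7 fun a => ip4 v (B.getD a 0)))))))
    true

/-- All checks for one of the 39 graphs. -/
def maximalityCheck (L : List ℕ) (p : List ℕ × ℕ) : Bool :=
  (Nat.beq p.1.length 7 && p.1.all fun x => L.elem x) && (inverseCheck p.1 p.2 &&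
    (List.range 128).all fun n => extensionCheck L p.1 p.2 n)

theorem maximalityCheck_all : (Nat.beq maximalLists.length basisTable.length &&
    (List.zipWith maximalityCheck maximalLists basisTable).all fun b => b) = true := by
  decide +kernel

theorem exists_maximalityCheck {L : List ℕ} (hL : L ∈ maximalLists) :
    ∃ p, maximalityCheck L p = true := by
  have h := maximalityCheck_all
  rw [Bool.and_eq_true, Nat.beq_eq, List.all_eq_true] at h
  obtain ⟨i, hi, rfl⟩ := List.getElem_of_mem hL
  refine ⟨basisTable[i]'(by rw [← h.1]; exact hi), ?_⟩
  have := h.2 ((List.zipWith maximalityCheck maximalLists basisTable)[i]'(by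
    rw [List.length_zipWith]; omega)) (List.getElem_mem _)
  rwa [List.getElem_zipWith] at this

theorem exists_bits (c : Fin 7 → ℕ) (hc : ∀ a, c a = 0 ∨ c a = 1) :
    ∃ n < 128, ∀ a : Fin 7, bt n a = c a := by
  have h : ∀ a0 a1 a2 a3 a4 a5 a6 : Fin 2,
      (a0 + 2 * a1 + 4 * a2 + 8 * a3 + 16 * a4 + 32 * a5 + 64 * a6 : ℕ) < 128 ∧
      ∀ a : Fin 7, bt (a0 + 2 * a1 + 4 * a2 + 8 * a3 + 16 * a4 + 32 * a5 + 64 * a6) a =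
        (![a0, a1, a2, a3, a4, a5, a6] a : ℕ) := by
    decide +kernel
  have hlt : ∀ a, c a < 2 := fun a => by rcases hc a with h | h <;> omega
  obtain ⟨h1, h2⟩ := h ⟨_, hlt 0⟩ ⟨_, hlt 1⟩ ⟨_, hlt 2⟩ ⟨_, hlt 3⟩ ⟨_, hlt 4⟩ ⟨_, hlt 5⟩
    ⟨_, hlt 6⟩
  refine ⟨_, h1, fun a => ?_⟩
  rw [h2 a]
  fin_cases a <;> rfl

theorem dotProduct_self_rootsE7 {x : Fin 8 → ℤ} (hx : x ∈ rootsE7) : x ⬝ᵥ x = 8 := by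
  obtain ⟨n, hn, rfl⟩ := exists_rt_eq hx
  exact ip_self hn

theorem ip4_eq {L : List ℕ} (hL : L ∈ maximalLists) {x y : ℕ} (hx : x ∈ L) (hy : y ∈ L) :
    ip x y = 4 * ip4 x y := by
  obtain ⟨a, rfl⟩ := List.get_of_mem hx
  obtain ⟨b, rfl⟩ := List.get_of_mem hy
  have ha := lt_of_mem hL hx
  have hb := lt_of_mem hL hy
  unfold ip4
  by_cases hab : L.get a = L.get b
  · rw [hab, Nat.beq_refl, cond_true, ip_self (by omega)]
    norm_num
  · have hne : Nat.beq (L.get a) (L.get b) = false := by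
      rw [Bool.eq_false_iff, Ne, Nat.beq_eq]
      exact hab
    rw [hne, cond_false, tb_eq]
    rcases ip_get hL (fun e => hab (congrArg L.get e)) with h | h
    · have : (adM (L.get a)).testBit (L.get b) = false := by
        rw [Bool.eq_false_iff, Ne, adM_testBit ha, h]
        omega
      rw [this, h]
      norm_num
    · have : (adM (L.get a)).testBit (L.get b) = true := (adM_testBit ha).mpr ⟨hb, h⟩
      rw [this, h]
      norm_num

/-- A representable graph that contains one of the 39 graphs is not larger. -/
theorem surjective_of_embedding {L : List ℕ} (hL : L ∈ maximalLists) {W : Type u}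
    {H : SimpleGraph W} (hH : E7Representable H) (φ : rootGraph L ↪g H) :
    Function.Surjective φ := by
  classical
  obtain ⟨f, hf⟩ := hH
  by_contra hns
  obtain ⟨w, hw⟩ := not_forall.mp hns
  obtain ⟨⟨B, t⟩, hcheck⟩ := exists_maximalityCheck hL
  simp only [maximalityCheck, Bool.and_eq_true, Nat.beq_eq, List.all_eq_true,
    List.elem_eq_mem, decide_eq_true_iff, inverseCheck, List.mem_range] at hcheck
  obtain ⟨⟨hB7, hBL⟩, hinv, hext⟩ := hcheck
  have hBmem : ∀ a : Fin 7, B.getD a 0 ∈ L := fun a => by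
    rw [List.getD_eq_getElem _ _ (by rw [hB7]; exact a.2)]
    exact hBL _ (List.getElem_mem _)
  choose k hk using fun a => List.get_of_mem (hBmem a)
  have hdot : ∀ x y, f (φ x) ⬝ᵥ f (φ y) = 4 * (ip4 (L.get x) (L.get y) : ℤ) := by
    intro x y
    rw [← ip4_eq hL (L.get_mem x) (L.get_mem y)]
    by_cases hxy : x = y
    · rw [hxy, dotProduct_self_rootsE7 (hf.mem _),
        ip_self (by have := lt_of_mem hL (L.get_mem y); omega)]
    · rcases ip_get hL hxy with h | h
      · rw [h]
        refine hf.not_adj _ _ (fun e => hxy (φ.injective e)) fun hadj => ?_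
        have h4 : ip (L.get x) (L.get y) = 4 := (φ.map_rel_iff.mp hadj).2
        omega
      · rw [h]
        exact hf.adj _ _ (φ.map_rel_iff.mpr ⟨hxy, h⟩)
  let c : Fin L.length → ℕ := fun x => if H.Adj w (φ x) then 1 else 0
  have hc : ∀ x, f w ⬝ᵥ f (φ x) = 4 * (c x : ℤ) := by
    intro x
    simp only [c]
    split_ifs with h
    · rw [hf.adj _ _ h]; norm_num
    · rw [hf.not_adj _ _ (fun e => hw ⟨x, e.symm⟩) h]; norm_num
  have hc01 : ∀ x, c x = 0 ∨ c x = 1 := fun x => by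
    simp only [c]
    split_ifs <;> simp
  obtain ⟨n, hn, hbits⟩ := exists_bits (fun a => c (k a)) fun a => hc01 _
  let b : Fin 7 → Fin 8 → ℤ := fun a => f (φ (k a))
  let P : Fin 7 → Fin 7 → ℤ := fun a d => (entry t a d : ℤ) - 64
  let y : Fin 7 → ℤ := fun a => ∑ d, (c (k d) : ℤ) * P d a
  have hy : ∀ a, y a = (prodN t n a : ℤ) - 64 * (sum7 (bt n) : ℤ) := by
    intro a
    simp only [y, P, prodN, sum7_eq, Nat.mul_eq, hbits]
    push_cast
    rw [Finset.mul_sum, ← Finset.sum_sub_distrib]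
    exact Finset.sum_congr rfl fun d _ => by ring
  have hP : ∀ a d, ∑ e, P a e * (b e ⬝ᵥ b d) = if a = d then 8 else 0 := by
    intro a d
    have h := hinv a a.2 d d.2
    simp only [sum7_eq, Nat.mul_eq, Nat.add_eq] at h
    have h' : (∑ e : Fin 7, (entry t a e : ℤ) * (ip4 (B.getD e 0) (B.getD d 0) : ℤ)) =
        (if a = d then 2 else 0) + 64 * ∑ e : Fin 7, (ip4 (B.getD e 0) (B.getD d 0) : ℤ) := by
      have e1 : (cond (Nat.beq a d) 2 0 : ℕ) = if a = d then 2 else 0 := by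
        by_cases had : a = d
        · simp [had]
        · have : Nat.beq a d = false := by
            rw [Bool.eq_false_iff, Ne, Nat.beq_eq]
            exact fun e => had (Fin.ext e)
          rw [this, cond_false, if_neg had]
      rw [e1] at h
      exact_mod_cast h
    simp only [b, hdot, hk, P]
    have e2 : (∑ e : Fin 7, ((entry t a e : ℤ) - 64) *
        (4 * (ip4 (B.getD e 0) (B.getD d 0) : ℤ))) =
        4 * ((∑ e : Fin 7, (entry t a e : ℤ) * (ip4 (B.getD e 0) (B.getD d 0) : ℤ)) -
          64 * ∑ e : Fin 7, (ip4 (B.getD e 0) (B.getD d 0) : ℤ)) := by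
      rw [Finset.mul_sum, ← Finset.sum_sub_distrib, Finset.mul_sum]
      exact Finset.sum_congr rfl fun e _ => by ring
    rw [e2, h']
    split_ifs <;> ring
  have hsum : ∀ x : Fin 8 → ℤ, x ⬝ᵥ (∑ a, y a • b a) = ∑ a, y a * (x ⬝ᵥ b a) := fun x => by
    rw [dotProduct_sum]
    exact Finset.sum_congr rfl fun a _ => by rw [dotProduct_smul, smul_eq_mul]
  have hz : (2 : ℤ) • f w - ∑ a, y a • b a = 0 := by
    refine eq_zero_of_orthogonal b P (fun a => (hf.mem _).2) hP (fun d => ?_) ?_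
    · rw [dotProduct_sub, hsum, dotProduct_smul, smul_eq_mul, dotProduct_comm, hc]
      simp only [y, Finset.sum_mul]
      rw [Finset.sum_comm]
      have : ∀ e, ∑ a, (c (k e) : ℤ) * P e a * (b d ⬝ᵥ b a) =
          (c (k e) : ℤ) * if e = d then 8 else 0 := fun e => by
        rw [← hP e d, Finset.mul_sum]
        exact Finset.sum_congr rfl fun a _ => by rw [dotProduct_comm (b d)]; ring
      simp only [this]
      simp
      ring
    · rw [sub_dotProduct, smul_dotProduct, (hf.mem w).2, dotProduct_comm, hsum]
      have h0 : ∀ a, (1 : Fin 8 → ℤ) ⬝ᵥ b a = 0 := fun a => by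
        rw [dotProduct_comm]
        exact (hf.mem (φ (k a))).2
      simp [h0]
  rw [sub_eq_zero] at hz
  have hv : ∀ x, ∑ a : Fin 7, y a * (ip4 (L.get x) (B.getD a 0) : ℤ) = 2 * c x := by
    intro x
    have h1 := hsum (f (φ x))
    rw [← hz, dotProduct_smul, smul_eq_mul, dotProduct_comm, hc] at h1
    simp only [b, hdot, hk] at h1
    have h2 : ∑ a : Fin 7, y a * (4 * (ip4 (L.get x) (B.getD a 0) : ℤ)) =
        4 * ∑ a : Fin 7, y a * (ip4 (L.get x) (B.getD a 0) : ℤ) := by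
      rw [Finset.mul_sum]
      exact Finset.sum_congr rfl fun a _ => by ring
    rw [h2] at h1
    linarith
  have hnorm : ∑ a, y a * (c (k a) : ℤ) = 4 := by
    have h1 := hsum (f w)
    rw [← hz, dotProduct_smul, smul_eq_mul, dotProduct_self_rootsE7 (hf.mem w)] at h1
    simp only [b, hc] at h1
    have h2 : ∑ a : Fin 7, y a * (4 * (c (k a) : ℤ)) =
        4 * ∑ a : Fin 7, y a * (c (k a) : ℤ) := by
      rw [Finset.mul_sum]
      exact Finset.sum_congr rfl fun a _ => by ring
    rw [h2] at h1
    linarith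
  have h := hext n hn
  have e1 : Nat.beq (sum7 fun a => Nat.mul (bt n a) (prodN t n a))
      (Nat.add 4 (Nat.mul 64 (Nat.mul (sum7 (bt n)) (sum7 (bt n))))) = true := by
    rw [Nat.beq_eq]
    have : (∑ a : Fin 7, (bt n a : ℤ) * (prodN t n a : ℤ)) =
        4 + 64 * ((sum7 (bt n) : ℤ) * (sum7 (bt n) : ℤ)) := by
      rw [← hnorm]
      have e : (sum7 (bt n) : ℤ) * (sum7 (bt n) : ℤ) =
          ∑ a : Fin 7, (sum7 (bt n) : ℤ) * (bt n a : ℤ) := by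
        rw [← Finset.mul_sum]
        rw [sum7_eq, Nat.cast_sum]
      rw [e, Finset.mul_sum, ← Finset.sum_add_distrib]
      refine Finset.sum_congr rfl fun a _ => ?_
      rw [hy, hbits]
      ring
    rw [sum7_eq]
    simp only [Nat.mul_eq, Nat.add_eq]
    exact_mod_cast this
  rw [extensionCheck, e1, cond_true, List.any_eq_true] at h
  obtain ⟨v, hvL, hcon⟩ := h
  obtain ⟨x, rfl⟩ := List.get_of_mem hvL
  have h1 := hv x
  have h2 : (∑ a : Fin 7, (ip4 (L.get x) (B.getD a 0) : ℤ) * (prodN t n a : ℤ)) = 2 * c x +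
      64 * ((sum7 (bt n) : ℤ) * ∑ a : Fin 7, (ip4 (L.get x) (B.getD a 0) : ℤ)) := by
    rw [← h1, Finset.mul_sum, Finset.mul_sum, ← Finset.sum_add_distrib]
    refine Finset.sum_congr rfl fun a _ => ?_
    rw [hy]
    ring
  have h3 : (∑ a : Fin 7, ip4 (L.get x) (B.getD a 0) * prodN t n a) = 2 * c x +
      64 * (sum7 (bt n) * ∑ a : Fin 7, ip4 (L.get x) (B.getD a 0)) := by
    exact_mod_cast h2
  simp only [Bool.and_eq_true, Bool.not_eq_true', Bool.eq_false_iff, Ne, Nat.beq_eq] at hcon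
  rw [sum7_eq fun a => Nat.mul (ip4 (L.get x) (B.getD a 0)) (prodN t n a),
    sum7_eq fun a => ip4 (L.get x) (B.getD a 0)] at hcon
  simp only [Nat.mul_eq, Nat.add_eq] at hcon
  rcases hc01 x with h0 | h0 <;> rw [h0] at h3
  · exact hcon.1 (by rw [h3]; ring)
  · exact hcon.2 (by rw [h3])

/-! ### The 39 graphs are pairwise non-isomorphic -/

/-- The number of sequences of `n + 1` pairwise adjacent roots in a list. -/
def cliqueCount : ℕ → List ℕ → ℕ
  | 0, l => l.length
  | n + 1, l => (l.map fun x => cliqueCount n (l.filter (tb (adM x)))).sum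

/-- The sum of the fourth powers of the degrees. -/
def degreeSum (l : List ℕ) : ℕ := (l.map fun x => (l.filter (tb (adM x))).length ^ 4).sum

/-- The sum of the fourth powers of the degrees, plus the number of sequences of four pairwise
adjacent vertices where that sum alone does not determine the graph. -/
def fingerprint (l : List ℕ) : ℕ :=
  degreeSum l + cond ([103952, 120176, 125360, 149840].elem (degreeSum l)) (cliqueCount 3 l) 0

theorem cliqueCount_perm (n : ℕ) : ∀ {l m : List ℕ}, l.Perm m →
    cliqueCount n l = cliqueCount n m := by
  induction n with
  | zero => exact fun h => h.length_eq
  | succ n ih =>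
    intro l m h
    rw [cliqueCount, cliqueCount, (h.map _).sum_eq]
    congr 2
    funext x
    exact ih (h.filter _)

theorem filter_map_congr {β : Type*} (g g' : β → ℕ) (s : List β)
    (h : ∀ x y, tb (adM (g x)) (g y) = tb (adM (g' x)) (g' y)) (x : β) :
    (s.map g).filter (tb (adM (g x))) = (s.filter fun y => tb (adM (g x)) (g y)).map g ∧
      (s.map g').filter (tb (adM (g' x))) = (s.filter fun y => tb (adM (g x)) (g y)).map g' := by
  rw [List.filter_map, List.filter_map]
  refine ⟨rfl, ?_⟩
  congr 2
  funext y
  exact (h x y).symm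

theorem cliqueCount_map {β : Type*} (g g' : β → ℕ)
    (h : ∀ x y, tb (adM (g x)) (g y) = tb (adM (g' x)) (g' y)) (n : ℕ) :
    ∀ s : List β, cliqueCount n (s.map g) = cliqueCount n (s.map g') := by
  induction n with
  | zero => simp [cliqueCount]
  | succ n ih =>
    intro s
    rw [cliqueCount, cliqueCount, List.map_map, List.map_map]
    congr 2
    funext x
    simp only [Function.comp]
    rw [(filter_map_congr g g' s h x).1, (filter_map_congr g g' s h x).2, ih]

theorem degreeSum_perm {l m : List ℕ} (h : l.Perm m) : degreeSum l = degreeSum m := by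
  rw [degreeSum, degreeSum, (h.map _).sum_eq]
  congr 2
  funext x
  rw [(h.filter _).length_eq]

theorem degreeSum_map {β : Type*} (g g' : β → ℕ)
    (h : ∀ x y, tb (adM (g x)) (g y) = tb (adM (g' x)) (g' y)) (s : List β) :
    degreeSum (s.map g) = degreeSum (s.map g') := by
  rw [degreeSum, degreeSum, List.map_map, List.map_map]
  congr 2
  funext x
  simp only [Function.comp]
  rw [(filter_map_congr g g' s h x).1, (filter_map_congr g g' s h x).2, List.length_map,
    List.length_map]

theorem fingerprint_perm {l m : List ℕ} (h : l.Perm m) : fingerprint l = fingerprint m := by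
  rw [fingerprint, fingerprint, cliqueCount_perm 3 h, degreeSum_perm h]

theorem fingerprint_map {β : Type*} (g g' : β → ℕ)
    (h : ∀ x y, tb (adM (g x)) (g y) = tb (adM (g' x)) (g' y)) (s : List β) :
    fingerprint (s.map g) = fingerprint (s.map g') := by
  rw [fingerprint, fingerprint, cliqueCount_map g g' h 3 s, degreeSum_map g g' h s]

theorem rootGraph_adj_iff {L : List ℕ} (hL : L ∈ maximalLists) (a b : Fin L.length) :
    (rootGraph L).Adj a b ↔ tb (adM (L.get a)) (L.get b) = true := by
  have ha := lt_of_mem hL (L.get_mem a)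
  have hb := lt_of_mem hL (L.get_mem b)
  rw [tb_eq, adM_testBit ha]
  constructor
  · exact fun h => ⟨hb, h.2⟩
  · refine fun h => ⟨fun e => ?_, h.2⟩
    rw [e, ip_self (by omega)] at h
    omega

theorem fingerprint_eq_of_iso {L L' : List ℕ} (hL : L ∈ maximalLists) (hL' : L' ∈ maximalLists)
    (e : rootGraph L ≃g rootGraph L') : fingerprint L = fingerprint L' := by
  have h1 : ((List.finRange L.length).map e).Perm (List.finRange L'.length) := by
    refine (List.perm_ext_iff_of_nodup ((List.nodup_finRange _).map e.injective)
      (List.nodup_finRange _)).mpr fun a => ?_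
    simp only [List.mem_map, List.mem_finRange, true_and, iff_true]
    exact e.surjective a
  have h2 := fingerprint_perm (h1.map L'.get)
  rw [List.map_get_finRange, List.map_map] at h2
  rw [← h2]
  conv_lhs => rw [← List.map_get_finRange L]
  refine fingerprint_map _ _ (fun a b => ?_) _
  rw [Bool.eq_iff_iff, ← rootGraph_adj_iff hL, Function.comp, Function.comp,
    ← rootGraph_adj_iff hL', e.map_adj_iff]

theorem fingerprints : maximalLists.map fingerprint = [1769472, 163952, 118832, 162416, 104720, 126800, 146768, 126752, 142448, 171632, 121520,
   152000, 194864, 104912, 147152, 143792, 177392, 121424, 151952, 174320, 196208, 167792,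
   191408, 169136, 202256, 174704, 223664, 281072, 71792, 203024, 276136, 254728, 275512,
   285256, 316168, 376794, 477680, 462776, 705552] := by
  decide +kernel

theorem eq_of_iso {i j : ℕ} (hi : i < maximalLists.length) (hj : j < maximalLists.length)
    (e : rootGraph maximalLists[i] ≃g rootGraph maximalLists[j]) : i = j := by
  have h := fingerprint_eq_of_iso (List.getElem_mem _) (List.getElem_mem _) e
  have hn : (maximalLists.map fingerprint).Nodup := by
    rw [fingerprints]
    decide +kernel
  refine (hn.getElem_inj_iff (hi := by simpa using hi) (hj := by simpa using hj)).mp ?_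
  rw [List.getElem_map, List.getElem_map, h]

/-! ### Cone graphs -/

theorem isConeGraph_iff {V : Type u} (G : SimpleGraph V) :
    IsConeGraph G ↔ ∃ v, ∀ w, w ≠ v → G.Adj v w := by
  classical
  constructor
  · rintro ⟨W, H, ⟨e⟩⟩
    refine ⟨e.symm none, fun w hw => ?_⟩
    rw [← e.map_adj_iff, e.apply_symm_apply]
    cases h : e w with
    | none => exact absurd (by rw [← h, e.symm_apply_apply]) hw
    | some a => exact cone_adj_none H a
  · rintro ⟨v, hv⟩
    refine ⟨{w // w ≠ v}, G.comap Subtype.val, ⟨Iso.symm ⟨Equiv.optionSubtypeNe v, ?_⟩⟩⟩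
    rintro (_ | a) (_ | b)
    · simp
    · simpa using iff_of_true (hv b b.2) (cone_adj_none _ b)
    · simpa using iff_of_true (hv a a.2).symm (cone_adj_none _ a).symm
    · simp [cone_adj_some]

/-- Whether some root in a list is adjacent to all the others. -/
def dominated (L : List ℕ) : Bool :=
  L.any fun x => L.all fun y => Nat.beq x y || tb (adM x) y

theorem get_injective {L : List ℕ} (hL : L ∈ maximalLists) : Function.Injective L.get :=
  fun _ _ e => (isE7Representation_rootGraph hL).injective (congrArg rt e)

theorem isConeGraph_iff_dominated {L : List ℕ} (hL : L ∈ maximalLists) :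
    IsConeGraph (rootGraph L) ↔ dominated L = true := by
  rw [isConeGraph_iff, dominated, List.any_eq_true]
  simp only [List.all_eq_true, Bool.or_eq_true, Nat.beq_eq]
  constructor
  · rintro ⟨a, ha⟩
    refine ⟨L.get a, L.get_mem a, fun y hy => ?_⟩
    obtain ⟨b, rfl⟩ := List.get_of_mem hy
    by_cases hab : b = a
    · exact Or.inl (by rw [hab])
    · exact Or.inr ((rootGraph_adj_iff hL a b).mp (ha b hab))
  · rintro ⟨x, hx, h⟩
    obtain ⟨a, rfl⟩ := List.get_of_mem hx
    refine ⟨a, fun b hb => (rootGraph_adj_iff hL a b).mpr ((h _ (L.get_mem b)).resolve_left ?_)⟩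
    exact fun e => hb (get_injective hL e).symm

theorem map_dominated : maximalLists.map dominated =
    false :: (List.replicate 27 true ++ List.replicate 11 false) := by
  decide +kernel

/-! ### Graphs that are not switching-equivalent to line graphs -/

/-- The vector in `ℤ⁸` that represents an edge of a graph on eight vertices. -/
def edgeVector (e : Sym2 (Fin 8)) : Fin 8 → ℤ := fun k => if k ∈ e then 3 else -1

theorem sum_pair_mul_pair : ∀ a b c d : Fin 8, a ≠ b → c ≠ d →
    (∑ k, (if k = a ∨ k = b then 3 else -1) * (if k = c ∨ k = d then 3 else -1) : ℤ) =
      8 * if (a = c ∧ b = d) ∨ (a = d ∧ b = c) then 3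
        else if a = c ∨ a = d ∨ b = c ∨ b = d then 1 else -1 := by
  decide +kernel

open Classical in
theorem edgeVector_dotProduct {H : SimpleGraph (Fin 8)} (e f : H.edgeSet) :
    edgeVector e ⬝ᵥ edgeVector f =
      8 * if e = f then 3 else if H.lineGraph.Adj e f then 1 else -1 := by
  obtain ⟨e, he⟩ := e
  obtain ⟨f, hf⟩ := f
  induction e using Sym2.ind with | _ a b
  induction f using Sym2.ind with | _ c d
  have h1 : s(a, b) = s(c, d) ↔ (a = c ∧ b = d) ∨ (a = d ∧ b = c) := by simp
  have h2 : (∃ v, v ∈ s(a, b) ∧ v ∈ s(c, d)) ↔ a = c ∨ a = d ∨ b = c ∨ b = d := by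
    simp only [Sym2.mem_iff]
    constructor
    · rintro ⟨v, rfl | rfl, rfl | rfl⟩ <;> simp
    · rintro (rfl | rfl | rfl | rfl)
      exacts [⟨a, by simp⟩, ⟨a, by simp⟩, ⟨b, by simp⟩, ⟨b, by simp⟩]
  have h := sum_pair_mul_pair a b c d (H.ne_of_adj he) (H.ne_of_adj hf)
  simp only [edgeVector, dotProduct, Sym2.mem_iff] at h ⊢
  rw [h]
  simp only [lineGraph_adj_iff_exists, Subtype.mk.injEq, h1, h2, ne_eq]
  congr 1
  by_cases h3 : (a = c ∧ b = d) ∨ (a = d ∧ b = c)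
  · rw [if_pos h3, if_pos h3]
  · simp only [h3, if_false, not_false_eq_true, true_and]

/-- A vector at which the form `3 I + A - Ā` is negative shows that a graph is not
switching-equivalent to the line graph of a graph on eight vertices. -/
theorem not_inS8 {V : Type u} [Fintype V] (G : SimpleGraph V) (z : V → ℤ) (S : V → V → ℤ)
    (h3 : ∀ a, S a a = 3) (h1 : ∀ a b, G.Adj a b → S a b = 1)
    (h0 : ∀ a b, a ≠ b → ¬ G.Adj a b → S a b = -1) (hz : ∑ a, ∑ b, z a * z b * S a b < 0) :
    ¬ InS8 G := by
  classical
  rintro ⟨H, X, ⟨φ⟩⟩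
  let ε : V → ℤ := fun a => if a ∈ X then 1 else -1
  have key : ∀ a b, ε a * ε b * (edgeVector (φ a) ⬝ᵥ edgeVector (φ b)) = 8 * S a b := by
    intro a b
    rw [edgeVector_dotProduct, φ.map_adj_iff, seidelSwitch_adj]
    by_cases hab : a = b
    · simp only [hab, if_true, h3, ε]
      split_ifs <;> norm_num
    · rw [if_neg fun e => hab (φ.injective e)]
      by_cases hadj : G.Adj a b
      · rw [h1 a b hadj]
        by_cases ha : a ∈ X <;> by_cases hb : b ∈ X <;> simp [ε, ha, hb, hab, hadj]
      · rw [h0 a b hab hadj]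
        by_cases ha : a ∈ X <;> by_cases hb : b ∈ X <;> simp [ε, ha, hb, hab, hadj]
  have hsq : (∑ a, (z a * ε a) • edgeVector (φ a)) ⬝ᵥ (∑ a, (z a * ε a) • edgeVector (φ a)) =
      8 * ∑ a, ∑ b, z a * z b * S a b := by
    rw [sum_dotProduct, Finset.mul_sum]
    refine Finset.sum_congr rfl fun a _ => ?_
    rw [dotProduct_sum, Finset.mul_sum]
    refine Finset.sum_congr rfl fun b _ => ?_
    rw [smul_dotProduct, dotProduct_smul, smul_eq_mul, smul_eq_mul]
    linear_combination z a * z b * key a b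
  have hnn : 0 ≤ (∑ a, (z a * ε a) • edgeVector (φ a)) ⬝ᵥ
      (∑ a, (z a * ε a) • edgeVector (φ a)) :=
    Finset.sum_nonneg fun k _ => mul_self_nonneg _
  omega

/-- Vectors at which the forms of the last eleven graphs are negative. -/
def negativeVectors : List (List ℤ) := [[1, 0, -4, 0, -4, 0, 0, 1, 1, -4, -4, -4, -4, -4],
   [-4, -4, 4, 3, 3, 4, 4, 2, 2, 4, 3, 3, -4, 4, 4, 4, 4],
   [-4, 2, 4, -2, 0, -1, 3, 1, 0, -1, 1, 2, 4, 4, -1, 3, 4, 4],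
   [-4, 2, 4, 1, -1, -2, 4, 4, 4, -2, -1, 1, 4, 4, 2, 4, 4, 4],
   [4, 0, -4, -3, -1, 4, -4, -4, -3, -4, 1, 3, 0, -4, -4, -4, -4, -4],
   [-4, -4, 4, 4, 0, 0, 4, 4, 4, 4, 4, 0, 0, -4, 4, 4, 4, 4],
   [-4, -4, 4, 4, 3, 4, 4, 4, 4, 3, 0, 0, -1, -1, 0, 1, 4, 4],
   [-4, -4, 4, 4, 2, 1, 4, 4, 4, 2, 2, 3, -3, -3, -1, 4, 4, 4, 4],
   [4, 4, -4, -4, -4, -4, -4, -4, -4, -4, -4, 4, 4, 4, -4, -4, -4, -4, -4, -4],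
   [-3, -2, 4, 4, -2, 0, 4, 4, 4, -1, 0, 0, -3, -3, 4, 4, 3, 4, 4, 4],
   [-1, 0, 2, 0, 0, -1, 4, 0, -1, -1, 3, -2, -2, 2, 1, 2, 2, 3, 2, 2, 1, -1]]

/-- The entry of `3 I + A - Ā` for two roots. -/
def switchForm (x y : ℕ) : ℤ := cond (Nat.beq x y) 3 (cond (tb (adM x) y) 1 (-1))

/-- The value of the form at a vector of coefficients. -/
def formValue (L : List ℕ) (z : List ℤ) : ℤ :=
  ∑ a : Fin L.length, ∑ b : Fin L.length,
    z.getD a 0 * z.getD b 0 * switchForm (L.get a) (L.get b)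

theorem formValue_neg : ∀ k < 11,
    formValue (maximalLists.getD (28 + k) []) (negativeVectors.getD k []) < 0 := by
  decide +kernel

theorem not_inS8_of_formValue_neg {L : List ℕ} (hL : L ∈ maximalLists) {z : List ℤ}
    (hz : formValue L z < 0) : ¬ InS8 (rootGraph L) := by
  have hne : ∀ a b : Fin L.length, a ≠ b → Nat.beq (L.get a) (L.get b) = false := by
    intro a b hab
    rw [Bool.eq_false_iff, Ne, Nat.beq_eq]
    exact fun e => hab (get_injective hL e)
  refine not_inS8 (rootGraph L) (fun a => z.getD a 0)
    (fun a b => switchForm (L.get a) (L.get b)) (fun a => ?_) (fun a b h => ?_)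
    (fun a b hab h => ?_) hz
  · rw [switchForm, Nat.beq_refl, cond_true]
  · rw [switchForm, hne a b h.ne, (rootGraph_adj_iff hL a b).mp h]
    rfl
  · rw [rootGraph_adj_iff hL, Bool.not_eq_true] at h
    rw [switchForm, hne a b hab, h]
    rfl

/-! ### The Schläfli graph -/

/-- Edges of `K₈` that correspond to the vertices of the Schläfli graph. -/
def edgeList : List (Fin 8 × Fin 8) := [(0, 2), (0, 3), (0, 4), (0, 5), (0, 6), (0, 7), (6, 7), (5, 7), (5, 6), (4, 7), (4, 6),
   (4, 5), (1, 3), (2, 4), (2, 5), (2, 6), (2, 7), (1, 2), (3, 4), (3, 5), (3, 6), (3, 7),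
   (2, 3), (1, 4), (1, 5), (1, 6), (1, 7)]

/-- The ends of the edge that corresponds to a position in the first list. -/
def edgeAt (k : ℕ) : Fin 8 × Fin 8 := edgeList.getD k (0, 1)

/-- Whether two pairs have an element in common. -/
def meets (p q : Fin 8 × Fin 8) : Bool :=
  p.1 == q.1 || p.1 == q.2 || p.2 == q.1 || p.2 == q.2

theorem lineGraph_top_adj {a b c d : Fin 8} (h : s(a, b) ∈ (⊤ : SimpleGraph (Fin 8)).edgeSet)
    (h' : s(c, d) ∈ (⊤ : SimpleGraph (Fin 8)).edgeSet) :
    (⊤ : SimpleGraph (Fin 8)).lineGraph.Adj ⟨s(a, b), h⟩ ⟨s(c, d), h'⟩ ↔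
      s(a, b) ≠ s(c, d) ∧ meets (a, b) (c, d) = true := by
  rw [lineGraph_adj_iff_exists, Ne, Subtype.mk.injEq]
  refine and_congr_right fun _ => ?_
  simp only [Sym2.mem_iff, meets, Bool.or_eq_true, beq_iff_eq]
  constructor
  · rintro ⟨v, rfl | rfl, rfl | rfl⟩ <;> simp
  · rintro (((rfl | rfl) | rfl) | rfl)
    exacts [⟨a, by simp⟩, ⟨a, by simp⟩, ⟨b, by simp⟩, ⟨b, by simp⟩]

theorem edgeAt_ne : ∀ k < 27, (edgeAt k).1 ≠ (edgeAt k).2 ∧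
    s((edgeAt k).1, (edgeAt k).2) ≠ s((0 : Fin 8), 1) := by
  decide +kernel

theorem exists_edgeAt : ∀ a b : Fin 8, a ≠ b → s(a, b) ≠ s((0 : Fin 8), 1) →
    ∃ k : Fin 27, s((edgeAt k).1, (edgeAt k).2) = s(a, b) := by
  decide +kernel

theorem edgeAt_adj : ∀ i < 27, ∀ j < 27,
    tb (adM ((maximalLists.getD 0 []).getD i 0)) ((maximalLists.getD 0 []).getD j 0) =
      (!Nat.beq i j && (meets (edgeAt i) (edgeAt j) ==
        (meets (0, 1) (edgeAt i) == meets (0, 1) (edgeAt j)))) := by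
  decide +kernel

theorem edgeAt_injective : ∀ i < 27, ∀ j < 27,
    s((edgeAt i).1, (edgeAt i).2) = s((edgeAt j).1, (edgeAt j).2) → i = j := by
  decide +kernel

theorem length_maximalLists_zero : (maximalLists.getD 0 []).length = 27 := by decide +kernel

theorem maximalLists_zero_mem : maximalLists.getD 0 [] ∈ maximalLists := by decide +kernel

/-- The vertex of the Schläfli graph that corresponds to a position in the first list. -/
def toSchlaefli (k : Fin (maximalLists.getD 0 []).length) :
    {x : (⊤ : SimpleGraph (Fin 8)).edgeSet // x ≠ baseEdge} :=
  ⟨⟨s((edgeAt k).1, (edgeAt k).2), (edgeAt_ne k (lt_of_lt_of_eq k.2 length_maximalLists_zero)).1⟩,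
    fun e => (edgeAt_ne k (lt_of_lt_of_eq k.2 length_maximalLists_zero)).2 (congrArg Subtype.val e)⟩

theorem toSchlaefli_bijective : Function.Bijective toSchlaefli := by
  constructor
  · intro a b e
    exact Fin.ext (edgeAt_injective a (lt_of_lt_of_eq a.2 length_maximalLists_zero) b
      (lt_of_lt_of_eq b.2 length_maximalLists_zero) (congrArg (fun x => x.1.1) e))
  · rintro ⟨⟨x, hx⟩, hne⟩
    induction x using Sym2.ind with | _ a b
    obtain ⟨k, hk⟩ := exists_edgeAt a b hx fun e => hne (Subtype.ext e)
    exact ⟨⟨k, lt_of_lt_of_eq k.2 length_maximalLists_zero.symm⟩, Subtype.ext (Subtype.ext hk)⟩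

theorem nonempty_iso_schlaefliGraph :
    Nonempty (rootGraph (maximalLists.getD 0 []) ≃g schlaefliGraph) := by
  refine ⟨⟨Equiv.ofBijective toSchlaefli toSchlaefli_bijective, ?_⟩⟩
  intro a b
  have ha := lt_of_lt_of_eq a.2 length_maximalLists_zero
  have hb := lt_of_lt_of_eq b.2 length_maximalLists_zero
  rw [rootGraph_adj_iff maximalLists_zero_mem]
  have e : ∀ k : Fin (maximalLists.getD 0 []).length,
      (maximalLists.getD 0 []).get k = (maximalLists.getD 0 []).getD k 0 := fun k =>
    (List.getD_eq_getElem _ _ k.2).symm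
  rw [e a, e b, edgeAt_adj a ha b hb]
  have hN : ∀ k : Fin (maximalLists.getD 0 []).length,
      (toSchlaefli k).1 ∈ (⊤ : SimpleGraph (Fin 8)).lineGraph.neighborSet baseEdge ↔
        meets (0, 1) (edgeAt k) = true := fun k => by
    refine (lineGraph_top_adj _ _).trans (and_iff_right ?_)
    exact fun e => (toSchlaefli k).2 (Subtype.ext e.symm)
  change (seidelSwitch (⊤ : SimpleGraph (Fin 8)).lineGraph _).Adj (toSchlaefli a).1
    (toSchlaefli b).1 ↔ _
  rw [seidelSwitch_adj, hN a, hN b]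
  by_cases hab : a = b
  · simp [hab]
  · have hne : (toSchlaefli a).1 ≠ (toSchlaefli b).1 := fun e =>
      hab (toSchlaefli_bijective.1 (Subtype.ext e))
    have hadj : (⊤ : SimpleGraph (Fin 8)).lineGraph.Adj (toSchlaefli a).1 (toSchlaefli b).1 ↔
        meets (edgeAt a) (edgeAt b) = true :=
      (lineGraph_top_adj _ _).trans (and_iff_right fun e => hne (Subtype.ext e))
    have hbeq : Nat.beq a b = false := by
      rw [Bool.eq_false_iff, Ne, Nat.beq_eq]
      exact fun e => hab (Fin.ext e)
    rw [hadj, hbeq, Bool.not_false, Bool.true_and, and_iff_right hne]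
    cases meets (edgeAt a) (edgeAt b) <;> cases meets (0, 1) (edgeAt a) <;>
      cases meets (0, 1) (edgeAt b) <;> simp

/-! ### The maximal representable graphs -/

theorem length_maximalLists : maximalLists.length = 39 := by decide +kernel

theorem isMaximal_iff {V : Type u} (G : SimpleGraph V) :
    IsMaximalE7Representable G ↔ ∃ L ∈ maximalLists, Nonempty (G ≃g rootGraph L) := by
  constructor
  · rintro ⟨hG, hmax⟩
    obtain ⟨L, hL, ⟨φ⟩⟩ := exists_embedding hG
    let e : ULift.{u} (Fin L.length) ≃ Fin L.length := Equiv.ulift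
    let H : SimpleGraph (ULift.{u} (Fin L.length)) := (rootGraph L).comap e
    let ψ : H ≃g rootGraph L := Iso.comap e (rootGraph L)
    have hr := isE7Representation_rootGraph hL
    have hH : E7Representable H :=
      ⟨fun a => rt (L.get (ψ a)), fun a => hr.mem _, hr.injective.comp ψ.injective,
        fun a b h => hr.adj _ _ (ψ.map_adj_iff.mpr h), fun a b hab h =>
          hr.not_adj _ _ (fun e => hab (ψ.injective e)) fun h' => h (ψ.map_adj_iff.mp h')⟩
    obtain ⟨χ⟩ := hmax _ H hH ⟨ψ.symm.toEmbedding.comp φ⟩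
    exact ⟨L, hL, ⟨ψ.comp χ⟩⟩
  · rintro ⟨L, hL, ⟨φ⟩⟩
    have hr := isE7Representation_rootGraph hL
    refine ⟨⟨fun a => rt (L.get (φ a)), fun a => hr.mem _, hr.injective.comp φ.injective,
        fun a b h => hr.adj _ _ (φ.map_adj_iff.mpr h), fun a b hab h =>
          hr.not_adj _ _ (fun e => hab (φ.injective e)) fun h' => h (φ.map_adj_iff.mp h')⟩,
      fun W H hH ⟨χ⟩ => ?_⟩
    let ψ : rootGraph L ↪g H := χ.comp φ.symm.toEmbedding
    have hψ := surjective_of_embedding hL hH ψ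
    exact ⟨Iso.comp ⟨Equiv.ofBijective ψ ⟨ψ.injective, hψ⟩, ψ.map_rel_iff⟩ φ⟩

end MaximalE7

theorem mainTheorem9 :
    ∃ (n : Fin 39 → ℕ) (M : ∀ i, SimpleGraph (Fin (n i))),
      -- the 39 graphs are pairwise non-isomorphic
      (∀ i j, Nonempty (M i ≃g M j) → i = j) ∧
      -- up to isomorphism they are exactly the maximal representable graphs
      (∀ (V : Type u) (G : SimpleGraph V),
        MaximalE7.IsMaximalE7Representable G ↔ ∃ i, Nonempty (G ≃g M i)) ∧
      -- one of them is the Schläfli graph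
      Nonempty (M 0 ≃g MaximalE7.schlaefliGraph) ∧
      -- exactly 27 of them are cone graphs
      (∀ i, MaximalE7.IsConeGraph (M i) ↔ 1 ≤ i.val ∧ i.val ≤ 27) ∧
      -- none of the remaining 11 lies in the class of switched line graphs
      (∀ i, 28 ≤ i.val → ¬ MaximalE7.InS8 (M i)) := by
  have hlen := MaximalE7.length_maximalLists
  have hlt : ∀ i : Fin 39, (i : ℕ) < MaximalE7.maximalLists.length := fun i => lt_of_lt_of_eq i.2 hlen.symm
  have hget : ∀ i : Fin 39, MaximalE7.maximalLists.getD i [] = MaximalE7.maximalLists[i.val]'(hlt i) :=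
    fun i => List.getD_eq_getElem _ _ (hlt i)
  have hmem : ∀ i : Fin 39, MaximalE7.maximalLists.getD i [] ∈ MaximalE7.maximalLists := fun i => by
    rw [hget]
    exact List.getElem_mem _
  refine ⟨fun i => (MaximalE7.maximalLists.getD i []).length,
    fun i => MaximalE7.rootGraph (MaximalE7.maximalLists.getD i []), ?_, ?_,
    MaximalE7.nonempty_iso_schlaefliGraph, ?_, ?_⟩
  · rintro i j ⟨e⟩
    exact Fin.ext (MaximalE7.eq_of_iso (hlt i) (hlt j) (hget i ▸ hget j ▸ e))
  · intro V G
    rw [MaximalE7.isMaximal_iff]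
    constructor
    · rintro ⟨L, hL, h⟩
      obtain ⟨i, hi, e⟩ := List.getElem_of_mem hL
      have e' := (hget ⟨i, lt_of_lt_of_eq hi hlen⟩).trans e
      subst e'
      exact ⟨_, h⟩
    · rintro ⟨i, h⟩
      exact ⟨_, hmem i, h⟩
  · intro i
    rw [MaximalE7.isConeGraph_iff_dominated (hmem i)]
    have h : ∀ i : Fin 39, (MaximalE7.maximalLists.map MaximalE7.dominated).getD i false = true ↔
        1 ≤ i.val ∧ i.val ≤ 27 := by
      rw [MaximalE7.map_dominated]
      decide +kernel
    have hd : (MaximalE7.maximalLists.map MaximalE7.dominated).getD i false =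
        MaximalE7.dominated MaximalE7.maximalLists[i.val] := by
      rw [List.getD_eq_getElem _ _ (by simpa using hlt i), List.getElem_map]
    rw [← h i, hd, hget]
  · intro i hi
    have h := MaximalE7.formValue_neg (i - 28) (by omega)
    rw [show 28 + (i.val - 28) = i.val by omega] at h
    exact MaximalE7.not_inS8_of_formValue_neg (hmem i) h
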